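/- \textbf{Setting.} Let $\mathcal C$ be the class of closed (upper semicontinuous) proper concave functions $\mathbb R\to[-\infty,\infty)$, $\mathcal{SC}_0$ its members symmetric about $0$, $\mathrm{dom}(\psi)=\{\psi>-\infty\}$, and $\mathcal{LC}$ the class of probability densities $f$ on $\mathbb R$ with $\log f\in\mathcal C$. Let $X_1,X_2,\dots$ be i.i.d. with a density $f_0$ symmetric about $\theta_0$; put $g_0=f_0(\cdot+\theta_0)$, $\psi_0=\log g_0$, and let $F_0$ be the distribution of $f_0$ and $\mathbb F_n$ the empirical distribution of $X_1,\dots,X_n$. Let $\mathcal P_1$ be the set of bounded densities on $\mathbb R$ with a finite first absolute moment that are symmetric about some point, and $\mathcal P_0$ the set of densities $g(\cdot-\theta)$ with $\theta\in\mathbb R$, $g\in\mathcal{LC}$ symmetric about $0$, and finite Fisher information for location (i.e. the density $f=g(\cdot-\theta)$ is absolutely continuous with an $L_1$-derivative $f'$ and $\int (f'/f)^2f<\infty$). Derivatives $h'$ are right derivatives. \textbf{Estimators.} Let $\bar\theta_n\to_p\theta_0$ and $y_n\to_p0$ be random variables. Let $\hat f_n$ be the maximum likelihood estimator of $f_0$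 in $\mathcal{LC}$ based on $X_1,\dots,X_n$, and let $$\hat g_n^{sym}(z)=\tfrac12\{\hat f_n(\bar\theta_n+z)+\hat f_n(\bar\theta_n-z)\},\qquad \hat g_n^{geo}(z)=C_n\{\hat f_n(\bar\theta_n+z)\hat f_n(\bar\theta_n-z)\}^{1/2},$$ with $C_n$ the constant making $\hat g_n^{geo}$ integrate to one. Let $\hat g_{\bar\theta_n}=e^{\hat\psi}$, where $\hat\psi$ maximizes $\int\psi(x-\bar\theta_n)\,d\mathbb F_n(x)-\int e^{\psi(x-\bar\theta_n)}dx$ over $\psi\in\mathcal{SC}_0$ (the partial MLE). Let $\hat b_n^2$ be the sample variance (with divisor $n-1$) minus the variance of the density $\hat f_n$, and let $\hat f_n^{sm}$, $(\hat g_n^{sym})^{sm}$ be the convolutions of $\hat f_n$, $\hat g_n^{sym}$ with the $N(0,\hat b_n^2)$ density. \textbf{Limits.} For $f_0\in\mathcal P_1$ let $\tilde\varphi$ be the maximizer of $\int\varphi\,dF_0-\int e^{\varphi(x)}dx$ over $\varphi\in\mathcal C$, $\tilde f=e^{\tilde\varphi}$, $\tilde\psi=\tilde\varphi(\cdot+\theta_0)$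 and $\tilde g=e^{\tilde\psi}$. If also $\int z^2f_0(z)\,dz<\infty$, let $\tilde b^2=\int z^2(f_0(z)-\tilde f(z))\,dz$, let $\tilde g^{sm}$ be the convolution of $\tilde g$ with $N(0,\tilde b^2)$ (so $\tilde g^{sm}=\tilde g$ if $\tilde b^2=0$), and $\tilde\psi^{sm}=\log\tilde g^{sm}$. \textbf{Theorem.} 1. Let $f_0\in\mathcal P_1$. Then $\mathrm{int}\{g_0>0\}\subseteq\mathrm{int}(\mathrm{dom}(\tilde\psi))$, and for $\hat g_n$ equal to $\hat g_n^{sym}$, $\hat g_{\bar\theta_n}$, $\hat g_n^{geo}$, $\hat f_n(\bar\theta_n+\cdot)$ or $\hat f_n(\bar\theta_n-\cdot)$, with $(q,\psi)=(\tilde g,\tilde\psi)$: (A) $\sup_{x\in K}|\hat g_n(x+y_n)-q(x)|\to_p0$ for every compact $K\subset\mathrm{int}(\mathrm{dom}(\psi))$; (B) $\sup_{x\in K}|\log\hat g_n(x+y_n)-\psi(x)|\to_p0$ for every compact $K\subset\mathrm{int}(\mathrm{dom}(\psi))$; (C) $(\log\hat g_n)'(x+y_n)\to_p\psi'(x)$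 for every continuity point $x\in\mathrm{int}(\mathrm{dom}(\psi))$ of $\psi'$. If moreover $\int z^2f_0(z)\,dz<\infty$, then (A)--(C) hold for $\hat g_n$ equal to $(\hat g_n^{sym})^{sm}$, $\hat f_n^{sm}(\bar\theta_n+\cdot)$ or $\hat f_n^{sm}(\bar\theta_n-\cdot)$, with $(q,\psi)=(\tilde g^{sm},\tilde\psi^{sm})$; and if $\tilde b^2>0$ then $\mathrm{dom}(\tilde\psi^{sm})=\mathbb R$, so that every compact $K\subset\mathbb R$ is allowed. 2. Let $f_0\in\mathcal P_0$. Then for $\hat g_n$ equal to $\hat g_n^{sym}$, $(\hat g_n^{sym})^{sm}$, $\hat g_{\bar\theta_n}$ or $\hat g_n^{geo}$, (A)--(C) hold with $(q,\psi)=(g_0,\psi_0)$, and in (A) the supremum may be taken over all $x\in\mathbb R$. In both parts, if $\bar\theta_n\to\theta_0$ and $y_n\to0$ almost surely, then all these convergences in probability may be replaced by almost sure convergence. -/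

import Mathlib

open MeasureTheory ProbabilityTheory Filter Set
open scoped Topology ENNReal NNReal

namespace LogConcaveLocation

noncomputable section

/-! ### Concave functions, densities and the models -/

/-- Effective domain of a concave function with values in `[-∞, ∞]`. -/
def dom (φ : ℝ → EReal) : Set ℝ := {x | φ x ≠ ⊥}

/-- Closed proper concave functions `ℝ → [-∞, ∞)`: the hypograph is convex, the function is upper
semicontinuous, never `+∞`, and not identically `-∞`. -/
def ConcaveClass : Set (ℝ → EReal) :=
  {φ | Convex ℝ {p : ℝ × ℝ | (p.2 : EReal) ≤ φ p.1} ∧ UpperSemicontinuous φ ∧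
    (∀ x, φ x ≠ ⊤) ∧ ∃ x, φ x ≠ ⊥}

/-- Members of `ConcaveClass` that are symmetric about `θ`. -/
def SymConcaveClass (θ : ℝ) : Set (ℝ → EReal) :=
  {φ | φ ∈ ConcaveClass ∧ ∀ x, φ (θ + x) = φ (θ - x)}

/-- Probability densities on the real line. -/
def Densities : Set (ℝ → ℝ) :=
  {f | Measurable f ∧ (∀ x, 0 ≤ f x) ∧ ∫⁻ x, ENNReal.ofReal (f x) = 1}

/-- Densities symmetric about `θ`. -/
def SymDensities (θ : ℝ) : Set (ℝ → ℝ) :=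
  {f | f ∈ Densities ∧ ∀ x, f (θ + x) = f (θ - x)}

/-- The log-density `log f`, with `log 0 = -∞`. -/
def logDensity (f : ℝ → ℝ) (x : ℝ) : EReal := ENNReal.log (ENNReal.ofReal (f x))

/-- The function `exp φ`, as a real-valued function. -/
def expFun (φ : ℝ → EReal) (x : ℝ) : ℝ := (EReal.exp (φ x)).toReal

/-- Log-concave densities. -/
def LogConcaveDensities : Set (ℝ → ℝ) := {f | f ∈ Densities ∧ logDensity f ∈ ConcaveClass}

/-- Log-concave densities symmetric about `θ`. -/
def SymLogConcaveDensities (θ : ℝ) : Set (ℝ → ℝ) := LogConcaveDensities ∩ SymDensities θ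

/-- `f` is absolutely continuous on `ℝ` with `L¹`-derivative `f'`. -/
def HasL1Deriv (f f' : ℝ → ℝ) : Prop :=
  Integrable f' ∧ ∀ a b : ℝ, f b - f a = ∫ x in a..b, f' x

/-- Fisher information for location: `∫ (f'/f)² f` if `f` is absolutely continuous with an
`L¹`-derivative `f'` (which is unique up to null sets), and `∞` otherwise. -/
def fisherInformation (f : ℝ → ℝ) : ℝ≥0∞ :=
  ⨅ (f' : ℝ → ℝ) (_ : HasL1Deriv f f'), ∫⁻ x, ENNReal.ofReal ((f' x / f x) ^ 2 * f x)

/-- The log-concave symmetric location model. -/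
def ModelP0 : Set (ℝ → ℝ) :=
  {f | f ∈ Densities ∧ ∃ θ : ℝ, ∃ g ∈ SymLogConcaveDensities 0, (∀ x, f x = g (x - θ)) ∧
    fisherInformation f < ∞}

/-- Bounded symmetric densities with a finite first moment. -/
def ModelP1 : Set (ℝ → ℝ) :=
  {f | f ∈ Densities ∧ (∃ θ : ℝ, f ∈ SymDensities θ) ∧ BddAbove (Set.range f) ∧
    Integrable (fun x => |x| * f x)}

/-- The distribution with density `f`. -/
def law (f : ℝ → ℝ) : Measure ℝ := volume.withDensity fun x => ENNReal.ofReal (f x)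

/-! ### Criterion functions and projections -/

/-- The criterion `∫ φ dF - ∫ exp (φ x) dx`, where `∫ φ dF` is the integral of the positive part
minus the integral of the negative part. -/
def omegaCrit (φ : ℝ → EReal) (F : Measure ℝ) : EReal :=
  ((∫⁻ x, (φ x).toENNReal ∂F : ℝ≥0∞) : EReal) - ((∫⁻ x, (-φ x).toENNReal ∂F : ℝ≥0∞) : EReal)
    - ((∫⁻ x, EReal.exp (φ x) : ℝ≥0∞) : EReal)

/-- The criterion `∫ ψ (x - θ) dF(x) - ∫ exp (ψ (x - θ)) dx`. -/
def psiCrit (θ : ℝ) (ψ : ℝ → EReal) (F : Measure ℝ) : EReal :=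
  omegaCrit (fun x => ψ (x - θ)) F

/-- `φ` maximizes `omegaCrit · F` over all closed proper concave functions. -/
def IsLogConcaveProjection (F : Measure ℝ) (φ : ℝ → EReal) : Prop :=
  φ ∈ ConcaveClass ∧ ∀ φ' ∈ ConcaveClass, omegaCrit φ' F ≤ omegaCrit φ F

/-- The maximizer of `omegaCrit · F` over all closed proper concave functions. -/
def logProjection (F : Measure ℝ) : ℝ → EReal := Classical.epsilon (IsLogConcaveProjection F)

/-- The log-concave projection of a density. -/
def projDensity (f : ℝ → ℝ) : ℝ → ℝ := expFun (logProjection (law f))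

/-- The log-concave projection of `f`, recentred at `0` when `f` has centre `θ`. -/
def centeredProj (f : ℝ → ℝ) (θ : ℝ) (x : ℝ) : ℝ := projDensity f (x + θ)

/-- The number `∫ z² (f z - p z) dz`, `p` being the log-concave projection of `f`. -/
def smoothingVariance (f : ℝ → ℝ) : ℝ := ∫ z, z ^ 2 * (f z - projDensity f z)

/-- The convolution of the centred projection with the centred Gaussian law with variance
`smoothingVariance f` (a point mass at `0` if this variance is `0`). -/
def smoothedProj (f : ℝ → ℝ) (θ : ℝ) (x : ℝ) : ℝ :=
  ∫ t, centeredProj f θ (x - t) ∂(gaussianReal 0 (smoothingVariance f).toNNReal)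

/-! ### The estimators, as functions of a sample `x 0, …, x (n - 1)` -/

/-- The empirical measure of the sample. -/
def empiricalMeasure (n : ℕ) (x : ℕ → ℝ) : Measure ℝ :=
  (n : ℝ≥0∞)⁻¹ • ∑ i ∈ Finset.range n, Measure.dirac (x i)

/-- `f` maximizes the likelihood of the sample over all log-concave densities. -/
def IsLogConcaveMLE (n : ℕ) (x : ℕ → ℝ) (f : ℝ → ℝ) : Prop :=
  f ∈ LogConcaveDensities ∧ ∀ h ∈ LogConcaveDensities,
    ∏ i ∈ Finset.range n, h (x i) ≤ ∏ i ∈ Finset.range n, f (x i)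

/-- The log-concave maximum likelihood estimator. -/
def mle (n : ℕ) (x : ℕ → ℝ) : ℝ → ℝ := Classical.epsilon (IsLogConcaveMLE n x)

/-- The symmetrization `(f (θ + z) + f (θ - z)) / 2` of the MLE `f`. -/
def symEst (n : ℕ) (x : ℕ → ℝ) (θ : ℝ) (z : ℝ) : ℝ :=
  (1 / 2) * (mle n x (θ + z) + mle n x (θ - z))

def sampleMean (n : ℕ) (x : ℕ → ℝ) : ℝ := (∑ i ∈ Finset.range n, x i) / n

def sampleVariance (n : ℕ) (x : ℕ → ℝ) : ℝ :=
  1 / ((n : ℝ) - 1) * ∑ i ∈ Finset.range n, (x i - sampleMean n x) ^ 2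

/-- The variance of the distribution with density the MLE. -/
def mleVariance (n : ℕ) (x : ℕ → ℝ) : ℝ :=
  (∫ z, z ^ 2 * mle n x z) - (∫ z, z * mle n x z) ^ 2

/-- The data-driven bandwidth. -/
def bandwidth (n : ℕ) (x : ℕ → ℝ) : ℝ := Real.sqrt (sampleVariance n x - mleVariance n x)

/-- Gaussian smoothing of `f` with bandwidth `b`. -/
def gaussSmooth (b : ℝ) (f : ℝ → ℝ) (z : ℝ) : ℝ :=
  1 / b * ∫ t, f (z - t) * gaussianPDFReal 0 1 (t / b)

/-- The smoothed log-concave MLE. -/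
def smoothedMle (n : ℕ) (x : ℕ → ℝ) : ℝ → ℝ := gaussSmooth (bandwidth n x) (mle n x)

/-- The smoothed symmetrized estimator. -/
def smoothedSymEst (n : ℕ) (x : ℕ → ℝ) (θ : ℝ) : ℝ → ℝ :=
  gaussSmooth (bandwidth n x) (symEst n x θ)

/-- `ψ` maximizes `psiCrit θ · Fₙ`, `Fₙ` the empirical measure, over the closed proper concave
functions symmetric about `0`. -/
def IsPartialMLE (n : ℕ) (x : ℕ → ℝ) (θ : ℝ) (ψ : ℝ → EReal) : Prop :=
  ψ ∈ SymConcaveClass 0 ∧ ∀ ψ' ∈ SymConcaveClass 0,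
    psiCrit θ ψ' (empiricalMeasure n x) ≤ psiCrit θ ψ (empiricalMeasure n x)

/-- The partial MLE of the centred density. -/
def partialMle (n : ℕ) (x : ℕ → ℝ) (θ : ℝ) : ℝ → ℝ :=
  expFun (Classical.epsilon (IsPartialMLE n x θ))

/-- The geometric mean type symmetrized estimator, normalized to integrate to one. -/
def geoEst (n : ℕ) (x : ℕ → ℝ) (θ : ℝ) (z : ℝ) : ℝ :=
  (∫ t, Real.sqrt (mle n x (θ + t) * mle n x (θ - t)))⁻¹ *
    Real.sqrt (mle n x (θ + z) * mle n x (θ - z))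

/-! ### Right derivatives and modes of convergence -/

/-- `φ` is finite at `x` and just to the right of `x`, and has right derivative `d` at `x`. -/
def HasRightDeriv (φ : ℝ → EReal) (d x : ℝ) : Prop :=
  (φ x ≠ ⊥ ∧ φ x ≠ ⊤) ∧ (∀ᶠ z in 𝓝[>] x, φ z ≠ ⊥ ∧ φ z ≠ ⊤) ∧
    HasDerivWithinAt (fun z => (φ z).toReal) d (Set.Ioi x) x

/-- The right derivative (used below only at interior points of the domain of a concave
function, where it exists, and for logarithms of Gaussian convolutions). -/
def rightDeriv (φ : ℝ → EReal) (x : ℝ) : ℝ :=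
  derivWithin (fun z => (φ z).toReal) (Set.Ioi x) x

variable {Ω : Type*} [MeasurableSpace Ω]

/-- Convergence to `0` in probability of `[0, ∞]`-valued random quantities. -/
def ConvInProb (μ : Measure Ω) (D : ℕ → Ω → ℝ≥0∞) : Prop :=
  ∀ ε : ℝ≥0∞, 0 < ε → Tendsto (fun n => μ {ω | ε ≤ D n ω}) atTop (𝓝 0)

/-- Almost sure convergence to `0` of `[0, ∞]`-valued random quantities. -/
def ConvAS (μ : Measure Ω) (D : ℕ → Ω → ℝ≥0∞) : Prop :=
  ∀ᵐ ω ∂μ, Tendsto (fun n => D n ω) atTop (𝓝 0)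

/-- The random quantity `sup_{x ∈ K} |gₙ(x + yₙ) - q(x)|`. -/
def densityDev (g : ℕ → Ω → ℝ → ℝ) (y : ℕ → Ω → ℝ) (q : ℝ → ℝ) (K : Set ℝ)
    (n : ℕ) (ω : Ω) : ℝ≥0∞ :=
  ⨆ x ∈ K, ENNReal.ofReal |g n ω (x + y n ω) - q x|

/-- The random quantity `sup_{x ∈ K} |log gₙ(x + yₙ) - log q(x)|`. It equals `∞` if `gₙ` vanishes
at some point of `K + yₙ`. -/
def logDev (g : ℕ → Ω → ℝ → ℝ) (y : ℕ → Ω → ℝ) (q : ℝ → ℝ) (K : Set ℝ)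
    (n : ℕ) (ω : Ω) : ℝ≥0∞ :=
  ⨆ x ∈ K, (logDensity (g n ω) (x + y n ω) - logDensity q x).abs

/-- The random quantity `|(log gₙ)'(x + yₙ) - (log q)'(x)|`, with right derivatives. It equals `∞`
if `log gₙ` has no right derivative at `x + yₙ`. -/
def scoreDev (g : ℕ → Ω → ℝ → ℝ) (y : ℕ → Ω → ℝ) (q : ℝ → ℝ) (x : ℝ)
    (n : ℕ) (ω : Ω) : ℝ≥0∞ :=
  ⨅ (d : ℝ) (_ : HasRightDeriv (logDensity (g n ω)) d (x + y n ω)),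
    ENNReal.ofReal |d - rightDeriv (logDensity q) x|

/-- Uniform convergence of `gₙ(· + yₙ)` to `q` on `A`. -/
def DensityConsistent (conv : (ℕ → Ω → ℝ≥0∞) → Prop) (g : ℕ → Ω → ℝ → ℝ) (y : ℕ → Ω → ℝ)
    (q : ℝ → ℝ) (A : Set ℝ) : Prop :=
  conv (densityDev g y q A)

/-- Uniform convergence of `log gₙ(· + yₙ)` to `log q` on compact subsets of the interior of the
domain of `log q`. -/
def LogConsistent (conv : (ℕ → Ω → ℝ≥0∞) → Prop) (g : ℕ → Ω → ℝ → ℝ) (y : ℕ → Ω → ℝ)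
    (q : ℝ → ℝ) : Prop :=
  ∀ K : Set ℝ, IsCompact K → K ⊆ interior (dom (logDensity q)) → conv (logDev g y q K)

/-- Convergence of `(log gₙ)'(x + yₙ)` to `(log q)'(x)` at each continuity point `x` of
`(log q)'` in the interior of the domain of `log q`. -/
def ScoreConsistent (conv : (ℕ → Ω → ℝ≥0∞) → Prop) (g : ℕ → Ω → ℝ → ℝ) (y : ℕ → Ω → ℝ)
    (q : ℝ → ℝ) : Prop :=
  ∀ x ∈ interior (dom (logDensity q)), ContinuousAt (rightDeriv (logDensity q)) x →
    conv (scoreDev g y q x)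

/-- The three convergences with uniformity on compact subsets of the interior of the domain of
`log q`. -/
def CompactlyConsistent (conv : (ℕ → Ω → ℝ≥0∞) → Prop) (g : ℕ → Ω → ℝ → ℝ) (y : ℕ → Ω → ℝ)
    (q : ℝ → ℝ) : Prop :=
  (∀ K : Set ℝ, IsCompact K → K ⊆ interior (dom (logDensity q)) → DensityConsistent conv g y q K) ∧
    LogConsistent conv g y q ∧ ScoreConsistent conv g y q

/-- The three convergences with the densities converging uniformly on the whole line. -/
def GloballyConsistent (conv : (ℕ → Ω → ℝ≥0∞) → Prop) (g : ℕ → Ω → ℝ → ℝ) (y : ℕ → Ω → ℝ)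
    (q : ℝ → ℝ) : Prop :=
  DensityConsistent conv g y q Set.univ ∧ LogConsistent conv g y q ∧ ScoreConsistent conv g y q

/-! ### The random density estimators, for observations `X` and preliminary estimators `θbar` -/

def gSym (X θbar : ℕ → Ω → ℝ) : ℕ → Ω → ℝ → ℝ :=
  fun n ω => symEst n (fun i => X i ω) (θbar n ω)

def gSymSmooth (X θbar : ℕ → Ω → ℝ) : ℕ → Ω → ℝ → ℝ :=
  fun n ω => smoothedSymEst n (fun i => X i ω) (θbar n ω)

def gPartial (X θbar : ℕ → Ω → ℝ) : ℕ → Ω → ℝ → ℝ :=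
  fun n ω => partialMle n (fun i => X i ω) (θbar n ω)

def gGeo (X θbar : ℕ → Ω → ℝ) : ℕ → Ω → ℝ → ℝ :=
  fun n ω => geoEst n (fun i => X i ω) (θbar n ω)

def mlePlus (X θbar : ℕ → Ω → ℝ) : ℕ → Ω → ℝ → ℝ :=
  fun n ω z => mle n (fun i => X i ω) (θbar n ω + z)

def mleMinus (X θbar : ℕ → Ω → ℝ) : ℕ → Ω → ℝ → ℝ :=
  fun n ω z => mle n (fun i => X i ω) (θbar n ω - z)

def smoothedMlePlus (X θbar : ℕ → Ω → ℝ) : ℕ → Ω → ℝ → ℝ :=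
  fun n ω z => smoothedMle n (fun i => X i ω) (θbar n ω + z)

def smoothedMleMinus (X θbar : ℕ → Ω → ℝ) : ℕ → Ω → ℝ → ℝ :=
  fun n ω z => smoothedMle n (fun i => X i ω) (θbar n ω - z)

/-- Consistency statements for a bounded symmetric `f₀` with finite mean. -/
def ConclusionP1 (conv : (ℕ → Ω → ℝ≥0∞) → Prop) (X θbar y : ℕ → Ω → ℝ)
    (f₀ : ℝ → ℝ) (θ₀ : ℝ) : Prop :=
  (∀ g ∈ ({gSym X θbar, gPartial X θbar, gGeo X θbar, mlePlus X θbar, mleMinus X θbar} :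
      Set (ℕ → Ω → ℝ → ℝ)), CompactlyConsistent conv g y (centeredProj f₀ θ₀)) ∧
  (Integrable (fun z => z ^ 2 * f₀ z) →
    ∀ g ∈ ({gSymSmooth X θbar, smoothedMlePlus X θbar, smoothedMleMinus X θbar} :
      Set (ℕ → Ω → ℝ → ℝ)), CompactlyConsistent conv g y (smoothedProj f₀ θ₀))

/-- Consistency statements for `f₀` in the log-concave symmetric location model. -/
def ConclusionP0 (conv : (ℕ → Ω → ℝ≥0∞) → Prop) (X θbar y : ℕ → Ω → ℝ)
    (f₀ : ℝ → ℝ) (θ₀ : ℝ) : Prop :=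
  ∀ g ∈ ({gSym X θbar, gSymSmooth X θbar, gPartial X θbar, gGeo X θbar} :
    Set (ℕ → Ω → ℝ → ℝ)), GloballyConsistent conv g y (fun x => f₀ (x + θ₀))

end

end LogConcaveLocation

open LogConcaveLocation

namespace LogConcaveLocation

/-! Each unsmoothed log-concave function in the statement is a maximizer of one criterion `crit P h
= ∫ log h dP - ∫ h`, for a suitable `P`. The MLE belongs to the empirical measure, its translate and
reflected translate to the translated and reflected empirical measures, and the partial MLE to the
symmetrized translated empirical measure: even functions do not distinguish a measure from its
symmetrization, and a reflection invariant measure has an even maximizer. The limit is the maximizer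
for the true law. The theorem is therefore mostly a statement about continuity of the map from `P`
to its maximizer, in Kantorovich distance `W`.

Two devices give this continuity. First, the criterion is strictly concave along geometric means:
replacing `g` and `h` by `√(g h)` gains half their squared Hellinger distance (`Adm.sqrt_mul`), so
that distance is at most the gap in criterion to a maximizer. Secondly, `h ≤ S` is replaced by its
least majorant with `m`-Lipschitz logarithm. This adds mass at most `2S/m`, and afterwards `P` may
be exchanged for `Q` at cost `mW` (`adm_lipMaj`). Together, `IsProj.hellinger_le_of_W1Le` bounds the
squared Hellinger distance of two maximizers by `4mW + 12S/m`, where `m` is free. The bound `S`, and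
a common exponential envelope, come from `exists_uniform_envelope`: a measure with mass on both
sides of an interval and a bounded first moment cannot have a maximizer that is too high, or too low
in the middle. The same bounds give existence of maximizers, which the definitions by choice need.

Log-concavity upgrades Hellinger convergence. Closeness at one point of each interval is enough for
continuous convergence, first inside the domain of the limit by comparing chords, then outside its
closure by unimodality. Uniformity on compact sets follows, and so does convergence of right
derivatives, since these lie between slopes of chords. An average of two log-concave functions need
not be log-concave, so these conclusions are proved for averages of two convergent log-concave
families (`locallyConsistent_of_tendsto`). If the limit is continuous and vanishes at infinity,
unimodality makes the convergence uniform on the line.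

For the smoothed estimators, Gaussian averaging preserves log-concavity by the composition formula
for totally positive kernels. The envelope gives convergence of the moments of the MLE and hence of
the bandwidth, and dominated convergence gives that of the averages. The bandwidth is eventually
positive because a maximizer has second moments no larger than those of its measure, whereas the
sample variance has divisor `n - 1`.

All of this is deterministic, along a filter of samples generated by countably many conditions on
means of test functions. The strong law puts almost every path into the filter. For convergence in
probability, the sets that contain the sample with probability tending to one form a finer filter.
In the second part a log-concave density is its own projection by `log t ≤ t - 1`, so the limiting
bandwidth is zero, and finite Fisher information supplies continuity of the density. -/

/-! ### Log-concave functions -/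

/-- Nonnegative log-concave functions on the line. -/
structure LogConc (h : ℝ → ℝ) : Prop where
  nonneg : ∀ x, 0 ≤ h x
  concaveOn : ConcaveOn ℝ {x | 0 < h x} (fun x => Real.log (h x))

/-- The pairs `(x, r)` with `exp r ≤ h x` form the hypograph of `log h` with `log 0 = -∞`. Convexity
of the hypograph needs no case distinction on positivity, which suits affine maps, limits and hulls.
-/
theorem logConc_iff {h : ℝ → ℝ} : LogConc h ↔ (∀ x, 0 ≤ h x) ∧
    ∀ x y r s a b : ℝ, 0 ≤ a → 0 ≤ b → a + b = 1 → Real.exp r ≤ h x → Real.exp s ≤ h y →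
      Real.exp (a * r + b * s) ≤ h (a * x + b * y) := by
  constructor
  · rintro ⟨h0, hc⟩
    refine ⟨h0, fun x y r s a b ha hb hab hx hy => ?_⟩
    have hx' : 0 < h x := (Real.exp_pos r).trans_le hx
    have hy' : 0 < h y := (Real.exp_pos s).trans_le hy
    have hz : 0 < h (a * x + b * y) := hc.1 hx' hy' ha hb hab
    have := hc.2 hx' hy' ha hb hab
    simp only [smul_eq_mul] at this
    rw [← Real.le_log_iff_exp_le hz]
    rw [← Real.le_log_iff_exp_le hx'] at hx
    rw [← Real.le_log_iff_exp_le hy'] at hy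
    nlinarith [mul_le_mul_of_nonneg_left hx ha, mul_le_mul_of_nonneg_left hy hb]
  · rintro ⟨h0, H⟩
    have key : ∀ x y a b : ℝ, 0 < h x → 0 < h y → 0 ≤ a → 0 ≤ b → a + b = 1 →
        Real.exp (a * Real.log (h x) + b * Real.log (h y)) ≤ h (a * x + b * y) :=
      fun x y a b hx hy ha hb hab => H x y _ _ a b ha hb hab
        (Real.exp_log hx).le (Real.exp_log hy).le
    refine ⟨h0, fun x hx y hy a b ha hb hab =>
      (Real.exp_pos _).trans_le (key x y a b hx hy ha hb hab), fun x hx y hy a b ha hb hab => ?_⟩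
    have := key x y a b hx hy ha hb hab
    simp only [smul_eq_mul]
    rwa [Real.le_log_iff_exp_le ((Real.exp_pos _).trans_le this)]

namespace LogConc

variable {h g : ℝ → ℝ}

theorem pos_of_mem (H : LogConc h) {u v x : ℝ} (hu : 0 < h u) (hx : 0 < h x) (huv : u ≤ v)
    (hvx : v ≤ x) : 0 < h v :=
  H.concaveOn.1.ordConnected.out hu hx ⟨huv, hvx⟩

/-- The chord inequality with denominators cleared, so that it can be fed to linear arithmetic and
survives `u = x`. -/
theorem log_three (H : LogConc h) {u v x : ℝ} (hu : 0 < h u) (hx : 0 < h x) (huv : u ≤ v)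
    (hvx : v ≤ x) :
    (x - v) * Real.log (h u) + (v - u) * Real.log (h x) ≤ (x - u) * Real.log (h v) := by
  rcases eq_or_lt_of_le (huv.trans hvx) with e | hlt
  · have : u = v := le_antisymm huv (e ▸ hvx)
    subst this; subst e; simp
  have hpos : 0 < x - u := sub_pos.2 hlt
  have := H.concaveOn.2 hu hx (div_nonneg (by linarith) hpos.le : 0 ≤ (x - v) / (x - u))
    (div_nonneg (by linarith) hpos.le : 0 ≤ (v - u) / (x - u)) (by field_simp; ring)
  simp only [smul_eq_mul] at this
  have e : (x - v) / (x - u) * u + (v - u) / (x - u) * x = v := by field_simp; ring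
  rw [e] at this
  have h2 := mul_le_mul_of_nonneg_left this hpos.le
  calc _ = (x - u) * ((x - v) / (x - u) * Real.log (h u) + (v - u) / (x - u) * Real.log (h x)) := by
        field_simp
    _ ≤ _ := h2

/-- Unimodality, without any positivity assumption; much of the later work uses only this
consequence of log-concavity. -/
theorem min_le (H : LogConc h) {u v x : ℝ} (huv : u ≤ v) (hvx : v ≤ x) :
    min (h u) (h x) ≤ h v := by
  rcases (H.nonneg u).eq_or_lt with e | hu
  · exact (min_le_left _ _).trans (e ▸ H.nonneg v)
  rcases (H.nonneg x).eq_or_lt with e | hx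
  · exact (min_le_right _ _).trans (e ▸ H.nonneg v)
  have hv := H.pos_of_mem hu hx huv hvx
  rcases eq_or_lt_of_le (huv.trans hvx) with e | hlt
  · have : u = v := le_antisymm huv (e ▸ hvx)
    rw [this]; exact min_le_left _ _
  by_contra hcon
  rw [not_le, lt_min_iff] at hcon
  have h1 := Real.log_lt_log hv hcon.1
  have h2 := Real.log_lt_log hv hcon.2
  have := H.log_three hu hx huv hvx
  rcases eq_or_lt_of_le huv with e | h3
  · subst e; exact lt_irrefl _ h1
  nlinarith [mul_nonneg (sub_nonneg.2 hvx) (sub_nonneg.2 h1.le), mul_pos (sub_pos.2 h3) (sub_pos.2 h2)]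

/-- Since `d = a + c - b`, the chord weights at `d` are those at `b` interchanged, and the two chord
inequalities add up. This is total positivity of order two of `(x, y) ↦ h (x - y)`, needed for
convolutions. -/
theorem mul_le_mul_of_add_eq (H : LogConc h) {a b c d : ℝ} (hab : a ≤ b) (hbc : b ≤ c)
    (hs : a + c = b + d) : h a * h c ≤ h b * h d := by
  rcases (H.nonneg a).eq_or_lt with e | ha
  · rw [← e, zero_mul]; exact mul_nonneg (H.nonneg _) (H.nonneg _)
  rcases (H.nonneg c).eq_or_lt with e | hc
  · rw [← e, mul_zero]; exact mul_nonneg (H.nonneg _) (H.nonneg _)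
  have hb := H.pos_of_mem ha hc hab hbc
  have hd := H.pos_of_mem ha hc (v := d) (by linarith) (by linarith)
  rcases eq_or_lt_of_le (hab.trans hbc) with e | hlt
  · have h1 : b = a := le_antisymm (e ▸ hbc) hab
    have h2 : d = c := by linarith
    rw [h1, h2]
  have h1 := H.log_three ha hc hab hbc
  have h2 := H.log_three ha hc (v := d) (by linarith) (by linarith)
  have h3 : (c - a) * (Real.log (h a) + Real.log (h c)) ≤
      (c - a) * (Real.log (h b) + Real.log (h d)) := by
    have : d = a + c - b := by linarith
    subst this
    nlinarith
  have h4 := le_of_mul_le_mul_left h3 (sub_pos.2 hlt)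
  rwa [← Real.log_mul ha.ne' hc.ne', ← Real.log_mul hb.ne' hd.ne',
    Real.log_le_log_iff (mul_pos ha hc) (mul_pos hb hd)] at h4

/-! ### Operations that preserve log-concavity, and continuity. -/

theorem comp_affine (H : LogConc h) (e c : ℝ) : LogConc (fun x => h (e * x + c)) := by
  rw [logConc_iff] at H ⊢
  refine ⟨fun x => H.1 _, fun x y r s a b ha hb hab hx hy => ?_⟩
  have := H.2 _ _ r s a b ha hb hab hx hy
  convert this using 2
  linear_combination (-c) * hab

theorem const_mul (H : LogConc h) {k : ℝ} (hk : 0 < k) : LogConc (fun x => k * h x) := by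
  rw [logConc_iff] at H ⊢
  refine ⟨fun x => mul_nonneg hk.le (H.1 _), fun x y r s a b ha hb hab hx hy => ?_⟩
  have e : ∀ t z, Real.exp t ≤ k * z ↔ Real.exp (t - Real.log k) ≤ z := by
    intro t z
    rw [Real.exp_sub, Real.exp_log hk, div_le_iff₀ hk, mul_comm]
  rw [e] at hx hy ⊢
  have := H.2 _ _ _ _ a b ha hb hab hx hy
  convert this using 2
  linear_combination (Real.log k) * hab

theorem mul (H : LogConc h) (G : LogConc g) : LogConc (fun x => h x * g x) := by
  refine ⟨fun x => mul_nonneg (H.nonneg x) (G.nonneg x), ?_⟩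
  have e : {x | 0 < h x * g x} = {x | 0 < h x} ∩ {x | 0 < g x} := by
    ext x
    constructor
    · intro hx
      have hx : 0 < h x * g x := hx
      exact ⟨pos_of_mul_pos_left hx (G.nonneg x), pos_of_mul_pos_right hx (H.nonneg x)⟩
    · rintro ⟨h1, h2⟩
      exact mul_pos (show 0 < h x from h1) (show 0 < g x from h2)
  rw [e]
  have hc := H.concaveOn.1.inter G.concaveOn.1
  refine ((H.concaveOn.subset inter_subset_left hc).add
    (G.concaveOn.subset inter_subset_right hc)).congr ?_
  rintro x ⟨h1, h2⟩
  exact (Real.log_mul (ne_of_gt h1) (ne_of_gt h2)).symm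

theorem sqrt (H : LogConc h) : LogConc (fun x => √(h x)) := by
  refine ⟨fun x => Real.sqrt_nonneg _, ?_⟩
  have e : {x | 0 < √(h x)} = {x | 0 < h x} := by ext x; simp [Real.sqrt_pos]
  rw [e]
  refine (H.concaveOn.smul (by norm_num : (0:ℝ) ≤ 1 / 2)).congr fun x hx => ?_
  simp only [smul_eq_mul]
  rw [Real.log_sqrt (H.nonneg x)]; ring

theorem exp_neg_mul_abs (B c : ℝ) (hB : 0 ≤ B) : LogConc (fun x => Real.exp (c - B * |x|)) := by
  rw [logConc_iff]
  refine ⟨fun x => (Real.exp_pos _).le, fun x y r s a b ha hb hab hx hy => ?_⟩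
  rw [Real.exp_le_exp] at *
  have h1 : |a * x + b * y| ≤ a * |x| + b * |y| := by
    calc _ ≤ |a * x| + |b * y| := abs_add_le _ _
      _ = _ := by rw [abs_mul, abs_mul, abs_of_nonneg ha, abs_of_nonneg hb]
  have h2 : c = a * c + b * c := by rw [← add_mul, hab, one_mul]
  nlinarith [mul_le_mul_of_nonneg_left hx ha, mul_le_mul_of_nonneg_left hy hb,
    mul_le_mul_of_nonneg_left h1 hB]

theorem continuousOn_log (H : LogConc h) :
    ContinuousOn (fun x => Real.log (h x)) (interior {x | 0 < h x}) :=
  H.concaveOn.continuousOn_interior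

theorem continuousAt (H : LogConc h) {x : ℝ} (hx : x ∈ interior {x | 0 < h x}) :
    ContinuousAt h x := by
  have h1 : ContinuousAt (fun x => Real.exp (Real.log (h x))) x :=
    Real.continuous_exp.continuousAt.comp
      (H.continuousOn_log.continuousAt (isOpen_interior.mem_nhds hx))
  refine h1.congr ?_
  filter_upwards [isOpen_interior.mem_nhds hx] with y hy
  exact Real.exp_log (show 0 < h y from interior_subset (s := {x | 0 < h x}) hy)

/-- A log-concave function that exceeds its value at `v` somewhere on the left of `v` decreases
to the right of `v`. -/
theorem le_of_lt_left (H : LogConc h) {u v x : ℝ} (huv : u ≤ v) (hvx : v ≤ x) (hlt : h v < h u) :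
    h x ≤ h v := by
  have := H.min_le huv hvx
  rcases min_le_iff.1 this with h1 | h1
  · exact absurd h1 (not_le.2 hlt)
  · exact h1

theorem le_of_lt_right (H : LogConc h) {u v x : ℝ} (huv : v ≤ u) (hvx : x ≤ v) (hlt : h v < h u) :
    h x ≤ h v := by
  have := H.min_le hvx huv
  rcases min_le_iff.1 this with h1 | h1
  · exact h1
  · exact absurd h1 (not_le.2 hlt)

/-! ### Bounds and exponential tails from the total mass. -/

theorem mul_sub_le_integral (H : LogConc h) (hi : Integrable h) {k α β : ℝ} (hαβ : α ≤ β)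
    (hk : ∀ z ∈ Icc α β, k ≤ h z) : k * (β - α) ≤ ∫ x, h x := by
  calc k * (β - α) = ∫ _ in Icc α β, k := by
        simp [Real.volume_real_Icc_of_le hαβ, mul_comm]
    _ ≤ ∫ x in Icc α β, h x :=
        setIntegral_mono_on (integrableOn_const (by simp)) hi.integrableOn measurableSet_Icc hk
    _ ≤ ∫ x, h x := setIntegral_le_integral hi (Eventually.of_forall H.nonneg)

/-- On `[x - d/2, x]`, the half of the chord nearer to `x`, the function is at least the geometric
mean `√(c * h x)`; a total mass of at most one then bounds `h x`. -/
theorem mul_le_of_far (H : LogConc h) (hi : Integrable h) (h1 : ∫ x, h x ≤ 1) {e x d c : ℝ}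
    (hd : 0 < d) (hex : e + d ≤ x) (hc : 0 < c) (hce : c ≤ h e) (hcx : c ≤ h x) :
    h x ≤ (2 / d) ^ 2 / c := by
  have hx : 0 < h x := hc.trans_le hcx
  have key : √(c * h x) * (x - (x - d / 2)) ≤ 1 := by
    refine (H.mul_sub_le_integral hi (by linarith) fun z hz => ?_).trans h1
    have hz0 := H.pos_of_mem (hc.trans_le hce) hx (v := z) (by linarith [hz.1]) hz.2
    have h3 := H.log_three (hc.trans_le hce) hx (v := z) (by linarith [hz.1]) hz.2
    have h4 := Real.log_le_log hc hce
    have h5 := Real.log_le_log hc hcx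
    rw [← Real.log_le_log_iff (Real.sqrt_pos.2 (mul_pos hc hx)) hz0,
      Real.log_sqrt (mul_pos hc hx).le, Real.log_mul hc.ne' hx.ne']
    have h6 : 0 < x - e := by linarith
    refine le_of_mul_le_mul_left (a := x - e) ?_ h6
    have h7 : x - z ≤ (x - e) / 2 := by linarith [hz.1]
    nlinarith [mul_le_mul_of_nonneg_left h4 (sub_nonneg.2 hz.2),
      mul_le_mul_of_nonneg_right h7 (sub_nonneg.2 h5)]
  have h2 : √(c * h x) ≤ 2 / d := by
    rw [le_div_iff₀ hd]; linarith
  rw [le_div_iff₀ hc, mul_comm, ← Real.sq_sqrt (mul_pos hc hx).le]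
  gcongr

theorem le_of_two_points (H : LogConc h) (hi : Integrable h) (h1 : ∫ x, h x ≤ 1) {p q c : ℝ}
    (hpq : p < q) (hc : 0 < c) (hp : c ≤ h p) (hq : c ≤ h q) (x : ℝ) :
    h x ≤ (4 / (q - p)) ^ 2 / c := by
  have hd : 0 < q - p := sub_pos.2 hpq
  have e : (4 / (q - p)) = 2 / ((q - p) / 2) := by field_simp; norm_num
  rcases lt_or_ge (h x) c with hlt | hge
  · have := H.mul_sub_le_integral hi hpq.le (k := c)
      fun z hz => (le_min hp hq).trans (H.min_le hz.1 hz.2)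
    have h2 : c ≤ 1 / (q - p) := by rw [le_div_iff₀ hd]; linarith
    rw [le_div_iff₀ hc]
    calc h x * c ≤ c * c := by gcongr
      _ ≤ (1 / (q - p)) * (1 / (q - p)) := by gcongr
      _ ≤ (4 / (q - p)) * (4 / (q - p)) := by gcongr <;> norm_num
      _ = _ := by ring
  rw [e]
  -- The point `x` has distance at least `(q - p) / 2` from one of `p` and `q`; the second case is
  -- the first one reflected.
  rcases le_total ((p + q) / 2) x with hx | hx
  · exact H.mul_le_of_far hi h1 (e := p) (by linarith) (by linarith) hc hp hge
  · have := (H.comp_affine (-1) 0).mul_le_of_far (e := -q) (x := -x) (d := (q - p) / 2) (c := c)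
      (by simpa using hi.comp_neg)
      (by simpa [integral_neg_eq_self (fun x => h x)] using h1) (by linarith) (by linarith) hc
      (by simpa using hq) (by simpa using hge)
    simpa using this

/-- Exponential tail on the right of two points where `h` is bounded below. -/
theorem right_tail (H : LogConc h) (hi : Integrable h) (h1 : ∫ x, h x ≤ 1) {p c : ℝ}
    (hc : 0 < c) (hp : c ≤ h p) {x : ℝ} (hx : p + Real.exp 1 / c + 1 ≤ x) :
    h x ≤ c * Real.exp (-(x - p) / (Real.exp 1 / c + 1)) := by
  -- A lower bound `c / e` on an interval of length `D > e / c` would force mass above one. Hence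
  -- `log h` has dropped below `log c - 1` at `p + D`, and by concavity it keeps falling with slope
  -- at most `-1 / D`.
  set D := Real.exp 1 / c + 1 with hD
  have hD1 : 0 < Real.exp 1 / c := div_pos (Real.exp_pos _) hc
  have hD0 : 0 < D := by positivity
  rcases (H.nonneg x).eq_or_lt with e | hx0
  · rw [← e]; positivity
  have hp0 : 0 < h p := hc.trans_le hp
  have hv0 := H.pos_of_mem hp0 hx0 (v := p + D) (by linarith) (by linarith)
  have hv : h (p + D) < c * Real.exp (-1) := by
    by_contra hcon
    push Not at hcon
    have h2 : c * Real.exp (-1) ≤ h p :=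
      (mul_le_of_le_one_right hc.le (Real.exp_le_one_iff.2 (by norm_num))).trans hp
    have := (H.mul_sub_le_integral hi (α := p) (β := p + D) (by linarith) (k := c * Real.exp (-1))
      fun z hz => (le_min h2 hcon).trans (H.min_le hz.1 hz.2)).trans h1
    rw [Real.exp_neg, hD] at this
    have h3 : c * (Real.exp 1)⁻¹ * (p + (Real.exp 1 / c + 1) - p) = 1 + c * (Real.exp 1)⁻¹ := by
      field_simp; ring
    rw [h3] at this
    have : 0 < c * (Real.exp 1)⁻¹ := by positivity
    linarith
  have h3 := H.log_three hp0 hx0 (v := p + D) (by linarith) (by linarith)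
  have h4 := Real.log_lt_log hv0 hv
  rw [Real.log_mul hc.ne' (Real.exp_pos _).ne', Real.log_exp] at h4
  have h5 := Real.log_le_log hc hp
  rw [← Real.log_le_log_iff hx0 (by positivity), Real.log_mul hc.ne' (Real.exp_pos _).ne',
    Real.log_exp]
  have h6 : D * Real.log (h x) ≤ D * (Real.log c + -(x - p) / D) := by
    have : D * (Real.log c + -(x - p) / D) = D * Real.log c - (x - p) := by field_simp; ring
    rw [this]
    nlinarith [mul_le_mul_of_nonneg_left h5 (by linarith : 0 ≤ x - (p + D)),
      mul_le_mul_of_nonneg_left h4.le (by linarith : 0 ≤ x - p)]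
  exact le_of_mul_le_mul_left h6 hD0

/-- The two-point bound serves near the origin and the two tails far away. The constants depend on
`p`, `q`, `c` only, so one integrable majorant serves a whole family and permits dominated
convergence. -/
theorem exists_envelope {p q c : ℝ} (hpq : p < q) (hc : 0 < c) :
    ∃ A B : ℝ, 0 < B ∧ 0 < A ∧ ∀ h : ℝ → ℝ, LogConc h → Integrable h → ∫ x, h x ≤ 1 → c ≤ h p →
      c ≤ h q → ∀ x, h x ≤ A * Real.exp (-(B * |x|)) := by
  set D := Real.exp 1 / c + 1 with hD
  have hD1 : 0 < Real.exp 1 / c := div_pos (Real.exp_pos _) hc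
  have hD0 : 0 < D := by positivity
  set S := (4 / (q - p)) ^ 2 / c with hS
  have hS0 : 0 < S := by have := sub_pos.2 hpq; positivity
  set R := |p| + |q| + D with hR
  refine ⟨S * Real.exp (1 / D * R) + c * Real.exp ((|p| + |q|) / D), 1 / D, by positivity,
    by positivity, fun h H hi h1 hp hq x => ?_⟩
  have hb := H.le_of_two_points hi h1 hpq hc hp hq x
  rcases le_or_gt |x| R with hx | hx
  · calc h x ≤ S * 1 := by rw [mul_one]; exact hb
      _ ≤ S * (Real.exp (1 / D * R) * Real.exp (-(1 / D * |x|))) := by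
          gcongr
          rw [← Real.exp_add]
          apply Real.one_le_exp
          have := mul_le_mul_of_nonneg_left hx (by positivity : 0 ≤ 1 / D)
          linarith
      _ ≤ _ := by rw [← mul_assoc]; gcongr; linarith [show 0 < c * Real.exp ((|p| + |q|) / D) by positivity]
  have fin : ∀ t e : ℝ, |e| ≤ |p| + |q| → |x| ≤ t → h x ≤ c * Real.exp (-(t - e) / D) →
      h x ≤ (S * Real.exp (1 / D * R) + c * Real.exp ((|p| + |q|) / D)) *
        Real.exp (-(1 / D * |x|)) := by
    intro t e he ht hxe
    calc h x ≤ c * Real.exp (-(t - e) / D) := hxe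
      _ ≤ c * Real.exp ((|p| + |q|) / D + -(1 / D * |x|)) := by
          gcongr
          rw [show (|p| + |q|) / D + -(1 / D * |x|) = (|p| + |q| - |x|) / D by ring]
          gcongr
          linarith [le_abs_self e]
      _ ≤ _ := by
          rw [Real.exp_add, ← mul_assoc]; gcongr
          linarith [show 0 < S * Real.exp (1 / D * R) by positivity]
  rcases le_total 0 x with h0 | h0
  · rw [abs_of_nonneg h0] at hx
    refine fin x p (by linarith [abs_nonneg q]) (abs_of_nonneg h0).le
      (H.right_tail hi h1 hc hp ?_)
    linarith [le_abs_self p, abs_nonneg q]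
  · rw [abs_of_nonpos h0] at hx
    refine fin (-x) (-q) (by rw [abs_neg]; linarith [abs_nonneg p]) (abs_of_nonpos h0).le ?_
    have := (H.comp_affine (-1) 0).right_tail (p := -q) (x := -x) (c := c)
      (by simpa using hi.comp_neg)
      (by simpa [integral_neg_eq_self (fun x => h x)] using h1) hc
      (by simpa using hq) (by linarith [neg_abs_le q, abs_nonneg p])
    simpa using this

end LogConc

/-! ### Integrability of the exponential envelopes. -/

theorem integrable_exp_neg_mul_abs {B : ℝ} (hB : 0 < B) :
    Integrable (fun x : ℝ => Real.exp (-(B * |x|))) := by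
  have h1 : IntegrableOn (fun x : ℝ => Real.exp (-B * x)) (Ioi 0) := exp_neg_integrableOn_Ioi 0 hB
  have h2 : IntegrableOn (fun x : ℝ => Real.exp (-(B * |x|))) (Ioi 0) :=
    h1.congr_fun (fun x hx => by simp [abs_of_pos (show 0 < x from hx)]) measurableSet_Ioi
  have h3 : IntegrableOn (fun x : ℝ => Real.exp (-(B * |x|))) (Iio 0) := by
    have := h2.comp_neg
    simpa using this
  rw [← integrableOn_univ, ← Iio_union_Ici (a := (0:ℝ))]
  exact h3.union (Iff.mpr integrableOn_Ici_iff_integrableOn_Ioi h2)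

/-- Half of the exponential is spent on the polynomial, through `t ≤ exp t` and `t ^ 2 / 2 ≤ exp t`
at `t = B |x| / 2`. The weight covers moments up to order two. -/
theorem integrable_sq_mul_exp_neg_mul_abs {B : ℝ} (hB : 0 < B) :
    Integrable (fun x : ℝ => (1 + |x| + x ^ 2) * Real.exp (-(B * |x|))) := by
  have hB2 : 0 < B / 2 := by positivity
  refine ((integrable_exp_neg_mul_abs hB2).const_mul (1 + 1 / (B / 2) + 2 / (B / 2) ^ 2)).mono'
    (by fun_prop) (Eventually.of_forall fun x => ?_)
  have h0 : 0 ≤ B / 2 * |x| := by positivity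
  have h1 : |x| ≤ 1 / (B / 2) * Real.exp (B / 2 * |x|) := by
    rw [div_mul_eq_mul_div, le_div_iff₀ hB2]
    nlinarith [Real.add_one_le_exp (B / 2 * |x|)]
  have h2 : x ^ 2 ≤ 2 / (B / 2) ^ 2 * Real.exp (B / 2 * |x|) := by
    rw [div_mul_eq_mul_div, le_div_iff₀ (by positivity)]
    have := Real.quadratic_le_exp_of_nonneg h0
    rw [← sq_abs x]
    nlinarith
  have h3 : 1 ≤ Real.exp (B / 2 * |x|) := Real.one_le_exp h0
  rw [Real.norm_of_nonneg (by positivity)]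
  calc _ ≤ ((1 + 1 / (B / 2) + 2 / (B / 2) ^ 2) * Real.exp (B / 2 * |x|)) *
        Real.exp (-(B * |x|)) := by
        gcongr; nlinarith
    _ = _ := by rw [mul_assoc, ← Real.exp_add]; congr 2; ring

/-! ### The criterion on real-valued log-concave functions -/

/-- Log-concave functions at which the criterion function of `P` is finite. -/
structure Adm (P : Measure ℝ) (h : ℝ → ℝ) : Prop where
  logConc : LogConc h
  usc : UpperSemicontinuous h
  pos : ∀ᵐ x ∂P, 0 < h x
  logInt : Integrable (fun x => Real.log (h x)) P
  int : Integrable h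

/-- The criterion `∫ log h dP - ∫ h`. -/
noncomputable def crit (P : Measure ℝ) (h : ℝ → ℝ) : ℝ := (∫ x, Real.log (h x) ∂P) - ∫ x, h x

/-- `h` maximizes the criterion of `P`. -/
structure IsProj (P : Measure ℝ) (h : ℝ → ℝ) : Prop where
  adm : Adm P h
  le_crit : ∀ g, Adm P g → crit P g ≤ crit P h

/-- `P` has mass at least `δ` on both sides of the interval `(a, b)`. -/
structure Spread (P : Measure ℝ) (a b δ : ℝ) : Prop where
  lt : a < b
  pos : 0 < δ
  left : δ ≤ P.real (Iic a)
  right : δ ≤ P.real (Ici b)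

theorem Spread.exists_pos {P : Measure ℝ} {a b δ : ℝ} (H : Spread P a b δ) {h : ℝ → ℝ}
    (hp : ∀ᵐ x ∂P, 0 < h x) : (∃ p ≤ a, 0 < h p) ∧ ∃ q, b ≤ q ∧ 0 < h q := by
  have key : ∀ s : Set ℝ, 0 < P.real s → ∃ p ∈ s, 0 < h p := by
    intro s hs
    by_contra hcon
    push Not at hcon
    have : P s = 0 := measure_mono_null (fun x hx => not_lt.2 (hcon x hx)) (ae_iff.1 hp)
    rw [measureReal_def, this] at hs
    simp at hs
  exact ⟨key _ (H.pos.trans_le H.left), key _ (H.pos.trans_le H.right)⟩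

theorem Adm.integral_pos {P : Measure ℝ} {a b δ : ℝ} (H : Spread P a b δ) {h : ℝ → ℝ}
    (hA : Adm P h) : 0 < ∫ x, h x := by
  obtain ⟨⟨p, hp, hp0⟩, q, hq, hq0⟩ := H.exists_pos hA.pos
  have hpq : p < q := hp.trans_lt (H.lt.trans_le hq)
  have := hA.logConc.mul_sub_le_integral hA.int hpq.le (k := min (h p) (h q))
    fun z hz => hA.logConc.min_le hz.1 hz.2
  exact (mul_pos (lt_min hp0 hq0) (sub_pos.2 hpq)).trans_le this

theorem upperSemicontinuous_const_mul {h : ℝ → ℝ} (hu : UpperSemicontinuous h) {k : ℝ}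
    (hk : 0 < k) : UpperSemicontinuous (fun x => k * h x) := by
  intro x y hy
  have : h x < y / k := by rwa [lt_div_iff₀ hk, mul_comm]
  filter_upwards [hu x _ this] with z hz
  rwa [lt_div_iff₀ hk, mul_comm] at hz

theorem Adm.const_mul {P : Measure ℝ} [IsProbabilityMeasure P] {h : ℝ → ℝ} (hA : Adm P h) {k : ℝ}
    (hk : 0 < k) : Adm P (fun x => k * h x) ∧
      crit P (fun x => k * h x) = Real.log k + (∫ x, Real.log (h x) ∂P) - k * ∫ x, h x := by
  have e : (fun x => Real.log (k * h x)) =ᵐ[P] fun x => Real.log k + Real.log (h x) := by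
    filter_upwards [hA.pos] with x hx
    exact Real.log_mul hk.ne' hx.ne'
  refine ⟨⟨hA.logConc.const_mul hk, upperSemicontinuous_const_mul hA.usc hk, ?_, ?_,
    hA.int.const_mul k⟩, ?_⟩
  · filter_upwards [hA.pos] with x hx using mul_pos hk hx
  · exact ((integrable_const _).add hA.logInt).congr e.symm
  · unfold crit
    rw [integral_congr_ae e, integral_add (integrable_const _) hA.logInt, integral_const_mul]
    simp

/-- Rescaling to mass one changes the criterion by `t - 1 - log t`, where `t` is the mass, and this
is positive unless `t = 1`. -/
theorem IsProj.integral_eq_one {P : Measure ℝ} [IsProbabilityMeasure P] {a b δ : ℝ}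
    (H : Spread P a b δ) {h : ℝ → ℝ} (hP : IsProj P h) : ∫ x, h x = 1 := by
  have h0 := hP.adm.integral_pos H
  have h1 := hP.adm.const_mul (inv_pos.2 h0)
  have h2 := hP.le_crit _ h1.1
  rw [h1.2, crit, Real.log_inv, inv_mul_cancel₀ h0.ne'] at h2
  by_contra hne
  have := Real.log_lt_sub_one_of_pos h0 hne
  linarith

theorem integral_log_le {P : Measure ℝ} [IsProbabilityMeasure P] {h : ℝ → ℝ} {A : Set ℝ}
    (hi : Integrable (fun x => Real.log (h x)) P) (hp : ∀ᵐ x ∂P, 0 < h x)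
    (hA : MeasurableSet A) {M r δ : ℝ} (hr : 0 ≤ r) (hδ : δ ≤ P.real A)
    (h1 : ∀ x, h x ≤ Real.exp M) (h2 : ∀ x ∈ A, h x ≤ Real.exp (M - r)) :
    ∫ x, Real.log (h x) ∂P ≤ M - r * δ := by
  calc ∫ x, Real.log (h x) ∂P ≤ ∫ x, (M - A.indicator (fun _ => r) x) ∂P := by
        refine integral_mono_ae hi ((integrable_const _).sub ((integrable_const r).indicator hA)) ?_
        filter_upwards [hp] with x hx
        by_cases hxA : x ∈ A
        · simp only [hxA, indicator_of_mem]
          exact (Real.log_le_iff_le_exp hx).2 (h2 x hxA)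
        · simp only [hxA, not_false_eq_true, indicator_of_notMem, sub_zero]
          exact (Real.log_le_iff_le_exp hx).2 (h1 x)
    _ = M - P.real A * r := by
        rw [integral_sub (integrable_const _) ((integrable_const r).indicator hA),
          integral_indicator_const _ hA]
        simp
    _ ≤ _ := by nlinarith

theorem LogConc.bddAbove {h : ℝ → ℝ} (H : LogConc h) (hi : Integrable h) (h1 : ∫ x, h x ≤ 1)
    {p q : ℝ} (hpq : p < q) (hp : 0 < h p) (hq : 0 < h q) : BddAbove (range h) := by
  refine ⟨(4 / (q - p)) ^ 2 / min (h p) (h q), ?_⟩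
  rintro _ ⟨x, rfl⟩
  exact H.le_of_two_points hi h1 hpq (lt_min hp hq) (min_le_left _ _) (min_le_right _ _) x

/-- Uniform upper bound for functions with a large value of the criterion. -/
theorem Adm.le_exp {P : Measure ℝ} [IsProbabilityMeasure P] {a b δ : ℝ} (H : Spread P a b δ)
    {h : ℝ → ℝ} (hA : Adm P h) (h1 : ∫ x, h x ≤ 1) {C : ℝ} (hC : -C ≤ ∫ x, Real.log (h x) ∂P)
    (x : ℝ) : h x ≤ Real.exp (max 1 (max C (4 * Real.exp 2 / ((b - a) * δ)))) := by
  set K := max 1 (max C (4 * Real.exp 2 / ((b - a) * δ))) with hK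
  by_contra hcon
  push Not at hcon
  obtain ⟨⟨p, hp, hp0⟩, q, hq, hq0⟩ := H.exists_pos hA.pos
  have hbdd := hA.logConc.bddAbove hA.int h1 (hp.trans_lt (H.lt.trans_le hq)) hp0 hq0
  have hS : Real.exp K < ⨆ x, h x := hcon.trans_le (le_ciSup hbdd x)
  have hS0 : 0 < ⨆ x, h x := (Real.exp_pos _).trans hS
  set M := Real.log (⨆ x, h x) with hM
  have hKM : K < M := (Real.lt_log_iff_exp_lt hS0).2 hS
  have hM1 : 1 < M := (le_max_left _ _).trans_lt hKM
  have hMC : C < M := ((le_max_left _ _).trans (le_max_right _ _)).trans_lt hKM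
  have hMe : 4 * Real.exp 2 / ((b - a) * δ) < M :=
    ((le_max_right _ _).trans (le_max_right _ _)).trans_lt hKM
  have hle : ∀ z, h z ≤ Real.exp M := fun z => by
    rw [hM, Real.exp_log hS0]; exact le_ciSup hbdd z
  have hδ1 : δ ≤ 1 := H.left.trans measureReal_le_one
  have hδ := H.pos
  -- With this `r`, a bound `log h ≤ M - r` on either side would give `∫ log h dP ≤ M - 2M = -M <
  -- -C`. So `h` exceeds `exp (M - r)` somewhere on each side.
  set r := 2 * M / δ with hr
  have hrδ : r * δ = 2 * M := by rw [hr]; field_simp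
  have hr1 : 1 ≤ r := by rw [hr, le_div_iff₀ hδ]; linarith
  by_cases hl : ∀ z ∈ Iic a, h z ≤ Real.exp (M - r)
  · have := integral_log_le hA.logInt hA.pos measurableSet_Iic (by linarith) H.left hle hl
    linarith
  by_cases hr : ∀ z ∈ Ici b, h z ≤ Real.exp (M - r)
  · have := integral_log_le hA.logInt hA.pos measurableSet_Ici (by linarith) H.right hle hr
    linarith
  push Not at hl hr
  obtain ⟨u, hu, hu1⟩ := hl
  obtain ⟨v, hv, hv1⟩ := hr
  have hu : u ≤ a := hu
  have hv : b ≤ v := hv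
  have hr0 : 0 < r := by linarith
  obtain ⟨m, hm⟩ : ∃ m, Real.exp (M - 1) < h m := by
    refine exists_lt_of_lt_ciSup ?_
    rw [← Real.lt_log_iff_exp_lt hS0]; linarith
  have huv : u < v := hu.trans_lt (H.lt.trans_le hv)
  -- Shrinking `[u, v]` towards the near-maximizer `m` by the factor `1 / r` raises the lower bound
  -- from `exp (M - r)` to `exp (M - 2)`. The mass then gives `exp (M - 2) (b - a) ≤ r`, which fails
  -- for large `M` because the left side outgrows the linear right side.
  have key := (hA.logConc.mul_sub_le_integral hA.int (α := m + (u - m) / r) (β := m + (v - m) / r)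
    (k := Real.exp (M - 2)) (by gcongr) (fun z hz => ?_)).trans h1
  · have e1 : m + (v - m) / r - (m + (u - m) / r) = (v - u) / r := by ring
    rw [e1, ← mul_div_assoc, div_le_one hr0, Real.exp_sub] at key
    have e2 : M ^ 2 / 2 ≤ Real.exp M := by
      have := Real.quadratic_le_exp_of_nonneg (by linarith : 0 ≤ M); linarith
    have e3 : 0 < b - a := sub_pos.2 H.lt
    have e4 : 0 < Real.exp 2 := Real.exp_pos 2
    have e5 : M ^ 2 / 2 / Real.exp 2 * (b - a) ≤ r := by
      refine le_trans ?_ key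
      gcongr
    have e6 : M ^ 2 / 2 / Real.exp 2 * (b - a) * δ ≤ 2 * M := by
      rw [← hrδ]; gcongr
    rw [div_lt_iff₀ (mul_pos e3 hδ)] at hMe
    have e7 : M ^ 2 / 2 / Real.exp 2 * (b - a) * δ = M / (2 * Real.exp 2) * (M * ((b - a) * δ)) := by
      field_simp
    rw [e7] at e6
    have e8 : M / (2 * Real.exp 2) * (4 * Real.exp 2) < M / (2 * Real.exp 2) * (M * ((b - a) * δ)) := by
      gcongr
    have e9 : M / (2 * Real.exp 2) * (4 * Real.exp 2) = 2 * M := by field_simp; norm_num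
    linarith
  · set w := m + r * (z - m) with hw
    have hz1 : u ≤ w := by
      have := (div_le_iff₀ hr0).1 (show (u - m) / r ≤ z - m by linarith [hz.1])
      linarith [mul_comm (z - m) r]
    have hz2 : w ≤ v := by
      have := (le_div_iff₀ hr0).1 (show z - m ≤ (v - m) / r by linarith [hz.2])
      linarith [mul_comm (z - m) r]
    have hw1 : Real.exp (M - r) ≤ h w :=
      (le_min hu1.le hv1.le).trans (hA.logConc.min_le hz1 hz2)
    have hr' : 1 / r ≤ 1 := by rw [div_le_one hr0]; exact hr1
    have := (logConc_iff.1 hA.logConc).2 m w _ _ (1 - 1 / r) (1 / r) (by linarith) (by positivity)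
      (by ring) hm.le hw1
    have e1 : (1 - 1 / r) * m + 1 / r * w = z := by rw [hw]; field_simp; ring
    rw [e1] at this
    refine le_trans (Real.exp_le_exp.2 ?_) this
    have e2 : (1 - 1 / r) * (M - 1) + 1 / r * (M - r) = M - 2 + 1 / r := by field_simp; ring
    rw [e2]
    have : 0 < 1 / r := by positivity
    linarith

/-- Uniform lower bound between the two sides of a spread measure. -/
theorem Adm.exp_le {P : Measure ℝ} [IsProbabilityMeasure P] {a b δ : ℝ} (H : Spread P a b δ)
    {h : ℝ → ℝ} (hA : Adm P h) {C D : ℝ} (hC : -C ≤ ∫ x, Real.log (h x) ∂P) (hD : 0 ≤ D)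
    (hh : ∀ x, h x ≤ Real.exp D) (hC0 : 0 ≤ C) {x : ℝ} (hax : a ≤ x) (hxb : x ≤ b) :
    Real.exp (-((C + D) / δ)) ≤ h x := by
  by_contra hcon
  push Not at hcon
  have hδ := H.pos
  -- A set of mass `δ` on which `h` stays below a too small value `h x` would pull `∫ log h dP`
  -- below `-C`.
  have fin : ∀ A : Set ℝ, MeasurableSet A → δ ≤ P.real A → (∀ z ∈ A, h z ≤ h x) → False := by
    intro A hA' hδA hz
    have hx : 0 < h x := by
      have : ∃ p ∈ A, 0 < h p := by
        by_contra hcon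
        push Not at hcon
        have : P A = 0 := measure_mono_null (fun x hx => not_lt.2 (hcon x hx)) (ae_iff.1 hA.pos)
        rw [measureReal_def, this] at hδA
        simp at hδA
        linarith
      obtain ⟨p, hp, hp0⟩ := this
      exact hp0.trans_le (hz p hp)
    have h1 : Real.log (h x) < -((C + D) / δ) := (Real.log_lt_iff_lt_exp hx).2 hcon
    have h3 : 0 ≤ (C + D) / δ := by positivity
    have := integral_log_le hA.logInt hA.pos hA' (r := D - Real.log (h x)) (by linarith) hδA hh
      (fun z hzA => by rw [sub_sub_cancel, Real.exp_log hx]; exact hz z hzA)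
    have h2 : (D - Real.log (h x)) * δ > (D + (C + D) / δ) * δ := by
      apply mul_lt_mul_of_pos_right _ hδ; linarith
    have h4 : (D + (C + D) / δ) * δ = D * δ + C + D := by field_simp; ring
    nlinarith
  -- By unimodality `h` cannot exceed `h x` on both sides of `x`, so one of the two half-lines can
  -- serve as `A`.
  by_cases hl : ∀ z ∈ Iic x, h z ≤ h x
  · exact fin _ measurableSet_Iic
      (H.left.trans (measureReal_mono (Iic_subset_Iic.2 hax) (measure_ne_top _ _))) hl
  by_cases hr : ∀ z ∈ Ici x, h z ≤ h x
  · exact fin _ measurableSet_Ici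
      (H.right.trans (measureReal_mono (Ici_subset_Ici.2 hxb) (measure_ne_top _ _))) hr
  push Not at hl hr
  obtain ⟨u, hu, hu1⟩ := hl
  obtain ⟨v, hv, hv1⟩ := hr
  exact absurd (hA.logConc.min_le hu hv) (not_le.2 (lt_min hu1 hv1))

/-! ### Majorants with Lipschitz logarithm -/

/-- The least majorant of `h` whose logarithm is `m`-Lipschitz. -/
noncomputable def lipMaj (m : ℝ) (h : ℝ → ℝ) (x : ℝ) : ℝ := ⨆ y, h y * Real.exp (-(m * |x - y|))

section lipMaj

variable {h : ℝ → ℝ} {S m : ℝ}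

theorem bddAbove_lipMaj (H : LogConc h) (hS : ∀ x, h x ≤ S) (hm : 0 ≤ m) (x : ℝ) :
    BddAbove (range fun y => h y * Real.exp (-(m * |x - y|))) := by
  refine ⟨S, ?_⟩
  rintro _ ⟨y, rfl⟩
  exact (mul_le_of_le_one_right (H.nonneg y) (Real.exp_le_one_iff.2 (by
    have := mul_nonneg hm (abs_nonneg (x - y)); linarith))).trans (hS y)

theorem mul_exp_le_lipMaj (H : LogConc h) (hS : ∀ x, h x ≤ S) (hm : 0 ≤ m) (x y : ℝ) :
    h y * Real.exp (-(m * |x - y|)) ≤ lipMaj m h x :=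
  le_ciSup (bddAbove_lipMaj H hS hm x) y

theorem le_lipMaj (H : LogConc h) (hS : ∀ x, h x ≤ S) (hm : 0 ≤ m) (x : ℝ) :
    h x ≤ lipMaj m h x := by
  simpa using mul_exp_le_lipMaj H hS hm x x

theorem lipMaj_pos (H : LogConc h) (hS : ∀ x, h x ≤ S) (hm : 0 ≤ m) {p : ℝ} (hp : 0 < h p)
    (x : ℝ) : 0 < lipMaj m h x :=
  (mul_pos hp (Real.exp_pos _)).trans_le (mul_exp_le_lipMaj H hS hm x p)

theorem lipMaj_le_exp_mul (H : LogConc h) (hS : ∀ x, h x ≤ S) (hm : 0 ≤ m) (x z : ℝ) :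
    lipMaj m h x ≤ Real.exp (m * |x - z|) * lipMaj m h z := by
  refine ciSup_le fun y => ?_
  have h1 := mul_exp_le_lipMaj H hS hm z y
  calc h y * Real.exp (-(m * |x - y|))
      ≤ h y * (Real.exp (m * |x - z|) * Real.exp (-(m * |z - y|))) := by
        refine mul_le_mul_of_nonneg_left ?_ (H.nonneg y)
        rw [← Real.exp_add, Real.exp_le_exp]
        have : |z - y| ≤ |x - z| + |x - y| := by
          have := abs_sub_le z x y
          rwa [abs_sub_comm z x] at this
        nlinarith [mul_le_mul_of_nonneg_left this hm]
    _ = Real.exp (m * |x - z|) * (h y * Real.exp (-(m * |z - y|))) := by ring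
    _ ≤ _ := mul_le_mul_of_nonneg_left h1 (Real.exp_pos _).le

theorem log_lipMaj_sub_le (H : LogConc h) (hS : ∀ x, h x ≤ S) (hm : 0 ≤ m) {p : ℝ} (hp : 0 < h p)
    (x z : ℝ) : Real.log (lipMaj m h x) - Real.log (lipMaj m h z) ≤ m * |x - z| := by
  have h1 := lipMaj_le_exp_mul H hS hm x z
  have hx := lipMaj_pos H hS hm hp x
  have hz := lipMaj_pos H hS hm hp z
  have := Real.log_le_log hx h1
  rw [Real.log_mul (Real.exp_pos _).ne' hz.ne', Real.log_exp] at this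
  linarith

theorem lipschitzWith_log_lipMaj (H : LogConc h) (hS : ∀ x, h x ≤ S) (hm : 0 < m) {p : ℝ}
    (hp : 0 < h p) : LipschitzWith 1 fun x => Real.log (lipMaj m h x) / m := by
  refine LipschitzWith.of_dist_le_mul fun x z => ?_
  have h1 := log_lipMaj_sub_le H hS hm.le hp x z
  have h2 := log_lipMaj_sub_le H hS hm.le hp z x
  rw [abs_sub_comm] at h2
  rw [Real.dist_eq, Real.dist_eq, NNReal.coe_one, one_mul, ← sub_div, abs_div, abs_of_pos hm,
    div_le_iff₀ hm, abs_le]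
  constructor <;> linarith

theorem continuous_lipMaj (H : LogConc h) (hS : ∀ x, h x ≤ S) (hm : 0 < m) {p : ℝ}
    (hp : 0 < h p) : Continuous (lipMaj m h) := by
  have h1 : Continuous fun x => Real.exp (m * (Real.log (lipMaj m h x) / m)) :=
    Real.continuous_exp.comp
      (continuous_const.mul (lipschitzWith_log_lipMaj H hS hm hp).continuous)
  refine h1.congr fun x => ?_
  rw [mul_div_cancel₀ _ hm.ne', Real.exp_log (lipMaj_pos H hS hm.le hp x)]

/-- On the logarithmic scale the majorant is the sup-convolution of `log h` with the concave
function `-m |·|`. Points that nearly attain the suprema at `x` and `y` are combined, with a loss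
`ε`. -/
theorem logConc_lipMaj (H : LogConc h) (hS : ∀ x, h x ≤ S) (hm : 0 ≤ m) {p : ℝ}
    (hp : 0 < h p) : LogConc (lipMaj m h) := by
  rw [logConc_iff]
  refine ⟨fun x => (lipMaj_pos H hS hm hp x).le, fun x y r s a b ha hb hab hx hy => ?_⟩
  have hz := lipMaj_pos H hS hm hp (a * x + b * y)
  rw [← Real.le_log_iff_exp_le hz]
  refine le_of_forall_pos_le_add fun ε hε => ?_
  have key : ∀ x r, Real.exp r ≤ lipMaj m h x → ∃ u, Real.exp (r - ε + m * |x - u|) ≤ h u := by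
    intro x r hx
    obtain ⟨u, hu⟩ := exists_lt_of_lt_ciSup
      (lt_of_lt_of_le (Real.exp_lt_exp.2 (by linarith : r - ε < r)) hx)
    refine ⟨u, ?_⟩
    rw [Real.exp_neg, ← div_eq_mul_inv, lt_div_iff₀ (Real.exp_pos _), ← Real.exp_add] at hu
    exact hu.le
  obtain ⟨u, hu⟩ := key x r hx
  obtain ⟨v, hv⟩ := key y s hy
  have h1 := (logConc_iff.1 H).2 _ _ _ _ a b ha hb hab hu hv
  have h2 := mul_exp_le_lipMaj H hS hm (a * x + b * y) (a * u + b * v)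
  have h3 : Real.exp (a * r + b * s - ε) ≤ lipMaj m h (a * x + b * y) := by
    refine le_trans ?_ h2
    refine le_trans ?_ (mul_le_mul_of_nonneg_right h1 (Real.exp_pos _).le)
    rw [← Real.exp_add, Real.exp_le_exp]
    have h4 : |a * x + b * y - (a * u + b * v)| ≤ a * |x - u| + b * |y - v| := by
      calc _ = |a * (x - u) + b * (y - v)| := by ring_nf
        _ ≤ |a * (x - u)| + |b * (y - v)| := abs_add_le _ _
        _ = _ := by rw [abs_mul, abs_mul, abs_of_nonneg ha, abs_of_nonneg hb]
    have h5 := mul_le_mul_of_nonneg_left h4 hm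
    have h6 : ε = a * ε + b * ε := by rw [← add_mul, hab, one_mul]
    nlinarith
  rw [← Real.le_log_iff_exp_le hz] at h3
  linarith

/-- A superlevel set of the majorant lies in the neighbourhood of radius `ρ = log (S / s) / m` of
the interval `{s < h}`, and `2ρ` is the length of `{s < S exp (-m |x|)}`. -/
theorem volume_lipMaj_lt (H : LogConc h) (hS : ∀ x, h x ≤ S) (hm : 0 < m) (hh : Measurable h)
    {s : ℝ} (hs : 0 < s) : volume {x | s < lipMaj m h x} ≤
      volume {x | s < h x} + volume {x | s < S * Real.exp (-(m * |x|))} := by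
  rcases eq_empty_or_nonempty {x | s < h x} with hA | ⟨y₀, hy₀⟩
  · have : {x | s < lipMaj m h x} = ∅ := by
      refine eq_empty_of_forall_notMem fun x hx => ?_
      refine absurd (ciSup_le (f := fun y => h y * Real.exp (-(m * |x - y|))) (c := s) fun y => ?_)
        (not_le.2 (show s < lipMaj m h x from hx))
      have h1 : h y ≤ s := not_lt.1 fun h2 => by
        have : y ∈ {x | s < h x} := h2
        rw [hA] at this; exact this
      exact (mul_le_of_le_one_right (H.nonneg y) (Real.exp_le_one_iff.2 (by
        have := mul_nonneg hm.le (abs_nonneg (x - y)); linarith))).trans h1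
    rw [this]; simp
  have hy₀ : s < h y₀ := hy₀
  have hsS : s < S := hy₀.trans_le (hS y₀)
  have hS0 : 0 < S := hs.trans hsS
  set ρ := Real.log (S / s) / m with hρ
  have hexp : ∀ u t, 0 < t → t ≤ S → s < t * Real.exp (-(m * u)) → u < ρ := by
    intro u t ht htS hu
    have h1 : s < S * Real.exp (-(m * u)) := hu.trans_le (by gcongr)
    rw [hρ, lt_div_iff₀ hm, Real.lt_log_iff_exp_lt (div_pos hS0 hs), lt_div_iff₀ hs]
    rw [Real.exp_neg, ← div_eq_mul_inv, lt_div_iff₀ (Real.exp_pos _)] at h1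
    rw [mul_comm u m]; linarith [mul_comm s (Real.exp (m * u))]
  have hρ0 : 0 < ρ := div_pos (Real.log_pos (by rw [lt_div_iff₀ hs]; linarith)) hm
  have hball : Ioo (-ρ) ρ ⊆ {x | s < S * Real.exp (-(m * |x|))} := by
    rintro x ⟨h1, h2⟩
    have h3 : |x| < ρ := abs_lt.2 ⟨h1, h2⟩
    rw [hρ, lt_div_iff₀ hm, Real.lt_log_iff_exp_lt (div_pos hS0 hs), lt_div_iff₀ hs] at h3
    show s < S * Real.exp (-(m * |x|))
    rw [Real.exp_neg, ← div_eq_mul_inv, lt_div_iff₀ (Real.exp_pos _), mul_comm m]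
    linarith
  have hnear : ∀ x, s < lipMaj m h x → ∃ y, s < h y ∧ |x - y| < ρ := by
    intro x hx
    obtain ⟨y, hy⟩ := exists_lt_of_lt_ciSup hx
    have hhy : s < h y := hy.trans_le (mul_le_of_le_one_right (H.nonneg y)
      (Real.exp_le_one_iff.2 (by have := mul_nonneg hm.le (abs_nonneg (x - y)); linarith)))
    exact ⟨y, hhy, hexp _ _ (hs.trans hhy) (hS y) hy⟩
  have hA : MeasurableSet {x | s < h x} := measurableSet_lt measurable_const hh
  have hmid : ∀ {u v w}, s < h u → s < h w → u ≤ v → v ≤ w → s < h v := fun hu hw h1 h2 =>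
    (lt_min hu hw).trans_le (H.min_le h1 h2)
  -- The interval `{s < h}` is cut at `y₀`, its right part moved right by `ρ` and its left part
  -- moved left; the gap is filled by two intervals of length `ρ`. No endpoints have to be named.
  have hsub : {x | s < lipMaj m h x} ⊆ (Ico y₀ (y₀ + ρ) ∪ (fun z => z + -ρ) ⁻¹' ({x | s < h x} ∩ Ici y₀)) ∪
      (Ico (y₀ - ρ) y₀ ∪ (fun z => z + ρ) ⁻¹' ({x | s < h x} \ Ici y₀)) := by
    intro x hx
    obtain ⟨y, hy, hxy⟩ := hnear x hx
    rw [abs_lt] at hxy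
    rcases le_or_gt y₀ x with h0 | h0
    · left
      rcases lt_or_ge x (y₀ + ρ) with h1 | h1
      · exact Or.inl ⟨h0, h1⟩
      · right
        exact ⟨hmid hy₀ hy (by linarith) (by linarith),
          show y₀ ≤ x + -ρ by linarith⟩
    · right
      rcases le_or_gt (y₀ - ρ) x with h1 | h1
      · exact Or.inl ⟨h1, h0⟩
      · right
        refine ⟨hmid hy hy₀ (by linarith) (by linarith), ?_⟩
        show ¬ (y₀ ≤ x + ρ)
        linarith
  calc volume {x | s < lipMaj m h x} ≤ _ := measure_mono hsub
    _ ≤ (volume (Ico y₀ (y₀ + ρ)) + volume ((fun z => z + -ρ) ⁻¹' ({x | s < h x} ∩ Ici y₀))) +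
        (volume (Ico (y₀ - ρ) y₀) + volume ((fun z => z + ρ) ⁻¹' ({x | s < h x} \ Ici y₀))) :=
      (measure_union_le _ _).trans (add_le_add (measure_union_le _ _) (measure_union_le _ _))
    _ = (volume ({x | s < h x} ∩ Ici y₀) + volume ({x | s < h x} \ Ici y₀)) +
        volume (Ioo (-ρ) ρ) := by
      rw [measure_preimage_add_right, measure_preimage_add_right, Real.volume_Ico,
        Real.volume_Ico, Real.volume_Ioo]
      have : ENNReal.ofReal (ρ - -ρ) = ENNReal.ofReal ρ + ENNReal.ofReal ρ := by
        rw [← ENNReal.ofReal_add hρ0.le hρ0.le]; congr 1; ring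
      rw [this, add_sub_cancel_left, sub_sub_cancel]; ring
    _ ≤ _ := by
      rw [measure_inter_add_sdiff _ measurableSet_Ici]
      gcongr

/-- Layer-cake integration of `volume_lipMaj_lt`; the extra term is `∫ S exp (-m |x|) dx`. -/
theorem integral_lipMaj_le (H : LogConc h) (hS : ∀ x, h x ≤ S) (hm : 0 < m) (hh : Measurable h)
    (hi : Integrable h) {p : ℝ} (hp : 0 < h p) :
    Integrable (lipMaj m h) ∧ ∫ x, lipMaj m h x ≤ (∫ x, h x) + 2 * S / m := by
  have hS0 : 0 < S := hp.trans_le (hS p)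
  have hE : Integrable (fun x : ℝ => S * Real.exp (-(m * |x|))) :=
    (integrable_exp_neg_mul_abs hm).const_mul S
  have hEi : ∫ x : ℝ, S * Real.exp (-(m * |x|)) = 2 * S / m := by
    rw [integral_const_mul, integral_comp_abs (f := fun x => Real.exp (-(m * x)))]
    have := integral_exp_mul_Ioi (a := -m) (by linarith) 0
    simp only [neg_mul] at this
    rw [this]; simp; field_simp
  have hc := continuous_lipMaj H hS hm hp
  have h0 : ∀ x, 0 ≤ lipMaj m h x := fun x => (lipMaj_pos H hS hm.le hp x).le
  have key : ∫⁻ x, ENNReal.ofReal (lipMaj m h x) ≤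
      ENNReal.ofReal ((∫ x, h x) + 2 * S / m) := by
    rw [← hEi, ENNReal.ofReal_add (integral_nonneg H.nonneg)
      (integral_nonneg fun x => by positivity),
      ofReal_integral_eq_lintegral_ofReal hi (Eventually.of_forall H.nonneg),
      ofReal_integral_eq_lintegral_ofReal hE (Eventually.of_forall fun x => by positivity),
      lintegral_eq_lintegral_meas_lt _ (Eventually.of_forall h0) hc.aemeasurable,
      lintegral_eq_lintegral_meas_lt _ (Eventually.of_forall H.nonneg) hh.aemeasurable,
      lintegral_eq_lintegral_meas_lt _ (Eventually.of_forall fun x => by positivity)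
        hE.aemeasurable]
    have hanti : Antitone fun s => volume {x | s < h x} := fun s t hst =>
      measure_mono fun x hx => lt_of_le_of_lt hst hx
    rw [← lintegral_add_left hanti.measurable]
    exact setLIntegral_mono' measurableSet_Ioi fun s hs => volume_lipMaj_lt H hS hm hh hs
  have hint : Integrable (lipMaj m h) := by
    refine ⟨hc.aestronglyMeasurable, ?_⟩
    rw [hasFiniteIntegral_iff_ofReal (Eventually.of_forall h0)]
    exact key.trans_lt ENNReal.ofReal_lt_top
  refine ⟨hint, ?_⟩
  rw [← ofReal_integral_eq_lintegral_ofReal hint (Eventually.of_forall h0)] at key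
  exact (ENNReal.ofReal_le_ofReal_iff (add_nonneg (integral_nonneg H.nonneg) (by positivity))).1 key

end lipMaj

/-! ### Stability of the maximizers -/

/-- The Kantorovich distance of `P` and `Q` is at most `W`. -/
def W1Le (P Q : Measure ℝ) (W : ℝ) : Prop :=
  ∀ u : ℝ → ℝ, LipschitzWith 1 u → |∫ x, u x ∂P - ∫ x, u x ∂Q| ≤ W

theorem W1Le.symm {P Q : Measure ℝ} {W : ℝ} (H : W1Le P Q W) : W1Le Q P W := fun u hu => by
  rw [abs_sub_comm]; exact H u hu

theorem integrable_of_lipschitzWith {P : Measure ℝ} [IsFiniteMeasure P]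
    (hP : Integrable (fun x : ℝ => x) P) {u : ℝ → ℝ} {K : ℝ≥0} (hu : LipschitzWith K u) :
    Integrable u P := by
  refine ((integrable_const |u 0|).add (hP.norm.const_mul K)).mono'
    hu.continuous.aestronglyMeasurable (Eventually.of_forall fun x => ?_)
  have := hu.dist_le_mul x 0
  rw [Real.dist_eq, Real.dist_eq, sub_zero] at this
  simp only [Real.norm_eq_abs, Pi.add_apply]
  have h2 := abs_sub_abs_le_abs_sub (u x) (u 0)
  linarith

/-- A raw log-concave function need not be admissible for `Q` at all, since it may vanish on a set
charged by `Q`. Its majorant is positive, with a logarithm that is `m` times a 1-Lipschitz function: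
exchanging the measures costs `m * W`, and the added mass costs `2 * S / m`. -/
theorem adm_lipMaj {P Q : Measure ℝ} [IsProbabilityMeasure P] [IsProbabilityMeasure Q]
    (hP : Integrable (fun x : ℝ => x) P) (hQ : Integrable (fun x : ℝ => x) Q) {W : ℝ}
    (hW : W1Le P Q W) {h : ℝ → ℝ} (hA : Adm P h) {S m : ℝ} (hS : ∀ x, h x ≤ S) (hm : 0 < m) :
    Adm Q (lipMaj m h) ∧ crit P h - (m * W + 2 * S / m) ≤ crit Q (lipMaj m h) := by
  have H := hA.logConc
  obtain ⟨p, hp⟩ := hA.pos.exists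
  have hL := lipschitzWith_log_lipMaj H hS hm hp
  obtain ⟨hi, hle⟩ := integral_lipMaj_le H hS hm hA.usc.measurable hA.int hp
  have e : (fun x => Real.log (lipMaj m h x)) = fun x => m * (Real.log (lipMaj m h x) / m) := by
    funext x; field_simp
  have hiP : Integrable (fun x => Real.log (lipMaj m h x)) P := by
    rw [e]; exact (integrable_of_lipschitzWith hP hL).const_mul m
  have hiQ : Integrable (fun x => Real.log (lipMaj m h x)) Q := by
    rw [e]; exact (integrable_of_lipschitzWith hQ hL).const_mul m
  refine ⟨⟨logConc_lipMaj H hS hm.le hp, (continuous_lipMaj H hS hm hp).upperSemicontinuous,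
    Eventually.of_forall fun x => lipMaj_pos H hS hm.le hp x, hiQ, hi⟩, ?_⟩
  have h1 : ∫ x, Real.log (h x) ∂P ≤ ∫ x, Real.log (lipMaj m h x) ∂P := by
    refine integral_mono_ae hA.logInt hiP ?_
    filter_upwards [hA.pos] with x hx using Real.log_le_log hx (le_lipMaj H hS hm.le x)
  have h2 := hW _ hL
  rw [integral_div, integral_div, ← sub_div, abs_div, abs_of_pos hm, div_le_iff₀ hm] at h2
  have h3 := (abs_le.1 h2).2
  unfold crit
  linarith

theorem upperSemicontinuous_sqrt_mul {g h : ℝ → ℝ} (hg : UpperSemicontinuous g)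
    (hh : UpperSemicontinuous h) (hg0 : ∀ x, 0 ≤ g x) (hh0 : ∀ x, 0 ≤ h x) :
    UpperSemicontinuous fun x => √(g x * h x) := by
  intro x y hy
  have hy0 : 0 < y := (Real.sqrt_nonneg _).trans_lt hy
  rw [Real.sqrt_lt' hy0] at hy
  have hc : Tendsto (fun ε : ℝ => (g x + ε) * (h x + ε)) (𝓝[>] 0) (𝓝 ((g x + 0) * (h x + 0))) :=
    (Continuous.tendsto (by fun_prop) 0).mono_left nhdsWithin_le_nhds
  rw [add_zero, add_zero] at hc
  obtain ⟨ε, hε, hε0⟩ := ((hc.eventually_lt_const hy).and self_mem_nhdsWithin).exists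
  have hε0 : 0 < ε := hε0
  filter_upwards [hg x (g x + ε) (by linarith), hh x (h x + ε) (by linarith)] with z h1 h2
  rw [Real.sqrt_lt' hy0]
  refine lt_of_le_of_lt ?_ hε
  have := hg0 x
  gcongr
  exact hh0 z

/-- The log term is exactly averaged, while the mass of the geometric mean falls short of the
average mass by half the squared Hellinger distance. This quantifies strict concavity of the
criterion. -/
theorem Adm.sqrt_mul {P : Measure ℝ} {g h : ℝ → ℝ} (hg : Adm P g) (hh : Adm P h) :
    Adm P (fun x => √(g x * h x)) ∧ Integrable (fun x => (√(g x) - √(h x)) ^ 2) ∧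
      crit P (fun x => √(g x * h x)) =
        (crit P g + crit P h + ∫ x, (√(g x) - √(h x)) ^ 2) / 2 := by
  have g0 := hg.logConc.nonneg
  have h0 := hh.logConc.nonneg
  have e : (fun x => Real.log (√(g x * h x))) =ᵐ[P]
      fun x => (1 / 2) * (Real.log (g x) + Real.log (h x)) := by
    filter_upwards [hg.pos, hh.pos] with x h1 h2
    rw [Real.log_sqrt (mul_pos h1 h2).le, Real.log_mul h1.ne' h2.ne']; ring
  have hli : Integrable (fun x => (1 / 2) * (Real.log (g x) + Real.log (h x))) P :=
    (hg.logInt.add hh.logInt).const_mul _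
  have husc := upperSemicontinuous_sqrt_mul hg.usc hh.usc g0 h0
  have hi : Integrable (fun x => √(g x * h x)) := by
    refine (hg.int.add hh.int).mono' husc.measurable.aestronglyMeasurable
      (Eventually.of_forall fun x => ?_)
    rw [Real.norm_of_nonneg (Real.sqrt_nonneg _), Pi.add_apply]
    rw [Real.sqrt_le_left (add_nonneg (g0 x) (h0 x))]
    nlinarith [g0 x, h0 x, mul_nonneg (g0 x) (h0 x)]
  have e2 : (fun x => (√(g x) - √(h x)) ^ 2) = fun x => (g x + h x) - 2 * √(g x * h x) := by
    funext x
    rw [Real.sqrt_mul (g0 x), sub_sq, Real.sq_sqrt (g0 x), Real.sq_sqrt (h0 x)]; ring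
  refine ⟨⟨(hg.logConc.mul hh.logConc).sqrt, husc, ?_, hli.congr e.symm, hi⟩, ?_, ?_⟩
  · filter_upwards [hg.pos, hh.pos] with x h1 h2 using Real.sqrt_pos.2 (mul_pos h1 h2)
  · rw [e2]; exact (hg.int.add hh.int).sub (hi.const_mul 2)
  · have e3 : ∫ x, (g x + h x - 2 * √(g x * h x)) =
        (∫ x, g x) + (∫ x, h x) - 2 * ∫ x, √(g x * h x) := by
      have h1 : Integrable fun x => g x + h x := hg.int.add hh.int
      rw [integral_sub h1 (hi.const_mul 2), integral_add hg.int hh.int, integral_const_mul]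
    unfold crit
    rw [e2, e3, integral_congr_ae e, integral_const_mul, integral_add hg.logInt hh.logInt]
    ring

theorem IsProj.hellinger_le {P : Measure ℝ} {g h : ℝ → ℝ} (hg : IsProj P g) (hh : Adm P h) :
    ∫ x, (√(g x) - √(h x)) ^ 2 ≤ crit P g - crit P h := by
  obtain ⟨h1, -, h3⟩ := hg.adm.sqrt_mul hh
  have := hg.le_crit _ h1
  linarith

/-- The maximizer is essentially unique. -/
theorem IsProj.ae_eq {P : Measure ℝ} {g h : ℝ → ℝ} (hg : IsProj P g) (hh : IsProj P h) :
    g =ᵐ[volume] h := by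
  have h1 := hg.hellinger_le hh.adm
  have h2 := hh.le_crit _ hg.adm
  have h3 : ∫ x, (√(g x) - √(h x)) ^ 2 = 0 :=
    le_antisymm (by linarith) (integral_nonneg fun x => sq_nonneg _)
  rw [integral_eq_zero_iff_of_nonneg (fun x => sq_nonneg _) (hg.adm.sqrt_mul hh.adm).2.1] at h3
  filter_upwards [h3] with x hx
  have h4 : √(g x) - √(h x) = 0 := by simpa using hx
  exact (Real.sqrt_inj (hg.adm.logConc.nonneg x) (hh.adm.logConc.nonneg x)).1 (by linarith)

/-- Let `η = m W + 2S/m` and let `L`, `L'` be the majorants of `f`, `g`. Then `crit Q L ≥ crit P f -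
η ≥ crit P L' - η ≥ crit Q g - 2η`, so `g` and `L` are Hellinger close. The passage from `L` back to
`f` is controlled by `(√L - √f)² ≤ L - f`, whose integral is at most `2S/m`. -/
theorem IsProj.hellinger_le_of_W1Le {P Q : Measure ℝ} [IsProbabilityMeasure P]
    [IsProbabilityMeasure Q] (hP : Integrable (fun x : ℝ => x) P)
    (hQ : Integrable (fun x : ℝ => x) Q) {W : ℝ} (hW : W1Le P Q W) {f g : ℝ → ℝ}
    (hf : IsProj P f) (hg : IsProj Q g) {S m : ℝ} (hfS : ∀ x, f x ≤ S) (hgS : ∀ x, g x ≤ S)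
    (hm : 0 < m) : Integrable (fun x => (√(g x) - √(f x)) ^ 2) ∧
      ∫ x, (√(g x) - √(f x)) ^ 2 ≤ 4 * m * W + 12 * S / m := by
  obtain ⟨a1, c1⟩ := adm_lipMaj hP hQ hW hf.adm hfS hm
  obtain ⟨a2, c2⟩ := adm_lipMaj hQ hP hW.symm hg.adm hgS hm
  have h1 := hg.hellinger_le a1
  have h2 := hf.le_crit _ a2
  obtain ⟨-, i1, -⟩ := hg.adm.sqrt_mul a1
  have F := hf.adm.logConc
  have G := hg.adm.logConc
  obtain ⟨p, hp⟩ := hf.adm.pos.exists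
  obtain ⟨hi, hle⟩ := integral_lipMaj_le F hfS hm hf.adm.usc.measurable hf.adm.int hp
  have i2 : Integrable fun x => 2 * (√(g x) - √(lipMaj m f x)) ^ 2 + 2 * (lipMaj m f x - f x) :=
    (i1.const_mul 2).add ((hi.sub hf.adm.int).const_mul 2)
  have hb : ∀ x, (√(g x) - √(f x)) ^ 2 ≤
      2 * (√(g x) - √(lipMaj m f x)) ^ 2 + 2 * (lipMaj m f x - f x) := by
    intro x
    have h3 := le_lipMaj F hfS hm.le x
    have h4 := Real.sqrt_le_sqrt h3
    have h5 := Real.sq_sqrt (F.nonneg x)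
    have h6 := Real.sq_sqrt ((F.nonneg x).trans h3)
    nlinarith [sq_nonneg (√(g x) - √(lipMaj m f x) - (√(lipMaj m f x) - √(f x))),
      Real.sqrt_nonneg (f x), mul_nonneg (Real.sqrt_nonneg (f x)) (sub_nonneg.2 h4)]
  have i3 : Integrable fun x => (√(g x) - √(f x)) ^ 2 := by
    refine i2.mono' ?_ (Eventually.of_forall fun x => ?_)
    · exact ((hg.adm.usc.measurable.sqrt.sub hf.adm.usc.measurable.sqrt).pow_const 2).aestronglyMeasurable
    · rw [Real.norm_of_nonneg (sq_nonneg _)]; exact hb x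
  refine ⟨i3, ?_⟩
  calc ∫ x, (√(g x) - √(f x)) ^ 2
      ≤ ∫ x, (2 * (√(g x) - √(lipMaj m f x)) ^ 2 + 2 * (lipMaj m f x - f x)) :=
        integral_mono i3 i2 hb
    _ = 2 * (∫ x, (√(g x) - √(lipMaj m f x)) ^ 2) +
        2 * ((∫ x, lipMaj m f x) - ∫ x, f x) := by
        have i4 : Integrable fun x => lipMaj m f x - f x := hi.sub hf.adm.int
        rw [integral_add (i1.const_mul 2) (i4.const_mul 2), integral_const_mul,
          integral_const_mul, integral_sub hi hf.adm.int]
    _ ≤ 2 * (2 * (m * W + 2 * S / m)) + 2 * (2 * S / m) := by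
        gcongr <;> linarith
    _ = _ := by ring

/-! ### Uniform bounds along a sequence of measures -/

/-- A competitor that is admissible for every law with a first moment; it bounds the criterion of
the maximizer from below. -/
theorem crit_exp_neg_abs {P : Measure ℝ} [IsProbabilityMeasure P]
    (hP : Integrable (fun x : ℝ => x) P) : Adm P (fun x => Real.exp (-|x|)) ∧
      crit P (fun x => Real.exp (-|x|)) = -(∫ x, |x| ∂P) - 2 := by
  have hi : Integrable (fun x : ℝ => Real.exp (-|x|)) := by
    simpa using integrable_exp_neg_mul_abs one_pos
  refine ⟨⟨by simpa using LogConc.exp_neg_mul_abs 1 0 one_pos.le,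
    (by fun_prop : Continuous fun x : ℝ => Real.exp (-|x|)).upperSemicontinuous,
    Eventually.of_forall fun x => Real.exp_pos _, by simpa using hP.abs.neg, hi⟩, ?_⟩
  unfold crit
  simp only [Real.log_exp]
  rw [integral_neg, integral_comp_abs (f := fun x => Real.exp (-x)), integral_exp_neg_Ioi_zero]
  ring

/-- For a maximizer, `∫ log h dP` is bounded below in terms of the first absolute moment. -/
theorem IsProj.le_integral_log {P : Measure ℝ} [IsProbabilityMeasure P] {a b δ : ℝ}
    (H : Spread P a b δ) (hP : Integrable (fun x : ℝ => x) P) {h : ℝ → ℝ} (hh : IsProj P h) :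
    -((∫ x, |x| ∂P) + 1) ≤ ∫ x, Real.log (h x) ∂P := by
  have h1 := crit_exp_neg_abs hP
  have h2 := hh.le_crit _ h1.1
  rw [h1.2, crit, hh.integral_eq_one H] at h2
  linarith

/-- Spread measures with bounded first moment have maximizers with a common exponential envelope
and a common lower bound in the middle. -/
theorem exists_uniform_envelope {a b δ D : ℝ} (hab : a < b) (hD : 0 ≤ D) :
    ∃ A B c : ℝ, 0 < A ∧ 0 < B ∧ 0 < c ∧ ∀ (P : Measure ℝ) (h : ℝ → ℝ), IsProbabilityMeasure P →
      Spread P a b δ → Adm P h → ∫ x, h x ≤ 1 → -D ≤ ∫ x, Real.log (h x) ∂P →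
        (∀ x, h x ≤ A * Real.exp (-(B * |x|))) ∧ ∀ x ∈ Icc a b, c ≤ h x := by
  set K := max 1 (max D (4 * Real.exp 2 / ((b - a) * δ))) with hK
  set c := Real.exp (-((D + K) / δ)) with hc
  obtain ⟨A, B, hB, hA, hE⟩ := LogConc.exists_envelope hab (Real.exp_pos (-((D + K) / δ)))
  refine ⟨A, B, c, hA, hB, Real.exp_pos _, fun P h _ H hA h1 hC => ?_⟩
  have hlow : ∀ x ∈ Icc a b, c ≤ h x := fun x hx =>
    hA.exp_le H hC (zero_le_one.trans (le_max_left _ _)) (hA.le_exp H h1 hC) hD hx.1 hx.2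
  exact ⟨hE h hA.logConc hA.int h1 (hlow a ⟨le_rfl, hab.le⟩) (hlow b ⟨hab.le, le_rfl⟩), hlow⟩

/-! ### Existence of the maximizer -/

/-- The upper semicontinuous hull of a bounded function. -/
noncomputable def uscHull (h : ℝ → ℝ) (x : ℝ) : ℝ := limsup h (𝓝 x)

section uscHull

variable {h : ℝ → ℝ} {S : ℝ}

theorem eventually_lt_of_uscHull_lt (hS : ∀ x, h x ≤ S) {x v : ℝ} (hv : uscHull h x < v) :
    ∀ᶠ y in 𝓝 x, h y < v :=
  eventually_lt_of_limsup_lt hv (isBoundedUnder_of ⟨S, hS⟩)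

theorem frequently_lt_of_lt_uscHull (h0 : ∀ x, 0 ≤ h x) {x v : ℝ} (hv : v < uscHull h x) :
    ∃ᶠ y in 𝓝 x, v < h y :=
  frequently_lt_of_lt_limsup (IsBoundedUnder.isCoboundedUnder_le (isBoundedUnder_of ⟨0, h0⟩)) hv

theorem uscHull_le_of_eventually_le (h0 : ∀ x, 0 ≤ h x) {x v : ℝ} (hv : ∀ᶠ y in 𝓝 x, h y ≤ v) :
    uscHull h x ≤ v :=
  limsup_le_of_le (IsBoundedUnder.isCoboundedUnder_le (isBoundedUnder_of ⟨0, h0⟩)) hv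

theorem le_uscHull (hS : ∀ x, h x ≤ S) (x : ℝ) : h x ≤ uscHull h x := by
  by_contra hcon
  push Not at hcon
  exact lt_irrefl _ (eventually_lt_of_uscHull_lt hS hcon).self_of_nhds

theorem upperSemicontinuous_uscHull (h0 : ∀ x, 0 ≤ h x) (hS : ∀ x, h x ≤ S) :
    UpperSemicontinuous (uscHull h) := by
  intro x v hv
  obtain ⟨w, hw1, hw2⟩ := exists_between hv
  filter_upwards [(eventually_lt_of_uscHull_lt hS hw1).eventually_nhds] with y hy
  exact (uscHull_le_of_eventually_le h0 (hy.mono fun z hz => hz.le)).trans_lt hw2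

/-- Values of the hull are nearly attained by `h` at nearby points, and convex combinations of
points close to `x` and `y` are close to the convex combination of `x` and `y`. -/
theorem logConc_uscHull (H : LogConc h) (hS : ∀ x, h x ≤ S) : LogConc (uscHull h) := by
  have h0 := H.nonneg
  rw [logConc_iff] at H ⊢
  refine ⟨fun x => (h0 x).trans (le_uscHull hS x), fun x y r s a b ha hb hab hx hy => ?_⟩
  by_contra hcon
  push Not at hcon
  have hc : Tendsto (fun ε : ℝ => Real.exp (a * r + b * s - ε)) (𝓝[>] 0)
      (𝓝 (Real.exp (a * r + b * s - 0))) :=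
    (Continuous.tendsto (by fun_prop) 0).mono_left nhdsWithin_le_nhds
  rw [sub_zero] at hc
  obtain ⟨ε, hε, hε0⟩ := ((hc.eventually_const_lt hcon).and self_mem_nhdsWithin).exists
  have hε0 : 0 < ε := hε0
  obtain ⟨η, hη, hball⟩ := Metric.eventually_nhds_iff.1 (eventually_lt_of_uscHull_lt hS hε)
  have key : ∀ x r, Real.exp r ≤ uscHull h x → ∃ u, |u - x| < η ∧ Real.exp (r - ε) ≤ h u := by
    intro x r hx
    have h1 := frequently_lt_of_lt_uscHull h0
      (lt_of_lt_of_le (Real.exp_lt_exp.2 (by linarith : r - ε < r)) hx)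
    obtain ⟨u, hu1, hu2⟩ := (h1.and_eventually (Metric.ball_mem_nhds x hη)).exists
    exact ⟨u, hu2, hu1.le⟩
  obtain ⟨u, hu1, hu2⟩ := key x r hx
  obtain ⟨v, hv1, hv2⟩ := key y s hy
  have h1 := H.2 u v _ _ a b ha hb hab hu2 hv2
  have h2 : |a * u + b * v - (a * x + b * y)| < η := by
    calc |a * u + b * v - (a * x + b * y)| = |a * (u - x) + b * (v - y)| := by ring_nf
      _ ≤ |a * (u - x)| + |b * (v - y)| := abs_add_le _ _
      _ = a * |u - x| + b * |v - y| := by rw [abs_mul, abs_mul, abs_of_nonneg ha, abs_of_nonneg hb]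
      _ ≤ max |u - x| |v - y| := by
        have e1 := mul_le_mul_of_nonneg_left (le_max_left |u - x| |v - y|) ha
        have e2 := mul_le_mul_of_nonneg_left (le_max_right |u - x| |v - y|) hb
        have e3 : a * max |u - x| |v - y| + b * max |u - x| |v - y| = max |u - x| |v - y| := by
          rw [← add_mul, hab, one_mul]
        linarith
      _ < η := max_lt hu1 hv1
  have h3 := hball (y := a * u + b * v) (by rwa [Real.dist_eq])
  have h4 : a * (r - ε) + b * (s - ε) = a * r + b * s - ε := by linear_combination (-ε) * hab
  rw [h4] at h1
  exact absurd h3 (not_lt.2 h1)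

/-- The two can differ only on the frontier of the convex set of positivity, which is null. -/
theorem uscHull_ae_eq (H : LogConc h) (hS : ∀ x, h x ≤ S) : uscHull h =ᵐ[volume] h := by
  have h1 : volume (frontier {x | 0 < h x}) = 0 := H.concaveOn.1.addHaar_frontier volume
  filter_upwards [measure_eq_zero_iff_ae_notMem.1 h1] with x hx
  refine le_antisymm ?_ (le_uscHull hS x)
  by_cases hi : x ∈ interior {x | 0 < h x}
  · refine le_of_forall_gt_imp_ge_of_dense fun v hv => uscHull_le_of_eventually_le H.nonneg ?_
    filter_upwards [(H.continuousAt hi).eventually_lt_const hv] with y hy using hy.le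
  · have hc : x ∉ closure {x | 0 < h x} := fun hc => hx ⟨hc, hi⟩
    refine uscHull_le_of_eventually_le H.nonneg ?_
    filter_upwards [isClosed_closure.isOpen_compl.mem_nhds hc] with y hy
    have : ¬ 0 < h y := fun h2 => hy (subset_closure h2)
    exact (not_lt.1 this).trans (H.nonneg x)

end uscHull

/-- A uniformly bounded sequence of functions has a subsequence converging on the rationals. -/
theorem exists_subseq_tendsto_rat {h : ℕ → ℝ → ℝ} {S : ℝ} (h0 : ∀ j x, 0 ≤ h j x)
    (hS : ∀ j x, h j x ≤ S) : ∃ σ : ℕ → ℕ, StrictMono σ ∧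
      ∀ r : ℚ, ∃ z, Tendsto (fun j => h (σ j) r) atTop (𝓝 z) := by
  have hK : IsCompact (Set.pi univ fun _ : ℚ => Icc (0:ℝ) S) :=
    isCompact_univ_pi fun _ => isCompact_Icc
  obtain ⟨Φ, -, σ, hσ, hlim⟩ := hK.tendsto_subseq (x := fun j (r : ℚ) => h j r)
    fun j r _ => ⟨h0 j r, hS j r⟩
  exact ⟨σ, hσ, fun r => ⟨Φ r, (tendsto_pi_nhds.1 hlim) r⟩⟩

section limit

variable {h : ℕ → ℝ → ℝ} {S : ℝ}

theorem logConc_liminf (H : ∀ j, LogConc (h j)) (hS : ∀ j x, h j x ≤ S) :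
    LogConc fun x => liminf (fun j => h j x) atTop := by
  have hb : ∀ x, IsBoundedUnder (· ≥ ·) atTop fun j => h j x := fun x =>
    isBoundedUnder_of ⟨0, fun j => (H j).nonneg x⟩
  have hc : ∀ x, IsCoboundedUnder (· ≥ ·) atTop fun j => h j x := fun x =>
    IsBoundedUnder.isCoboundedUnder_ge (isBoundedUnder_of ⟨S, fun j => hS j x⟩)
  rw [logConc_iff]
  refine ⟨fun x => le_liminf_of_le (hc x) (Eventually.of_forall fun j => (H j).nonneg x),
    fun x y r s a b ha hb' hab hx hy => ?_⟩
  refine le_of_forall_lt fun v hv => ?_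
  have hct : Tendsto (fun ε : ℝ => Real.exp (a * r + b * s - ε)) (𝓝[>] 0)
      (𝓝 (Real.exp (a * r + b * s - 0))) :=
    (Continuous.tendsto (by fun_prop) 0).mono_left nhdsWithin_le_nhds
  rw [sub_zero] at hct
  obtain ⟨ε, hε, hε0⟩ := ((hct.eventually_const_lt hv).and self_mem_nhdsWithin).exists
  have hε0 : 0 < ε := hε0
  refine hε.trans_le (le_liminf_of_le (hc _) ?_)
  filter_upwards [eventually_lt_of_lt_liminf
      (lt_of_lt_of_le (Real.exp_lt_exp.2 (by linarith : r - ε < r)) hx) (hb x),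
    eventually_lt_of_lt_liminf
      (lt_of_lt_of_le (Real.exp_lt_exp.2 (by linarith : s - ε < s)) hy) (hb y)] with j h1 h2
  have h3 := (logConc_iff.1 (H j)).2 x y _ _ a b ha hb' hab h1.le h2.le
  have h4 : a * (r - ε) + b * (s - ε) = a * r + b * s - ε := by linear_combination (-ε) * hab
  rwa [h4] at h3

/-- Along a sequence converging on the rationals, the values are asymptotically bounded by the
hull of the limit, everywhere. -/
theorem eventually_lt_of_uscHull_liminf_lt (H : ∀ j, LogConc (h j)) (hS : ∀ j x, h j x ≤ S)
    (hr : ∀ r : ℚ, ∃ z, Tendsto (fun j => h j r) atTop (𝓝 z)) {c e : ℝ} (hc : 0 < c)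
    (he : ∀ j, c ≤ h j e) {x v : ℝ} (hxe : x ≠ e)
    (hv : uscHull (fun x => liminf (fun j => h j x) atTop) x < v) :
    ∀ᶠ j in atTop, h j x < v := by
  have HL := logConc_liminf H hS
  have hLS : ∀ x, liminf (fun j => h j x) atTop ≤ S := fun x =>
    liminf_le_of_le (isBoundedUnder_of ⟨0, fun j => (H j).nonneg x⟩)
      fun b hb => by
        obtain ⟨j, hj⟩ := hb.exists
        exact hj.trans (hS j x)
  have hv0 : 0 < v := ((HL.nonneg x).trans (le_uscHull hLS x)).trans_lt hv
  obtain ⟨w, hw1, hw2⟩ := exists_between hv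
  -- If `h j x ≥ v`, then the chord from `(x, log v)` to `(e, log c)` bounds `h j` from below
  -- between `x` and `e`. At a rational `y` close to `x` this bound still exceeds `w`, whereas `h j
  -- y` converges to a limit below `w`.
  have hG : Tendsto (fun y => Real.exp ((1 - (y - x) / (e - x)) * Real.log v +
      (y - x) / (e - x) * Real.log c)) (𝓝 x) (𝓝 (Real.exp ((1 - (x - x) / (e - x)) * Real.log v +
      (x - x) / (e - x) * Real.log c))) := Continuous.tendsto (by fun_prop) x
  rw [sub_self, zero_div, sub_zero, one_mul, zero_mul, add_zero, Real.exp_log hv0] at hG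
  obtain ⟨η, hη, hball⟩ := Metric.eventually_nhds_iff.1
    ((eventually_lt_of_uscHull_lt hLS hw1).and (hG.eventually_const_lt hw2))
  obtain ⟨y, hy1, hy2, hy3⟩ : ∃ y : ℚ, |(y : ℝ) - x| < η ∧ 0 ≤ ((y : ℝ) - x) / (e - x) ∧
      ((y : ℝ) - x) / (e - x) ≤ 1 := by
    rcases lt_or_gt_of_ne hxe with h1 | h1
    · obtain ⟨y, hy1, hy2⟩ := exists_rat_btwn (lt_min h1 (by linarith : x < x + η))
      have h2 := hy2.trans_le (min_le_left _ _)
      have h3 := hy2.trans_le (min_le_right _ _)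
      have h4 : 0 < e - x := by linarith
      refine ⟨y, abs_lt.2 ⟨by linarith, by linarith⟩, div_nonneg (by linarith) h4.le, ?_⟩
      rw [div_le_one h4]; linarith
    · obtain ⟨y, hy1, hy2⟩ := exists_rat_btwn (max_lt h1 (by linarith : x - η < x))
      have h2 := (le_max_left _ _).trans_lt hy1
      have h3 := (le_max_right _ _).trans_lt hy1
      have h4 : e - x < 0 := by linarith
      refine ⟨y, abs_lt.2 ⟨by linarith, by linarith⟩, div_nonneg_of_nonpos (by linarith) h4.le, ?_⟩
      rw [div_le_one_of_neg h4]; linarith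
  obtain ⟨hb1, hb2⟩ := hball (y := (y : ℝ)) (by rwa [Real.dist_eq])
  obtain ⟨z, hz⟩ := hr y
  have hzw : z < w := by rw [← hz.liminf_eq]; exact hb1
  filter_upwards [hz.eventually_lt_const hzw] with j hj
  by_contra hcon
  push Not at hcon
  have h1 := (logConc_iff.1 (H j)).2 x e (Real.log v) (Real.log c)
    (1 - ((y : ℝ) - x) / (e - x)) (((y : ℝ) - x) / (e - x)) (by linarith) hy2 (by ring)
    (by rwa [Real.exp_log hv0]) (by rw [Real.exp_log hc]; exact he j)
  have h2 : (1 - ((y : ℝ) - x) / (e - x)) * x + ((y : ℝ) - x) / (e - x) * e = y := by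
    have : e - x ≠ 0 := sub_ne_zero.2 (Ne.symm hxe)
    field_simp; ring
  rw [h2] at h1
  linarith

end limit

/-- The function `K - log v`, with value `∞` for `v ≤ 0`. -/
noncomputable def negLog (K v : ℝ) : ℝ≥0∞ := if v ≤ 0 then ⊤ else ENNReal.ofReal (K - Real.log v)

theorem negLog_antitone (K : ℝ) : Antitone (negLog K) := by
  intro v w hvw
  unfold negLog
  by_cases hv : v ≤ 0
  · simp [hv]
  · have hw : ¬ w ≤ 0 := fun h => hv (hvw.trans h)
    rw [if_neg hv, if_neg hw]
    exact ENNReal.ofReal_le_ofReal (by linarith [Real.log_le_log (not_le.1 hv) hvw])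

/-- Continuity from the right, including at `v ≤ 0` where the value is infinite. It turns eventual
upper bounds on functions into lower bounds on the liminf of `negLog`, as Fatou's lemma requires. -/
theorem exists_lt_negLog {K v : ℝ} {e : ℝ≥0∞} (he : e < negLog K v) :
    ∃ w, v < w ∧ e < negLog K w := by
  have hetop : e ≠ ⊤ := (he.trans_le le_top).ne
  unfold negLog at *
  by_cases hv : v ≤ 0
  · refine ⟨Real.exp (K - e.toReal - 1), by linarith [Real.exp_pos (K - e.toReal - 1)], ?_⟩
    rw [if_neg (not_le.2 (Real.exp_pos _)), Real.log_exp,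
      ENNReal.lt_ofReal_iff_toReal_lt hetop]
    linarith
  · rw [if_neg hv, ENNReal.lt_ofReal_iff_toReal_lt hetop] at he
    have hv := not_le.1 hv
    have hc : Tendsto (fun w => K - Real.log w) (𝓝[>] v) (𝓝 (K - Real.log v)) :=
      (continuousAt_const.sub (Real.continuousAt_log hv.ne')).tendsto.mono_left nhdsWithin_le_nhds
    obtain ⟨w, hw1, hw2⟩ := ((hc.eventually_const_lt he).and self_mem_nhdsWithin).exists
    have hw2 : v < w := hw2
    refine ⟨w, hw2, ?_⟩
    rwa [if_neg (not_le.2 (hv.trans hw2)), ENNReal.lt_ofReal_iff_toReal_lt hetop]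

theorem measurable_negLog (K : ℝ) : Measurable (negLog K) := (negLog_antitone K).measurable

/-- Limits of maximizing sequences. -/
theorem exists_adm_of_seq {P : Measure ℝ} [IsProbabilityMeasure P] {h : ℕ → ℝ → ℝ} {S c a b : ℝ}
    (hA : ∀ j, Adm P (h j)) (h1 : ∀ j, ∫ x, h j x ≤ 1) (hS : ∀ j x, h j x ≤ S) (hab : a ≠ b)
    (hc : 0 < c) (ha : ∀ j, c ≤ h j a) (hb : ∀ j, c ≤ h j b) {L : ℝ}
    (hL : Tendsto (fun j => ∫ x, Real.log (h j x) ∂P) atTop (𝓝 L)) :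
    ∃ g, Adm P g ∧ ∫ x, g x ≤ 1 ∧ L ≤ ∫ x, Real.log (g x) ∂P := by
  obtain ⟨σ, hσ, hr⟩ := exists_subseq_tendsto_rat (fun j x => (hA j).logConc.nonneg x) hS
  set k := fun j => h (σ j) with hk
  have H : ∀ j, LogConc (k j) := fun j => (hA _).logConc
  have hkS : ∀ j x, k j x ≤ S := fun j x => hS _ x
  set Λ := fun x => liminf (fun j => k j x) atTop with hΛ
  have HL : LogConc Λ := logConc_liminf H hkS
  have hbdd : ∀ x, IsBoundedUnder (· ≥ ·) atTop fun j => k j x := fun x =>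
    isBoundedUnder_of ⟨0, fun j => (H j).nonneg x⟩
  have hΛS : ∀ x, Λ x ≤ S := fun x => liminf_le_of_le (hbdd x) fun b hb => by
    obtain ⟨j, hj⟩ := hb.exists
    exact hj.trans (hkS j x)
  set g := uscHull Λ with hg
  have G : LogConc g := logConc_uscHull HL hΛS
  have hgu : UpperSemicontinuous g := upperSemicontinuous_uscHull HL.nonneg hΛS
  have hS0 : 0 < S := hc.trans_le ((ha 0).trans (hS 0 a))
  have hgS : ∀ x, g x ≤ S := fun x =>
    uscHull_le_of_eventually_le HL.nonneg (Eventually.of_forall hΛS)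
  -- The chord argument excludes the anchor point itself, so two different anchors are needed to
  -- reach every `x`. The bound must hold everywhere, since `P` may have atoms.
  have hlim : ∀ x v, g x < v → ∀ᶠ j in atTop, k j x < v := by
    intro x v hv
    by_cases hxa : x = a
    · exact eventually_lt_of_uscHull_liminf_lt H hkS hr hc (fun j => hb _) (hxa ▸ hab) hv
    · exact eventually_lt_of_uscHull_liminf_lt H hkS hr hc (fun j => ha _) hxa hv
  -- Fatou's lemma for the mass, where the hull may be replaced by the liminf almost everywhere.
  have hint : ∫⁻ x, ENNReal.ofReal (g x) ≤ 1 := by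
    calc ∫⁻ x, ENNReal.ofReal (g x) = ∫⁻ x, ENNReal.ofReal (Λ x) := by
          refine lintegral_congr_ae ?_
          filter_upwards [uscHull_ae_eq HL hΛS] with x hx
          rw [hg, hx]
      _ ≤ ∫⁻ x, liminf (fun j => ENNReal.ofReal (k j x)) atTop := by
          refine lintegral_mono fun x => ?_
          refine le_of_forall_lt fun e he => ?_
          have he' := (he.trans_le le_top).ne
          rw [ENNReal.lt_ofReal_iff_toReal_lt he'] at he
          obtain ⟨w, hw1, hw2⟩ := exists_between he
          refine lt_of_lt_of_le ((ENNReal.lt_ofReal_iff_toReal_lt he').2 hw1)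
            (le_liminf_of_le (by isBoundedDefault) ?_)
          filter_upwards [eventually_lt_of_lt_liminf hw2 (hbdd x)] with j hj
          exact ENNReal.ofReal_le_ofReal hj.le
      _ ≤ liminf (fun j => ∫⁻ x, ENNReal.ofReal (k j x)) atTop :=
          lintegral_liminf_le fun j => (hA _).usc.measurable.ennreal_ofReal
      _ ≤ 1 := by
          refine liminf_le_of_le (by isBoundedDefault) fun b hb => ?_
          obtain ⟨j, hj⟩ := hb.exists
          refine hj.trans ?_
          rw [← ofReal_integral_eq_lintegral_ofReal (hA _).int (Eventually.of_forall (H j).nonneg)]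
          exact ENNReal.ofReal_le_one.2 (h1 _)
  have hgi : Integrable g := by
    refine ⟨hgu.measurable.aestronglyMeasurable, ?_⟩
    rw [hasFiniteIntegral_iff_ofReal (Eventually.of_forall G.nonneg)]
    exact hint.trans_lt ENNReal.one_lt_top
  set K := Real.log S with hK
  have hlogS : ∀ {v}, 0 < v → v ≤ S → 0 ≤ K - Real.log v := fun hv hvS =>
    sub_nonneg.2 (Real.log_le_log hv hvS)
  -- Fatou's lemma for `log S - log`, which is nonnegative along the sequence. Finiteness of the
  -- left side yields positivity of `g` almost everywhere for `P` as well as integrability of `log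
  -- g`.
  have hkey : ∫⁻ x, negLog K (g x) ∂P ≤ ENNReal.ofReal (K - L) := by
    calc ∫⁻ x, negLog K (g x) ∂P ≤ ∫⁻ x, liminf (fun j => negLog K (k j x)) atTop ∂P := by
          refine lintegral_mono fun x => le_of_forall_lt fun e he => ?_
          obtain ⟨e', he1, he2⟩ := exists_between he
          obtain ⟨w, hw1, hw2⟩ := exists_lt_negLog he2
          refine he1.trans_le (le_liminf_of_le (by isBoundedDefault) ?_)
          filter_upwards [hlim x w hw1] with j hj
          exact hw2.le.trans (negLog_antitone K hj.le)
      _ ≤ liminf (fun j => ∫⁻ x, negLog K (k j x) ∂P) atTop :=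
          lintegral_liminf_le fun j => (measurable_negLog K).comp (hA _).usc.measurable
      _ = liminf (fun j => ENNReal.ofReal (K - ∫ x, Real.log (k j x) ∂P)) atTop := by
          congr 1
          funext j
          have e1 : ∫⁻ x, negLog K (k j x) ∂P =
              ∫⁻ x, ENNReal.ofReal (K - Real.log (k j x)) ∂P := by
            refine lintegral_congr_ae ?_
            filter_upwards [(hA (σ j)).pos] with x hx
            rw [negLog, if_neg (not_le.2 hx)]
          have e2 : Integrable (fun x => K - Real.log (k j x)) P :=
            (integrable_const K).sub (hA (σ j)).logInt
          rw [e1, ← ofReal_integral_eq_lintegral_ofReal e2,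
            integral_sub (integrable_const K) (hA (σ j)).logInt]
          · simp [hk]
          · filter_upwards [(hA (σ j)).pos] with x hx using hlogS hx (hkS j x)
      _ = ENNReal.ofReal (K - L) := Tendsto.liminf_eq
          ((ENNReal.continuous_ofReal.tendsto _).comp
            (tendsto_const_nhds.sub (hL.comp hσ.tendsto_atTop)))
  have hpos : ∀ᵐ x ∂P, 0 < g x := by
    filter_upwards [ae_lt_top ((measurable_negLog K).comp hgu.measurable)
      (hkey.trans_lt ENNReal.ofReal_lt_top).ne] with x hx
    by_contra hcon
    rw [Function.comp, negLog, if_pos (not_lt.1 hcon)] at hx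
    exact lt_irrefl _ hx
  have e1 : ∫⁻ x, negLog K (g x) ∂P = ∫⁻ x, ENNReal.ofReal (K - Real.log (g x)) ∂P := by
    refine lintegral_congr_ae ?_
    filter_upwards [hpos] with x hx
    rw [negLog, if_neg (not_le.2 hx)]
  have hnn : 0 ≤ᵐ[P] fun x => K - Real.log (g x) := by
    filter_upwards [hpos] with x hx using hlogS hx (hgS x)
  have hi1 : Integrable (fun x => K - Real.log (g x)) P := by
    refine ⟨(measurable_const.sub hgu.measurable.log).aestronglyMeasurable, ?_⟩
    rw [hasFiniteIntegral_iff_ofReal hnn, ← e1]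
    exact hkey.trans_lt ENNReal.ofReal_lt_top
  have hi2 : Integrable (fun x => Real.log (g x)) P := by
    refine ((integrable_const K).sub hi1).congr (Eventually.of_forall fun x => ?_)
    simp
  refine ⟨g, ⟨G, hgu, hpos, hi2, hgi⟩, ?_, ?_⟩
  · rw [← ofReal_integral_eq_lintegral_ofReal hgi (Eventually.of_forall G.nonneg)] at hint
    exact ENNReal.ofReal_le_one.1 hint
  · rw [e1, ← ofReal_integral_eq_lintegral_ofReal hi1 hnn,
      integral_sub (integrable_const K) hi2] at hkey
    have h3 : 0 ≤ K - L := by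
      refine ge_of_tendsto' ((tendsto_const_nhds (x := K)).sub hL) fun j => ?_
      have : ∫ x, Real.log (h j x) ∂P ≤ ∫ _, K ∂P := by
        refine integral_mono_ae (hA j).logInt (integrable_const K) ?_
        filter_upwards [(hA j).pos] with x hx using Real.log_le_log hx (hS j x)
      simpa using this
    have h4 := (ENNReal.ofReal_le_ofReal_iff h3).1 hkey
    simp at h4
    linarith

/-- A maximizing sequence, normalized to mass one, has a common upper bound and a common positive
lower bound at `a` and `b`. It therefore has a limit in the sense of `exists_adm_of_seq`, and
neither term of the criterion loses in the limit. -/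
theorem exists_isProj {P : Measure ℝ} [IsProbabilityMeasure P] {a b δ : ℝ} (H : Spread P a b δ)
    (hP : Integrable (fun x : ℝ => x) P) : ∃ h, IsProj P h := by
  -- Normalization does not lower the criterion, by `log t ≤ t - 1` at the mass `t`.
  have hnorm : ∀ g, Adm P g → ∃ k, Adm P k ∧ ∫ x, k x = 1 ∧ crit P g ≤ crit P k := by
    intro g hg
    have h0 := hg.integral_pos H
    obtain ⟨h1, h2⟩ := hg.const_mul (inv_pos.2 h0)
    refine ⟨_, h1, ?_, ?_⟩
    · rw [integral_const_mul, inv_mul_cancel₀ h0.ne']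
    · rw [h2, Real.log_inv, inv_mul_cancel₀ h0.ne', crit]
      linarith [Real.log_le_sub_one_of_pos h0]
  set V := crit P '' {g | Adm P g} with hV
  have hVne : V.Nonempty := ⟨_, _, (crit_exp_neg_abs hP).1, rfl⟩
  have hVb : BddAbove V := by
    refine ⟨max 1 (max 0 (4 * Real.exp 2 / ((b - a) * δ))), ?_⟩
    rintro _ ⟨g, hg, rfl⟩
    obtain ⟨k, hk, hk1, hle⟩ := hnorm g hg
    refine hle.trans ?_
    by_cases hneg : 0 ≤ ∫ x, Real.log (k x) ∂P
    · have h1 := hk.le_exp H hk1.le (C := 0) (by simpa using hneg)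
      have h2 := integral_log_le (A := ∅) hk.logInt hk.pos MeasurableSet.empty (r := 0) (δ := 0)
        le_rfl (by simp) h1 (by simp)
      rw [crit, hk1]; linarith
    · rw [crit, hk1]
      linarith [le_max_left 1 (max 0 (4 * Real.exp 2 / ((b - a) * δ)))]
  set L := sSup V with hLdef
  have hseq : ∀ j : ℕ, ∃ k, Adm P k ∧ ∫ x, k x = 1 ∧ L - 1 / ((j : ℝ) + 1) < crit P k := by
    intro j
    obtain ⟨_, ⟨g, hg, rfl⟩, hlt⟩ := exists_lt_of_lt_csSup hVne
      (show L - 1 / ((j : ℝ) + 1) < L by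
        have : 0 < 1 / ((j : ℝ) + 1) := by positivity
        linarith)
    obtain ⟨k, hk, hk1, hle⟩ := hnorm g hg
    exact ⟨k, hk, hk1, hlt.trans_le hle⟩
  choose h hA h1 hcr using hseq
  have hlog : ∀ j, ∫ x, Real.log (h j x) ∂P = crit P (h j) + 1 := fun j => by
    rw [crit, h1]; ring
  have hj1 : ∀ j : ℕ, 1 / ((j : ℝ) + 1) ≤ 1 := fun j => by
    rw [div_le_one (by positivity)]; linarith [Nat.cast_nonneg (α := ℝ) j]
  obtain ⟨A, B, c, hA0, hB0, hc0, hE⟩ := exists_uniform_envelope (δ := δ) H.lt (abs_nonneg L)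
  have hE' := fun j => hE P (h j) inferInstance H (hA j) (h1 j).le (by
    rw [hlog]; linarith [neg_abs_le L, hcr j, hj1 j])
  have hS : ∀ j x, h j x ≤ A := fun j x => ((hE' j).1 x).trans
    (mul_le_of_le_one_right hA0.le (Real.exp_le_one_iff.2 (by
      have := mul_nonneg hB0.le (abs_nonneg x); linarith)))
  have hlim : Tendsto (fun j => ∫ x, Real.log (h j x) ∂P) atTop (𝓝 (L + 1)) := by
    simp only [hlog]
    refine Tendsto.add_const 1 ?_
    refine tendsto_of_tendsto_of_tendsto_of_le_of_le (g := fun j : ℕ => L - 1 / ((j : ℝ) + 1))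
      (h := fun _ => L) ?_ tendsto_const_nhds (fun j => (hcr j).le)
      fun j => le_csSup hVb ⟨_, hA j, rfl⟩
    simpa using tendsto_const_nhds.sub (tendsto_one_div_add_atTop_nhds_zero_nat (𝕜 := ℝ))
  obtain ⟨g, hg, hg1, hgL⟩ := exists_adm_of_seq hA (fun j => (h1 j).le) hS H.lt.ne hc0
    (fun j => (hE' j).2 a ⟨le_rfl, H.lt.le⟩) (fun j => (hE' j).2 b ⟨H.lt.le, le_rfl⟩) hlim
  refine ⟨g, hg, fun k hk => ?_⟩
  have h2 : L ≤ crit P g := by rw [crit]; linarith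
  exact le_trans (le_csSup hVb ⟨k, hk, rfl⟩) h2

/-! ### Convergence of log-concave functions -/

section convergence

variable {ι : Type*} {l : Filter ι} {k : ι → ℝ → ℝ} {q : ℝ → ℝ}

/-- Log-concave functions that come close to `q` somewhere in each interval converge to `q`
continuously at interior points of the domain. -/
theorem LogConc.tendsto_interior (hk : ∀ᶠ i in l, LogConc (k i)) (hq : LogConc q)
    (hD : ∀ u v, u < v → Icc u v ⊆ interior {x | 0 < q x} → ∀ ε > 0, ∀ᶠ i in l,
      ∃ z ∈ Ioo u v, |k i z - q z| < ε) {x : ℝ} (hx : x ∈ interior {x | 0 < q x}) :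
    Tendsto (fun p : ι × ℝ => k p.1 p.2) (l ×ˢ 𝓝 x) (𝓝 (q x)) := by
  have hc : 0 < q x := interior_subset (s := {x | 0 < q x}) hx
  have hcont := hq.continuousAt hx
  have hint : ∀ᶠ y in 𝓝 x, y ∈ interior {x | 0 < q x} := isOpen_interior.mem_nhds hx
  have fin : ∀ (η : ℝ) (T : Set ℝ), 0 < η →
      (∀ᶠ i in l, ∀ y, |y - x| < η → k i y ∈ T) →
      ∀ᶠ p : ι × ℝ in l ×ˢ 𝓝 x, k p.1 p.2 ∈ T := by
    intro η T hη h
    filter_upwards [h.prod_mk (Metric.ball_mem_nhds x hη)] with p hp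
    exact hp.1 p.2 hp.2
  refine tendsto_order.2 ⟨fun w hw => ?_, fun w hw => ?_⟩
  · obtain ⟨w', hw1, hw2⟩ := exists_between hw
    obtain ⟨η, hη, hball⟩ := Metric.eventually_nhds_iff.1
      (hint.and (hcont.eventually_const_lt hw2))
    have hb : ∀ y, |y - x| < η → y ∈ interior {x | 0 < q x} ∧ w' < q y := fun y hy =>
      hball (by rwa [Real.dist_eq])
    -- For the lower bound, `y` is enclosed by two points at which `k i` is close to `q`, and
    -- unimodality applies.
    refine fin (η / 4) (Ioi w) (by positivity) ?_
    filter_upwards [hk,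
      hD (x - η / 2) (x - η / 4) (by linarith)
        (fun y hy => (hb y (abs_lt.2 ⟨by linarith [hy.1], by linarith [hy.2]⟩)).1) (w' - w)
        (by linarith),
      hD (x + η / 4) (x + η / 2) (by linarith)
        (fun y hy => (hb y (abs_lt.2 ⟨by linarith [hy.1], by linarith [hy.2]⟩)).1) (w' - w)
        (by linarith)] with i hi h1 h2 y hy
    obtain ⟨z1, hz1, hz1'⟩ := h1
    obtain ⟨z2, hz2, hz2'⟩ := h2
    rw [abs_lt] at hy hz1' hz2'
    have e1 := (hb z1 (abs_lt.2 ⟨by linarith [hz1.1], by linarith [hz1.2]⟩)).2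
    have e2 := (hb z2 (abs_lt.2 ⟨by linarith [hz2.1], by linarith [hz2.2]⟩)).2
    exact (lt_min (by linarith) (by linarith)).trans_le
      (hi.min_le (u := z1) (x := z2) (by linarith [hz1.2]) (by linarith [hz2.1]))
  · have hexp : ∀ t : ℝ, Tendsto (fun κ : ℝ => q x * Real.exp (t * κ)) (𝓝[>] 0)
        (𝓝 (q x * Real.exp (t * 0))) := fun t =>
      (Continuous.tendsto (by fun_prop) 0).mono_left nhdsWithin_le_nhds
    -- For the upper bound the chord through two points `u < v` on the left is extended to `y`.
    -- Errors `2κ` in the two logarithms are magnified by at most `((y - u) + (y - v)) / (v - u) ≤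
    -- 3`, whence the exponent `6κ`.
    have h6 := hexp 6
    rw [mul_zero, Real.exp_zero, mul_one] at h6
    obtain ⟨κ, hκ, hκ0⟩ := ((h6.eventually_lt_const hw).and self_mem_nhdsWithin).exists
    have hκ0 : 0 < κ := hκ0
    have lt1 : q x * Real.exp (-κ) < q x :=
      mul_lt_of_lt_one_right hc (Real.exp_lt_one_iff.2 (by linarith))
    have lt2 : q x < q x * Real.exp κ := lt_mul_of_one_lt_right hc (Real.one_lt_exp_iff.2 hκ0)
    have lt3 : q x * Real.exp (-(2 * κ)) < q x * Real.exp (-κ) := by gcongr; linarith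
    have lt4 : q x * Real.exp κ < q x * Real.exp (2 * κ) := by gcongr; linarith
    obtain ⟨η', hη', hball⟩ := Metric.eventually_nhds_iff.1
      (hint.and ((hcont.eventually_const_lt lt1).and (hcont.eventually_lt_const lt2)))
    obtain ⟨η, hη, rfl⟩ : ∃ η, 0 < η ∧ η' = 10 * η := ⟨η' / 10, by positivity, by ring⟩
    have hb : ∀ y, |y - x| < 10 * η → y ∈ interior {x | 0 < q x} ∧ q x * Real.exp (-κ) < q y ∧
        q y < q x * Real.exp κ := fun y hy => hball (by rwa [Real.dist_eq])
    set ε := min (q x * Real.exp (-κ) - q x * Real.exp (-(2 * κ)))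
      (q x * Real.exp (2 * κ) - q x * Real.exp κ) with hε
    have hε0 : 0 < ε := lt_min (by linarith) (by linarith)
    have hε1 : ε ≤ q x * Real.exp (-κ) - q x * Real.exp (-(2 * κ)) := min_le_left _ _
    have hε2 : ε ≤ q x * Real.exp (2 * κ) - q x * Real.exp κ := min_le_right _ _
    refine fin η (Iio w) hη ?_
    filter_upwards [hk,
      hD (x - 9 * η) (x - 8 * η) (by linarith)
        (fun y hy => (hb y (abs_lt.2 ⟨by linarith [hy.1], by linarith [hy.2]⟩)).1) ε hε0,
      hD (x - 2 * η) (x - η) (by linarith)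
        (fun y hy => (hb y (abs_lt.2 ⟨by linarith [hy.1], by linarith [hy.2]⟩)).1) ε hε0]
      with i hi h1 h2 y hy
    obtain ⟨u, hu, hu'⟩ := h1
    obtain ⟨v, hv, hv'⟩ := h2
    rw [abs_lt] at hy hu' hv'
    have e1 := (hb u (abs_lt.2 ⟨by linarith [hu.1], by linarith [hu.2]⟩)).2.1
    have e2 := (hb v (abs_lt.2 ⟨by linarith [hv.1], by linarith [hv.2]⟩)).2.2
    have f1 : q x * Real.exp (-(2 * κ)) < k i u := by linarith
    have f2 : k i v < q x * Real.exp (2 * κ) := by linarith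
    refine lt_of_le_of_lt ?_ hκ
    rcases (hi.nonneg y).eq_or_lt with e | hy0
    · rw [← e]; positivity
    have hu0 : 0 < k i u := lt_trans (by positivity) f1
    have huv : u ≤ v := by linarith [hu.2, hv.1]
    have hvy : v ≤ y := by linarith [hv.2]
    have hv0 := hi.pos_of_mem hu0 hy0 huv hvy
    have h3 := hi.log_three hu0 hy0 huv hvy
    have g1 := Real.log_lt_log (by positivity) f1
    have g2 := Real.log_lt_log hv0 f2
    rw [Real.log_mul hc.ne' (Real.exp_pos _).ne', Real.log_exp] at g1 g2
    rw [← Real.log_le_log_iff hy0 (by positivity), Real.log_mul hc.ne' (Real.exp_pos _).ne',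
      Real.log_exp]
    have hvu : 0 < v - u := by linarith [hu.2, hv.1]
    refine le_of_mul_le_mul_left (a := v - u) ?_ hvu
    have m1 := mul_le_mul_of_nonneg_left g1.le (by linarith : 0 ≤ y - v)
    have m2 := mul_le_mul_of_nonneg_left g2.le (by linarith : 0 ≤ y - u)
    have m3 : (y - u) + (y - v) ≤ 3 * (v - u) := by linarith [hu.1, hu.2, hv.1, hv.2, hy.2]
    have m4 := mul_le_mul_of_nonneg_right m3 (by linarith : 0 ≤ 2 * κ)
    nlinarith

/-- Convergence to `0` outside the closure of the domain of the limit. -/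
theorem LogConc.tendsto_exterior (hk : ∀ᶠ i in l, LogConc (k i)) (hq : LogConc q)
    (hD : ∀ u v, u < v → ∀ ε > 0, ∀ᶠ i in l, ∃ z ∈ Ioo u v, |k i z - q z| < ε)
    {a b : ℝ} (hab : a < b) (ha : 0 < q a) (hb : 0 < q b) {x : ℝ}
    (hx : x ∉ closure {x | 0 < q x}) :
    Tendsto (fun p : ι × ℝ => k p.1 p.2) (l ×ˢ 𝓝 x) (𝓝 0) := by
  obtain ⟨η, hη, hball⟩ := Metric.eventually_nhds_iff.1 (isClosed_closure.isOpen_compl.mem_nhds hx)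
  have hz : ∀ y, |y - x| < η → q y = 0 := fun y hy => by
    have h1 : y ∉ closure {x | 0 < q x} := hball (by rwa [Real.dist_eq])
    exact le_antisymm (not_lt.1 fun h2 => h1 (subset_closure h2)) (hq.nonneg y)
  set c := min (q a) (q b) with hc
  have hc0 : 0 < c := lt_min ha hb
  have hmid : ∀ z ∈ Ioo a b, c ≤ q z := fun z hz => hq.min_le hz.1.le hz.2.le
  -- The zero set of `q` around `x` cannot meet `[a, b]`, so it lies strictly on one side.
  have hout : b < x - η / 2 ∨ x + η / 2 < a := by
    by_contra hcon
    push Not at hcon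
    have key : ∀ t, a ≤ t → t ≤ b → |t - x| < η → False := fun t h1 h2 h3 => by
      have := hz t h3
      have h4 := hq.pos_of_mem ha hb h1 h2
      linarith
    rcases le_total b (x + η / 2) with h1 | h1
    · exact key b hab.le le_rfl (abs_lt.2 ⟨by linarith [hcon.1], by linarith⟩)
    · rcases le_total a x with h2 | h2
      · exact key (x + η / 2) (by linarith) h1 (abs_lt.2 ⟨by linarith, by linarith⟩)
      · exact key a le_rfl hab.le (abs_lt.2 ⟨by linarith, by linarith [hcon.2]⟩)
  rw [Metric.tendsto_nhds]
  intro ε hε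
  set e := min ε (c / 2) with he
  have he0 : 0 < e := lt_min hε (by positivity)
  -- `k i` exceeds `c / 2` at some point of `(a, b)` and is below `min ε (c / 2)` at a point `w`
  -- between there and `x`; by unimodality it does not increase from `w` outwards.
  have key : ∀ᶠ i in l, ∀ y, |y - x| < η / 4 → k i y < ε := by
    rcases hout with ho | ho
    · filter_upwards [hk, hD a b hab (c / 2) (by positivity),
        hD (x - η / 2) (x - η / 4) (by linarith) e he0] with i hi h1 h2 y hy
      obtain ⟨z, hz1, hz2⟩ := h1
      obtain ⟨w, hw1, hw2⟩ := h2
      rw [abs_lt] at hz2 hw2 hy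
      rw [hz w (abs_lt.2 ⟨by linarith [hw1.1], by linarith [hw1.2]⟩)] at hw2
      have h3 : k i w < k i z := by
        have := hmid z hz1
        linarith [min_le_right ε (c / 2)]
      have := hi.le_of_lt_left (by linarith [hz1.2, hw1.1]) (by linarith [hw1.2] : w ≤ y) h3
      linarith [min_le_left ε (c / 2)]
    · filter_upwards [hk, hD a b hab (c / 2) (by positivity),
        hD (x + η / 4) (x + η / 2) (by linarith) e he0] with i hi h1 h2 y hy
      obtain ⟨z, hz1, hz2⟩ := h1
      obtain ⟨w, hw1, hw2⟩ := h2
      rw [abs_lt] at hz2 hw2 hy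
      rw [hz w (abs_lt.2 ⟨by linarith [hw1.1], by linarith [hw1.2]⟩)] at hw2
      have h3 : k i w < k i z := by
        have := hmid z hz1
        linarith [min_le_right ε (c / 2)]
      have := hi.le_of_lt_right (by linarith [hz1.1, hw1.2]) (by linarith [hw1.1] : y ≤ w) h3
      linarith [min_le_left ε (c / 2)]
  filter_upwards [(hk.and key).prod_mk (Metric.ball_mem_nhds x (by positivity : 0 < η / 4))] with p hp
  rw [Real.dist_eq, sub_zero, abs_of_nonneg (hp.1.1.nonneg _)]
  exact hp.1.2 p.2 hp.2

end convergence

/-! ### Convergence of the maximizers -/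

/-- Convergence in Kantorovich distance. -/
def W1Tendsto {ι : Type*} (P : ι → Measure ℝ) (l : Filter ι) (P₀ : Measure ℝ) : Prop :=
  ∀ ε > 0, ∀ᶠ i in l, W1Le (P i) P₀ ε

/-- A ramp that falls from `t` to `0`, used as a Lipschitz substitute for the indicator of a
half-line. -/
theorem lipschitzWith_clamp (a t : ℝ) :
    LipschitzWith 1 fun x : ℝ => min (max (a - x) 0) t := by
  refine LipschitzWith.min_const (LipschitzWith.max_const ?_ 0) t
  refine LipschitzWith.of_dist_le_mul fun x y => ?_
  rw [Real.dist_eq, Real.dist_eq, NNReal.coe_one, one_mul, sub_sub_sub_cancel_left, abs_sub_comm]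

theorem mul_le_mul_add_of_W1Le {P P₀ : Measure ℝ} [IsProbabilityMeasure P]
    [IsProbabilityMeasure P₀] {a t W : ℝ} (ht : 0 < t) (hW : W1Le P P₀ W) :
    t * P₀.real (Iic a) ≤ t * P.real (Iic (a + t)) + W := by
  have hu := lipschitzWith_clamp (a + t) t
  have h1 := hW _ hu
  set u := fun x : ℝ => min (max (a + t - x) 0) t with hu'
  have hb : ∀ x, ‖u x‖ ≤ t := fun x => by
    rw [Real.norm_of_nonneg (le_min (le_max_right _ _) ht.le)]; exact min_le_right _ _
  have hi : ∀ (R : Measure ℝ) [IsProbabilityMeasure R], Integrable u R := fun R _ =>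
    (integrable_const t).mono' hu.continuous.aestronglyMeasurable (Eventually.of_forall hb)
  have h2 : ∫ x, u x ∂P ≤ t * P.real (Iic (a + t)) := by
    calc ∫ x, u x ∂P ≤ ∫ x, (Iic (a + t)).indicator (fun _ => t) x ∂P := by
          refine integral_mono (hi P) ((integrable_const t).indicator measurableSet_Iic) fun x => ?_
          by_cases hx : x ∈ Iic (a + t)
          · rw [indicator_of_mem hx]; exact min_le_right _ _
          · rw [indicator_of_notMem hx]
            have : a + t < x := not_le.1 hx
            exact (min_le_left _ _).trans (max_le (by linarith) le_rfl)
      _ = _ := by rw [integral_indicator_const _ measurableSet_Iic, smul_eq_mul, mul_comm]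
  have h3 : t * P₀.real (Iic a) ≤ ∫ x, u x ∂P₀ := by
    calc t * P₀.real (Iic a) = ∫ x, (Iic a).indicator (fun _ => t) x ∂P₀ := by
          rw [integral_indicator_const _ measurableSet_Iic, smul_eq_mul, mul_comm]
      _ ≤ ∫ x, u x ∂P₀ := by
          refine integral_mono ((integrable_const t).indicator measurableSet_Iic) (hi P₀) fun x => ?_
          by_cases hx : x ∈ Iic a
          · rw [indicator_of_mem hx]
            have : x ≤ a := hx
            exact le_min (le_max_of_le_left (by linarith)) le_rfl
          · rw [indicator_of_notMem hx]
            exact le_min (le_max_right _ _) ht.le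
  linarith [(abs_le.1 h1).1]

theorem W1Le.map_neg {P P₀ : Measure ℝ} {W : ℝ} (hW : W1Le P P₀ W) :
    W1Le (P.map fun x => -x) (P₀.map fun x => -x) W := fun u hu => by
  have e : ∀ M : Measure ℝ, (∫ x, u x ∂(M.map fun x => -x)) = (∫ x, u (-x) ∂M) := fun M =>
    integral_map (measurable_id.neg.aemeasurable) hu.continuous.aestronglyMeasurable
  rw [e, e]
  have : LipschitzWith 1 fun x : ℝ => -x :=
    LipschitzWith.of_dist_le_mul fun x y => by simp [dist_neg_neg]
  have h3 := hu.comp this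
  rw [mul_one] at h3
  exact hW _ h3

/-- Masses of half-lines are compared after moving the endpoint by `t`, at a price `W / t` which is
kept below half of `δ`. The right side is the left side of the reflected measures. -/
theorem Spread.of_W1Le {P P₀ : Measure ℝ} [IsProbabilityMeasure P] [IsProbabilityMeasure P₀]
    {a b δ t W : ℝ} (H : Spread P₀ a b δ) (ht : 0 < t) (htab : a + t < b - t)
    (hWt : W ≤ t * δ / 2) (hW : W1Le P P₀ W) : Spread P (a + t) (b - t) (δ / 2) := by
  have hδ := H.pos
  refine ⟨htab, by positivity, ?_, ?_⟩
  · have h1 := mul_le_mul_add_of_W1Le (a := a) ht hW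
    have h2 := mul_le_mul_of_nonneg_left H.left ht.le
    refine le_of_mul_le_mul_left (a := t) ?_ ht
    linarith
  · have hmp : ∀ (R : Measure ℝ) [IsProbabilityMeasure R],
        IsProbabilityMeasure (R.map fun x => -x) := fun R _ =>
      Measure.isProbabilityMeasure_map (by fun_prop)
    have := hmp P
    have := hmp P₀
    have h1 := mul_le_mul_add_of_W1Le (a := -b) ht hW.map_neg
    have e : ∀ (R : Measure ℝ) (c : ℝ), (R.map fun x => -x).real (Iic c) = R.real (Ici (-c)) := by
      intro R c
      rw [map_measureReal_apply (by fun_prop) measurableSet_Iic]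
      congr 1
      ext x; simp
    rw [e, e, neg_neg, neg_add, neg_neg, ← sub_eq_add_neg] at h1
    have h2 := mul_le_mul_of_nonneg_left H.right ht.le
    refine le_of_mul_le_mul_left (a := t) ?_ ht
    linarith

section projections

variable {ι : Type*} {l : Filter ι} {P : ι → Measure ℝ} {P₀ : Measure ℝ}
  {f : ι → ℝ → ℝ} {f₀ : ℝ → ℝ} {a b δ : ℝ}

theorem exists_envelope_of_W1Tendsto [IsProbabilityMeasure P₀] (H : Spread P₀ a b δ)
    (hP₀ : Integrable (fun x : ℝ => x) P₀)
    (hP : ∀ᶠ i in l, IsProbabilityMeasure (P i) ∧ Integrable (fun x : ℝ => x) (P i))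
    (hW : W1Tendsto P l P₀) (hf₀ : IsProj P₀ f₀) (hf : ∀ᶠ i in l, IsProj (P i) (f i)) :
    ∃ A B : ℝ, 0 < A ∧ 0 < B ∧ (∀ x, f₀ x ≤ A * Real.exp (-(B * |x|))) ∧
      ∀ᶠ i in l, (∀ x, f i x ≤ A * Real.exp (-(B * |x|))) ∧ ∫ x, f i x = 1 := by
  obtain ⟨t, ht, htab⟩ : ∃ t, 0 < t ∧ a + t < b - t :=
    ⟨(b - a) / 3, by linarith [H.lt], by linarith [H.lt]⟩
  have hδ := H.pos
  have hD0 : 0 ≤ ∫ x, |x| ∂P₀ := integral_nonneg fun x => abs_nonneg x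
  -- One unit is the constant in `IsProj.le_integral_log`; the other absorbs the change in the first
  -- absolute moment, since `|x|` is 1-Lipschitz.
  obtain ⟨A, B, c, hA, hB, hc, hE⟩ := exists_uniform_envelope (a := a + t) (b := b - t)
    (δ := δ / 2) (D := (∫ x, |x| ∂P₀) + 1 + 1) htab (by linarith)
  refine ⟨A, B, hA, hB, ?_, ?_⟩
  -- `P₀` at distance zero from itself: the limit thus satisfies the same weakened spread condition
  -- and shares the envelope.
  · have hs := H.of_W1Le ht htab (P := P₀) (W := 0) (by positivity) fun u _ => by simp
    refine (hE P₀ f₀ inferInstance hs hf₀.adm (hf₀.integral_eq_one H).le ?_).1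
    linarith [hf₀.le_integral_log H hP₀]
  · filter_upwards [hP, hf, hW (t * δ / 2) (by positivity), hW 1 one_pos] with i hPi hfi h1 h2
    have := hPi.1
    have hs := H.of_W1Le ht htab le_rfl h1
    refine ⟨(hE (P i) (f i) hPi.1 hs hfi.adm (hfi.integral_eq_one hs).le ?_).1,
      hfi.integral_eq_one hs⟩
    have h3 := hfi.le_integral_log hs hPi.2
    have h4 := h2 (fun x => |x|) (lipschitzWith_one_norm (E := ℝ))
    linarith [(abs_le.1 h4).2]

theorem eventually_hellinger_lt [IsProbabilityMeasure P₀] (H : Spread P₀ a b δ)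
    (hP₀ : Integrable (fun x : ℝ => x) P₀)
    (hP : ∀ᶠ i in l, IsProbabilityMeasure (P i) ∧ Integrable (fun x : ℝ => x) (P i))
    (hW : W1Tendsto P l P₀) (hf₀ : IsProj P₀ f₀) (hf : ∀ᶠ i in l, IsProj (P i) (f i))
    {ε : ℝ} (hε : 0 < ε) : ∀ᶠ i in l, Integrable (fun x => (√(f i x) - √(f₀ x)) ^ 2) ∧
      ∫ x, (√(f i x) - √(f₀ x)) ^ 2 < ε := by
  obtain ⟨A, B, hA, hB, h0, hE⟩ := exists_envelope_of_W1Tendsto H hP₀ hP hW hf₀ hf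
  have hle : ∀ x, A * Real.exp (-(B * |x|)) ≤ A := fun x =>
    mul_le_of_le_one_right hA.le (Real.exp_le_one_iff.2 (by
      have := mul_nonneg hB.le (abs_nonneg x); linarith))
  -- First `m` makes the term `12 A / m` equal to `ε / 4`, then the distance is taken so small that
  -- `4 m W` is `ε / 4` too.
  set m := 48 * A / ε with hm
  have hm0 : 0 < m := by positivity
  filter_upwards [hP, hf, hE, hW (ε / (16 * m)) (by positivity)] with i hPi hfi hEi hWi
  have := hPi.1
  obtain ⟨h1, h2⟩ := hf₀.hellinger_le_of_W1Le hP₀ hPi.2 hWi.symm hfi (fun x => (h0 x).trans (hle x))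
    (fun x => (hEi.1 x).trans (hle x)) hm0
  refine ⟨h1, h2.trans_lt ?_⟩
  have e1 : 4 * m * (ε / (16 * m)) = ε / 4 := by field_simp; norm_num
  have e2 : 12 * A / m = ε / 4 := by rw [hm]; field_simp; norm_num
  rw [e1, e2]; linarith

theorem eventually_exists_close [IsProbabilityMeasure P₀] (H : Spread P₀ a b δ)
    (hP₀ : Integrable (fun x : ℝ => x) P₀)
    (hP : ∀ᶠ i in l, IsProbabilityMeasure (P i) ∧ Integrable (fun x : ℝ => x) (P i))
    (hW : W1Tendsto P l P₀) (hf₀ : IsProj P₀ f₀) (hf : ∀ᶠ i in l, IsProj (P i) (f i))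
    {u v : ℝ} (huv : u < v) {ε : ℝ} (hε : 0 < ε) :
    ∀ᶠ i in l, ∃ z ∈ Ioo u v, |√(f i z) - √(f₀ z)| < ε := by
  have huv' : 0 < v - u := sub_pos.2 huv
  filter_upwards [eventually_hellinger_lt H hP₀ hP hW hf₀ hf
    (by positivity : 0 < ε ^ 2 * (v - u))] with i hi
  by_contra hcon
  push Not at hcon
  have h1 : ε ^ 2 * (v - u) ≤ ∫ x, (√(f i x) - √(f₀ x)) ^ 2 := by
    calc ε ^ 2 * (v - u) = ∫ _ in Ioo u v, ε ^ 2 := by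
          simp [Real.volume_real_Ioo_of_le huv.le, mul_comm]
      _ ≤ ∫ x in Ioo u v, (√(f i x) - √(f₀ x)) ^ 2 := by
          refine setIntegral_mono_on (integrableOn_const (by simp)) hi.1.integrableOn
            measurableSet_Ioo fun z hz => ?_
          rw [← sq_abs (√(f i z) - √(f₀ z))]
          gcongr
          exact hcon z hz
      _ ≤ _ := setIntegral_le_integral hi.1 (Eventually.of_forall fun x => sq_nonneg _)
  linarith [hi.2]

/-- Maximizers converge continuously off the boundary of the domain of the limit. -/
theorem IsProj.tendsto [IsProbabilityMeasure P₀] (H : Spread P₀ a b δ)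
    (hP₀ : Integrable (fun x : ℝ => x) P₀)
    (hP : ∀ᶠ i in l, IsProbabilityMeasure (P i) ∧ Integrable (fun x : ℝ => x) (P i))
    (hW : W1Tendsto P l P₀) (hf₀ : IsProj P₀ f₀) (hf : ∀ᶠ i in l, IsProj (P i) (f i))
    {x : ℝ} (hx : x ∉ frontier {x | 0 < f₀ x}) :
    Tendsto (fun p : ι × ℝ => f p.1 p.2) (l ×ˢ 𝓝 x) (𝓝 (f₀ x)) := by
  have hD := fun u v (huv : u < v) ε (hε : ε > 0) =>
    eventually_exists_close H hP₀ hP hW hf₀ hf huv hε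
  -- Hellinger distance controls square roots. These are log-concave with the same sets of
  -- positivity, so the shape arguments are applied to them and the result is squared.
  have hk : ∀ᶠ i in l, LogConc fun x => √(f i x) := hf.mono fun i hi => hi.adm.logConc.sqrt
  have hq := hf₀.adm.logConc.sqrt
  have hs : {x | 0 < √(f₀ x)} = {x | 0 < f₀ x} := by ext x; simp
  have main : Tendsto (fun p : ι × ℝ => √(f p.1 p.2)) (l ×ˢ 𝓝 x) (𝓝 √(f₀ x)) := by
    by_cases hi : x ∈ interior {x | 0 < f₀ x}
    · exact LogConc.tendsto_interior hk hq (fun u v huv _ => hD u v huv) (by rwa [hs])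
    · have hc : x ∉ closure {x | 0 < f₀ x} := fun hc => hx ⟨hc, hi⟩
      have h0 : f₀ x = 0 := le_antisymm (not_lt.1 fun h2 => hc (subset_closure h2))
        (hf₀.adm.logConc.nonneg x)
      obtain ⟨⟨p, hp, hp0⟩, r, hr, hr0⟩ := H.exists_pos hf₀.adm.pos
      rw [h0, Real.sqrt_zero]
      exact LogConc.tendsto_exterior hk hq hD (hp.trans_lt (H.lt.trans_le hr))
        (Real.sqrt_pos.2 hp0) (Real.sqrt_pos.2 hr0) (by rwa [hs])
  have h2 := main.pow 2
  rw [Real.sq_sqrt (hf₀.adm.logConc.nonneg x)] at h2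
  refine h2.congr' ?_
  filter_upwards [hf.prod_inl (𝓝 x)] with p hp
  exact Real.sq_sqrt (hp.adm.logConc.nonneg _)

end projections

/-! ### From pointwise convergence to the three kinds of consistency -/

theorem logDensity_toReal {f : ℝ → ℝ} {x : ℝ} (hx : 0 ≤ f x) :
    (logDensity f x).toReal = Real.log (f x) := by
  unfold logDensity
  rcases hx.eq_or_lt with h | h
  · simp [← h]
  · rw [ENNReal.log_ofReal_of_pos h, EReal.toReal_coe]

theorem logDensity_of_pos {f : ℝ → ℝ} {x : ℝ} (hx : 0 < f x) :
    logDensity f x = (Real.log (f x) : ℝ) := ENNReal.log_ofReal_of_pos hx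

theorem logDensity_ne_top (f : ℝ → ℝ) (x : ℝ) : logDensity f x ≠ ⊤ := fun h =>
  ENNReal.ofReal_ne_top (ENNReal.log_eq_top_iff.1 h)

theorem logDensity_eq_bot {f : ℝ → ℝ} {x : ℝ} : logDensity f x = ⊥ ↔ f x ≤ 0 := by
  unfold logDensity; simp

theorem dom_logDensity (f : ℝ → ℝ) : dom (logDensity f) = {x | 0 < f x} := by
  ext x
  exact (not_congr logDensity_eq_bot).trans not_le

/-- Uniform distance of `h (· + y)` and `q` on `K`. -/
noncomputable def supDev (h : ℝ → ℝ) (y : ℝ) (q : ℝ → ℝ) (K : Set ℝ) : ℝ≥0∞ :=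
  ⨆ x ∈ K, ENNReal.ofReal |h (x + y) - q x|

/-- Uniform distance of `log h (· + y)` and `log q` on `K`. -/
noncomputable def supLogDev (h : ℝ → ℝ) (y : ℝ) (q : ℝ → ℝ) (K : Set ℝ) : ℝ≥0∞ :=
  ⨆ x ∈ K, (logDensity h (x + y) - logDensity q x).abs

/-- Distance of the right derivatives of `log h` at `x + y` and of `log q` at `x`. -/
noncomputable def derivDev (h : ℝ → ℝ) (y : ℝ) (q : ℝ → ℝ) (x : ℝ) : ℝ≥0∞ :=
  ⨅ (d : ℝ) (_ : HasRightDeriv (logDensity h) d (x + y)),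
    ENNReal.ofReal |d - rightDeriv (logDensity q) x|

/-- The three kinds of convergence of `h i (· + y i)` to `q`, for `i` along `l`. -/
structure LocallyConsistent {ι : Type*} (l : Filter ι) (h : ι → ℝ → ℝ) (y : ι → ℝ) (q : ℝ → ℝ) :
    Prop where
  density : ∀ K, IsCompact K → K ⊆ interior {x | 0 < q x} →
    Tendsto (fun i => supDev (h i) (y i) q K) l (𝓝 0)
  log : ∀ K, IsCompact K → K ⊆ interior {x | 0 < q x} →
    Tendsto (fun i => supLogDev (h i) (y i) q K) l (𝓝 0)
  score : ∀ x ∈ interior {x | 0 < q x}, ContinuousAt (rightDeriv (logDensity q)) x →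
    Tendsto (fun i => derivDev (h i) (y i) q x) l (𝓝 0)

theorem tendsto_zero_of_forall_real {ι : Type*} {l : Filter ι} {D : ι → ℝ≥0∞}
    (H : ∀ ε : ℝ, 0 < ε → ∀ᶠ i in l, D i ≤ ENNReal.ofReal ε) : Tendsto D l (𝓝 0) := by
  rw [ENNReal.tendsto_nhds_zero]
  intro ε hε
  by_cases htop : ε = ⊤
  · simp [htop]
  · have := H ε.toReal (ENNReal.toReal_pos hε.ne' htop)
    rwa [ENNReal.ofReal_toReal htop] at this

/-- The tube lemma for filters: a property that holds eventually near each point of a compact set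
holds eventually on all of it. Continuous convergence thereby becomes uniform convergence. -/
theorem eventually_forall_of_isCompact {ι : Type*} {l : Filter ι} {K : Set ℝ} (hK : IsCompact K)
    {p : ι → ℝ → Prop} (H : ∀ x ∈ K, ∀ᶠ z : ι × ℝ in l ×ˢ 𝓝 x, p z.1 z.2) :
    ∀ᶠ i in l, ∀ x ∈ K, p i x := by
  have h1 : {z : ι × ℝ | p z.1 z.2} ∈ l ×ˢ 𝓝ˢ K := hK.mem_prod_nhdsSet_of_forall H
  have h2 : ∀ᶠ z : ι × ℝ in l ×ˢ 𝓟 K, p z.1 z.2 :=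
    Filter.prod_mono le_rfl principal_le_nhdsSet h1
  rwa [eventually_prod_principal_iff] at h2

theorem LogConc.hasDerivWithinAt_rightDeriv {q : ℝ → ℝ} (hq : LogConc q) {x : ℝ}
    (hx : x ∈ interior {x | 0 < q x}) :
    HasDerivWithinAt (fun z => Real.log (q z)) (rightDeriv (logDensity q) x) (Ioi x) x := by
  have e : (fun z => (logDensity q z).toReal) = fun z => Real.log (q z) :=
    funext fun z => logDensity_toReal (hq.nonneg z)
  unfold rightDeriv
  rw [e]
  have h1 := hq.concaveOn.neg.hasDerivWithinAt_rightDeriv_of_mem_interior hx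
  have h2 := h1.neg
  simp only [neg_neg, Pi.neg_def] at h2
  exact h2.differentiableWithinAt.hasDerivWithinAt

section master

variable {ι : Type*} {l : Filter ι} {y : ι → ℝ} {q : ℝ → ℝ}

theorem LogConc.tendsto_prod {k : ι → ℝ → ℝ} (hk : ∀ᶠ i in l, LogConc (k i)) (hq : LogConc q)
    (hc : ∀ x ∈ interior {x | 0 < q x}, Tendsto (fun i => k i x) l (𝓝 (q x)))
    {x : ℝ} (hx : x ∈ interior {x | 0 < q x}) :
    Tendsto (fun p : ι × ℝ => k p.1 p.2) (l ×ˢ 𝓝 x) (𝓝 (q x)) := by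
  refine LogConc.tendsto_interior hk hq (fun u v huv hsub ε hε => ?_) hx
  obtain ⟨z, hz⟩ := nonempty_Ioo.2 huv
  filter_upwards [Metric.tendsto_nhds.1 (hc z (hsub ⟨hz.1.le, hz.2.le⟩)) ε hε] with i hi
  exact ⟨z, hz, hi⟩

theorem tendsto_prod_add (hy : Tendsto y l (𝓝 0)) (x : ℝ) :
    Tendsto (fun p : ι × ℝ => (p.1, p.2 + y p.1)) (l ×ˢ 𝓝 x) (l ×ˢ 𝓝 x) := by
  refine tendsto_fst.prodMk ?_
  simpa using tendsto_snd.add (hy.comp tendsto_fst)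

/-- One-sided derivatives of the logarithms converge at continuity points. -/
theorem LogConc.eventually_exists_rightDeriv {k : ι → ℝ → ℝ} (hk : ∀ᶠ i in l, LogConc (k i))
    (hq : LogConc q) (hc : ∀ x ∈ interior {x | 0 < q x}, Tendsto (fun i => k i x) l (𝓝 (q x)))
    (hy : Tendsto y l (𝓝 0)) {x : ℝ} (hx : x ∈ interior {x | 0 < q x})
    (hcont : ContinuousAt (rightDeriv (logDensity q)) x) {ε : ℝ} (hε : 0 < ε) :
    ∀ᶠ i in l, ∃ d, HasDerivWithinAt (fun z => Real.log (k i z)) d (Ioi (x + y i)) (x + y i) ∧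
      |d - rightDeriv (logDensity q) x| ≤ ε ∧ (∀ᶠ z in 𝓝 (x + y i), 0 < k i z) := by
  set d₀ := rightDeriv (logDensity q) x with hd₀
  have hpos : ∀ z ∈ interior {x | 0 < q x}, 0 < q z := fun z hz =>
    interior_subset (s := {x | 0 < q x}) hz
  have hint : ∀ᶠ z in 𝓝 x, z ∈ interior {x | 0 < q x} := isOpen_interior.mem_nhds hx
  have hsl := (hasDerivWithinAt_iff_tendsto_slope.1 (hq.hasDerivWithinAt_rightDeriv hx))
  rw [sdiff_singleton_eq_self (by simp)] at hsl
  obtain ⟨η₁, hη₁, hb₁⟩ := Metric.eventually_nhds_iff.1 (hint.and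
    (Metric.tendsto_nhds.1 hcont ε hε))
  obtain ⟨η₂, hη₂, hb₂⟩ := Metric.mem_nhdsWithin_iff.1
    (hsl.eventually_const_lt (show d₀ - ε < d₀ by linarith))
  -- On this scale the slope of `log q` over `[x, x + η]` exceeds `d₀ - ε`, by definition of the
  -- right derivative. The slope over `[x - η, x]` is at most the right derivative at `x - η`, hence
  -- below `d₀ + ε` by continuity of that derivative.
  set η := min η₁ η₂ / 2 with hη
  have hη0 : 0 < η := by have := lt_min hη₁ hη₂; positivity
  have hηa : η < η₁ := by have := min_le_left η₁ η₂; linarith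
  have hηb : η < η₂ := by have := min_le_right η₁ η₂; linarith
  have hin1 : x + η ∈ interior {x | 0 < q x} :=
    (hb₁ (y := x + η) (by simpa [abs_of_pos hη0] using hηa)).1
  have hin2 := hb₁ (y := x - η) (by simpa [Real.dist_eq, abs_of_pos hη0] using hηa)
  have hs1 : d₀ - ε < slope (fun z => Real.log (q z)) x (x + η) :=
    hb₂ ⟨by simpa [abs_of_pos hη0] using hηb, by simpa using hη0⟩
  have hs2 : slope (fun z => Real.log (q z)) (x - η) x < d₀ + ε := by
    have h1 := hq.concaveOn.slope_le_of_hasDerivWithinAt_Ioi (hpos _ hin2.1) (hpos _ hx)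
      (by linarith) (hq.hasDerivWithinAt_rightDeriv hin2.1)
    have h2 := hin2.2
    rw [Real.dist_eq, abs_lt] at h2
    linarith [h2.2]
  have hlim : ∀ t, x + t ∈ interior {x | 0 < q x} →
      Tendsto (fun i => Real.log (k i (x + t + y i))) l (𝓝 (Real.log (q (x + t)))) := by
    intro t ht
    have h1 := LogConc.tendsto_prod hk hq hc ht
    have h2 : Tendsto (fun i => (i, x + t + y i)) l (l ×ˢ 𝓝 (x + t)) :=
      tendsto_id.prodMk (by simpa using hy.const_add (x + t))
    exact (h1.comp h2).log (hpos _ ht).ne'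
  have l0 := hlim 0 (by simpa using hx)
  have l1 := hlim η hin1
  have l2 := hlim (-η) (sub_eq_add_neg x η ▸ hin2.1)
  simp only [add_zero] at l0
  have q1 : ∀ᶠ i in l, d₀ - ε < (Real.log (k i (x + η + y i)) - Real.log (k i (x + y i))) / η := by
    refine ((l1.sub l0).div_const η).eventually_const_lt ?_
    rwa [slope_def_field, add_sub_cancel_left] at hs1
  have q2 : ∀ᶠ i in l, (Real.log (k i (x + y i)) - Real.log (k i (x + -η + y i))) / η < d₀ + ε := by
    refine ((l0.sub l2).div_const η).eventually_lt_const ?_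
    rwa [slope_def_field, sub_sub_cancel, sub_eq_add_neg x] at hs2
  have hposE : ∀ t, x + t ∈ interior {x | 0 < q x} → ∀ᶠ i in l, 0 < k i (x + t + y i) := by
    intro t ht
    have h1 := LogConc.tendsto_prod hk hq hc ht
    have h2 : Tendsto (fun i => (i, x + t + y i)) l (l ×ˢ 𝓝 (x + t)) :=
      tendsto_id.prodMk (by simpa using hy.const_add (x + t))
    exact (h1.comp h2).eventually_const_lt (hpos _ ht)
  filter_upwards [hk, q1, q2, hposE η hin1, hposE (-η) (sub_eq_add_neg x η ▸ hin2.1)]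
    with i hi c1 c2 p1 p2
  set w := x + y i with hw
  have e1 : x + η + y i = w + η := by ring
  have e2 : x + -η + y i = w - η := by ring
  rw [e1] at c1 p1
  rw [e2] at c2 p2
  have hIcc : Icc (w - η) (w + η) ⊆ {z | 0 < k i z} := fun z hz => hi.pos_of_mem p2 p1 hz.1 hz.2
  have hnhds : Icc (w - η) (w + η) ∈ 𝓝 w := Icc_mem_nhds (by linarith) (by linarith)
  have hwi : w ∈ interior {z | 0 < k i z} := interior_mono hIcc (mem_interior_iff_mem_nhds.2 hnhds)
  have hd := hi.hasDerivWithinAt_rightDeriv hwi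
  have hw0 : 0 < k i w := hIcc ⟨by linarith, by linarith⟩
  refine ⟨_, hd, ?_, mem_of_superset hnhds hIcc⟩
  -- Concavity places the right derivative at `w` between the slopes over `[w, w + η]` and `[w - η,
  -- w]`, and these converge to the slopes for `q`.
  have b1 := hi.concaveOn.slope_le_of_hasDerivWithinAt_Ioi hw0 p1 (by linarith) hd
  have b2 : rightDeriv (logDensity (k i)) w ≤ slope (fun z => Real.log (k i z)) (w - η) w := by
    have h3 := (hasDerivWithinAt_iff_tendsto_slope.1 hd)
    rw [sdiff_singleton_eq_self (by simp)] at h3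
    refine le_of_tendsto h3 ?_
    filter_upwards [Ioo_mem_nhdsGT (show w < w + η by linarith)] with z hz
    have := hi.concaveOn.slope_anti_adjacent p2 (hIcc ⟨by linarith [hz.1], hz.2.le⟩)
      (show w - η < w by linarith) hz.1
    rwa [slope_def_field, slope_def_field]
  rw [slope_def_field, add_sub_cancel_left] at b1
  rw [slope_def_field, sub_sub_cancel] at b2
  rw [abs_le]
  constructor <;> linarith

/-! ### Convergence of averages, locally and on the whole line. -/

variable {h₁ h₂ g : ι → ℝ → ℝ}

/-- Averages of two log-concave functions that converge to the same log-concave function. -/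
theorem locallyConsistent_of_tendsto (hk₁ : ∀ᶠ i in l, LogConc (h₁ i))
    (hk₂ : ∀ᶠ i in l, LogConc (h₂ i)) (hq : LogConc q)
    (hc₁ : ∀ x ∈ interior {x | 0 < q x}, Tendsto (fun i => h₁ i x) l (𝓝 (q x)))
    (hc₂ : ∀ x ∈ interior {x | 0 < q x}, Tendsto (fun i => h₂ i x) l (𝓝 (q x)))
    (hy : Tendsto y l (𝓝 0)) (hg : ∀ᶠ i in l, ∀ x, g i x = (1 / 2) * (h₁ i x + h₂ i x)) :
    LocallyConsistent l g y q := by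
  have hpos : ∀ z ∈ interior {x | 0 < q x}, 0 < q z := fun z hz =>
    interior_subset (s := {x | 0 < q x}) hz
  have hT : ∀ x ∈ interior {x | 0 < q x},
      Tendsto (fun p : ι × ℝ => g p.1 (p.2 + y p.1)) (l ×ˢ 𝓝 x) (𝓝 (q x)) := by
    intro x hx
    have h1 := ((LogConc.tendsto_prod hk₁ hq hc₁ hx).add
      (LogConc.tendsto_prod hk₂ hq hc₂ hx)).const_mul (1 / 2)
    rw [show (1 / 2) * (q x + q x) = q x by ring] at h1
    refine (h1.comp (tendsto_prod_add hy x)).congr' ?_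
    filter_upwards [hg.prod_inl (𝓝 x)] with p hp
    exact (hp _).symm
  have hqT : ∀ x ∈ interior {x | 0 < q x},
      Tendsto (fun p : ι × ℝ => q p.2) (l ×ˢ 𝓝 x) (𝓝 (q x)) := fun x hx =>
    (hq.continuousAt hx).tendsto.comp tendsto_snd
  refine ⟨fun K hK hKs => ?_, fun K hK hKs => ?_, fun x hx hcont => ?_⟩
  · refine tendsto_zero_of_forall_real fun ε hε => ?_
    have h1 : ∀ᶠ i in l, ∀ x ∈ K, |g i (x + y i) - q x| < ε := by
      refine eventually_forall_of_isCompact hK (p := fun i x => |g i (x + y i) - q x| < ε)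
        fun x hx => ?_
      have := ((hT x (hKs hx)).sub (hqT x (hKs hx))).abs
      rw [sub_self, abs_zero] at this
      exact this.eventually_lt_const hε
    filter_upwards [h1] with i hi
    exact iSup₂_le fun x hx => ENNReal.ofReal_le_ofReal (hi x hx).le
  · refine tendsto_zero_of_forall_real fun ε hε => ?_
    have h1 : ∀ᶠ i in l, ∀ x ∈ K, |Real.log (g i (x + y i)) - Real.log (q x)| < ε ∧
        0 < g i (x + y i) := by
      refine eventually_forall_of_isCompact hK (p := fun i x =>
        |Real.log (g i (x + y i)) - Real.log (q x)| < ε ∧ 0 < g i (x + y i)) fun x hx => ?_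
      have h0 := hpos x (hKs hx)
      have := (((hT x (hKs hx)).log h0.ne').sub ((hqT x (hKs hx)).log h0.ne')).abs
      rw [sub_self, abs_zero] at this
      exact (this.eventually_lt_const hε).and ((hT x (hKs hx)).eventually_const_lt h0)
    filter_upwards [h1] with i hi
    refine iSup₂_le fun x hx => ?_
    rw [logDensity_of_pos (hi x hx).2, logDensity_of_pos (hpos x (hKs hx)), ← EReal.coe_sub,
      EReal.abs_def]
    exact ENNReal.ofReal_le_ofReal (hi x hx).1.le
  · refine tendsto_zero_of_forall_real fun ε hε => ?_
    filter_upwards [hg, LogConc.eventually_exists_rightDeriv hk₁ hq hc₁ hy hx hcont hε,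
      LogConc.eventually_exists_rightDeriv hk₂ hq hc₂ hy hx hcont hε] with i hgi H1 H2
    obtain ⟨d₁, D1, B1, P1⟩ := H1
    obtain ⟨d₂, D2, B2, P2⟩ := H2
    set w := x + y i with hw
    have p1 : 0 < h₁ i w := P1.self_of_nhds
    have p2 : 0 < h₂ i w := P2.self_of_nhds
    have hgpos : ∀ᶠ z in 𝓝 w, 0 < g i z := by
      filter_upwards [P1, P2] with z z1 z2
      rw [hgi]; positivity
    have E : ∀ {k : ι → ℝ → ℝ} {d : ℝ}, (∀ᶠ z in 𝓝 w, 0 < k i z) →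
        HasDerivWithinAt (fun z => Real.log (k i z)) d (Ioi w) w →
        HasDerivWithinAt (k i) (k i w * d) (Ioi w) w := by
      intro k d hk hd
      have h1 := hd.exp
      rw [Real.exp_log hk.self_of_nhds] at h1
      refine h1.congr_of_eventuallyEq ?_ (Real.exp_log hk.self_of_nhds).symm
      filter_upwards [nhdsWithin_le_nhds hk] with z hz using (Real.exp_log hz).symm
    have hgd : HasDerivWithinAt (g i) ((1 / 2) * (h₁ i w * d₁ + h₂ i w * d₂)) (Ioi w) w := by
      have h1 := ((E P1 D1).add (E P2 D2)).const_mul (1 / 2)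
      exact h1.congr (fun z _ => hgi z) (hgi w)
    have hld := hgd.log hgpos.self_of_nhds.ne'
    have hR : HasRightDeriv (logDensity (g i))
        ((1 / 2) * (h₁ i w * d₁ + h₂ i w * d₂) / g i w) w := by
      have hne : ∀ z, 0 < g i z → logDensity (g i) z ≠ ⊥ ∧ logDensity (g i) z ≠ ⊤ := fun z hz =>
        ⟨fun h => absurd hz (not_lt.2 (logDensity_eq_bot.1 h)), logDensity_ne_top _ _⟩
      refine ⟨hne w hgpos.self_of_nhds, ?_, ?_⟩
      · filter_upwards [nhdsWithin_le_nhds hgpos] with z hz using hne z hz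
      · refine hld.congr_of_eventuallyEq ?_ (logDensity_toReal hgpos.self_of_nhds.le)
        filter_upwards [nhdsWithin_le_nhds hgpos] with z hz using logDensity_toReal hz.le
    refine (iInf₂_le (f := fun d (_ : HasRightDeriv (logDensity (g i)) d (x + y i)) =>
      ENNReal.ofReal |d - rightDeriv (logDensity q) x|) _ hR).trans (ENNReal.ofReal_le_ofReal ?_)
    have g0 := hgpos.self_of_nhds
    -- The logarithmic derivative of the average is a convex combination of `d₁` and `d₂` with
    -- weights proportional to `h₁` and `h₂`, so it inherits the error bound `ε`.
    have e : (1 / 2) * (h₁ i w * d₁ + h₂ i w * d₂) / g i w - rightDeriv (logDensity q) x =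
        ((1 / 2) * (h₁ i w * (d₁ - rightDeriv (logDensity q) x) +
          h₂ i w * (d₂ - rightDeriv (logDensity q) x))) / g i w := by
      rw [div_sub' g0.ne']
      congr 1
      rw [hgi w]; ring
    rw [e, abs_div, abs_of_pos g0, div_le_iff₀ g0, hgi w, abs_mul, abs_of_pos (by norm_num : (0:ℝ) < 1 / 2)]
    have : |h₁ i w * (d₁ - rightDeriv (logDensity q) x) +
        h₂ i w * (d₂ - rightDeriv (logDensity q) x)| ≤ h₁ i w * ε + h₂ i w * ε := by
      refine (abs_add_le _ _).trans ?_
      rw [abs_mul, abs_mul, abs_of_pos p1, abs_of_pos p2]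
      gcongr
    linarith

/-- Pointwise convergence of log-concave functions to a continuous limit that vanishes at infinity
is uniform on the line. -/
theorem LogConc.eventually_forall_abs_sub_lt {k : ι → ℝ → ℝ} (hk : ∀ᶠ i in l, LogConc (k i))
    (hq : LogConc q) (hc : ∀ x ∈ interior {x | 0 < q x}, Tendsto (fun i => k i x) l (𝓝 (q x)))
    (hqc : Continuous q) (hq0 : Tendsto q (cocompact ℝ) (𝓝 0)) {p : ℝ} (hp : 0 < q p)
    {ε : ℝ} (hε : 0 < ε) : ∀ᶠ i in l, ∀ x, |k i x - q x| < ε := by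
  have hopen : interior {x | 0 < q x} = {x | 0 < q x} :=
    (isOpen_lt continuous_const hqc).interior_eq
  set e := min ε (q p) / 4 with he
  have he0 : 0 < e := by have := lt_min hε hp; positivity
  have heε : 4 * e ≤ ε := by have := min_le_left ε (q p); linarith
  have hep : 4 * e ≤ q p := by have := min_le_right ε (q p); linarith
  set K := {x | e ≤ q x} with hK
  have hKcl : IsClosed K := isClosed_le continuous_const hqc
  have hKc : IsCompact K := by
    obtain ⟨t, ht, hts⟩ := mem_cocompact.1 (hq0.eventually_lt_const he0)
    refine ht.of_isClosed_subset hKcl fun x hx => ?_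
    by_contra hxt
    exact absurd (show q x < e from hts hxt) (not_lt.2 hx)
  have hpK : p ∈ K := show e ≤ q p by linarith
  have hKs : K ⊆ interior {x | 0 < q x} := by
    rw [hopen]; exact fun x hx => lt_of_lt_of_le he0 hx
  have hu : ∀ᶠ i in l, ∀ x ∈ K, |k i x - q x| < e := by
    refine eventually_forall_of_isCompact hKc (p := fun i x => |k i x - q x| < e) fun x hx => ?_
    have := ((LogConc.tendsto_prod hk hq hc (hKs hx)).sub
      ((hq.continuousAt (hKs hx)).tendsto.comp (tendsto_snd (f := l)))).abs
    rw [sub_self, abs_zero] at this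
    exact this.eventually_lt_const he0
  obtain ⟨α, hα, hαl⟩ := hKc.exists_isLeast ⟨p, hpK⟩
  obtain ⟨β, hβ, hβl⟩ := hKc.exists_isGreatest ⟨p, hpK⟩
  have hαe : q α ≤ e := by
    refine le_of_tendsto (f := q) (x := 𝓝[<] α) (hqc.continuousAt.tendsto.mono_left nhdsWithin_le_nhds) ?_
    filter_upwards [self_mem_nhdsWithin] with z hz
    by_contra hcon
    exact absurd (hαl (show z ∈ K from (not_le.1 hcon).le)) (not_le.2 hz)
  have hβe : q β ≤ e := by
    refine le_of_tendsto (f := q) (x := 𝓝[>] β) (hqc.continuousAt.tendsto.mono_left nhdsWithin_le_nhds) ?_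
    filter_upwards [self_mem_nhdsWithin] with z hz
    by_contra hcon
    exact absurd (hβl (show z ∈ K from (not_le.1 hcon).le)) (not_le.2 hz)
  filter_upwards [hk, hu] with i hi hui x
  by_cases hx : x ∈ K
  · exact (hui x hx).trans_le (by linarith)
  have hxq : q x < e := not_le.1 hx
  have h1 := (abs_lt.1 (hui p hpK)).1
  have h2 : k i x < 2 * e := by
    rcases lt_or_ge x α with h3 | h3
    · have h4 := (abs_lt.1 (hui α hα)).2
      exact (hi.le_of_lt_right (hαl hpK) h3.le (by linarith)).trans_lt (by linarith)
    rcases lt_or_ge β x with h3' | h3'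
    · have h4 := (abs_lt.1 (hui β hβ)).2
      exact (hi.le_of_lt_left (hβl hpK) h3'.le (by linarith)).trans_lt (by linarith)
    exact absurd (le_trans (le_min hα hβ) (hq.min_le h3 h3')) (not_le.2 hxq)
  rw [abs_lt]
  constructor <;> linarith [hi.nonneg x, hq.nonneg x]

theorem tendsto_supDev_univ (hk₁ : ∀ᶠ i in l, LogConc (h₁ i))
    (hk₂ : ∀ᶠ i in l, LogConc (h₂ i)) (hq : LogConc q)
    (hc₁ : ∀ x ∈ interior {x | 0 < q x}, Tendsto (fun i => h₁ i x) l (𝓝 (q x)))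
    (hc₂ : ∀ x ∈ interior {x | 0 < q x}, Tendsto (fun i => h₂ i x) l (𝓝 (q x)))
    (hy : Tendsto y l (𝓝 0)) (hg : ∀ᶠ i in l, ∀ x, g i x = (1 / 2) * (h₁ i x + h₂ i x))
    (hqc : Continuous q) (hq0 : Tendsto q (cocompact ℝ) (𝓝 0)) {p : ℝ} (hp : 0 < q p) :
    Tendsto (fun i => supDev (g i) (y i) q univ) l (𝓝 0) := by
  refine tendsto_zero_of_forall_real fun ε hε => ?_
  have huc : UniformContinuous q := hqc.uniformContinuous_of_tendsto_cocompact hq0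
  obtain ⟨η, hη, hqη⟩ := Metric.uniformContinuous_iff.1 huc (ε / 2) (by positivity)
  filter_upwards [hg, Metric.tendsto_nhds.1 hy η hη,
    LogConc.eventually_forall_abs_sub_lt hk₁ hq hc₁ hqc hq0 hp (by positivity : 0 < ε / 2),
    LogConc.eventually_forall_abs_sub_lt hk₂ hq hc₂ hqc hq0 hp (by positivity : 0 < ε / 2)]
    with i hgi hyi H1 H2
  refine iSup₂_le fun x _ => ENNReal.ofReal_le_ofReal ?_
  have h1 := abs_lt.1 (H1 (x + y i))
  have h2 := abs_lt.1 (H2 (x + y i))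
  have h3 : dist (q (x + y i)) (q x) < ε / 2 := hqη (by simpa [Real.dist_eq] using hyi)
  rw [Real.dist_eq, abs_lt] at h3
  rw [hgi, abs_le]
  constructor <;> linarith [h1.1, h1.2, h2.1, h2.2, h3.1, h3.2]

end master

/-! ### Extended-real-valued concave functions and real-valued log-concave functions -/

section bridge

variable {h : ℝ → ℝ} {φ : ℝ → EReal} {P : Measure ℝ}

theorem coe_le_logDensity {r x : ℝ} : (r : EReal) ≤ logDensity h x ↔ Real.exp r ≤ h x := by
  rcases lt_or_ge 0 (h x) with hx | hx
  · rw [logDensity_of_pos hx, EReal.coe_le_coe_iff, Real.le_log_iff_exp_le hx]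
  · rw [logDensity_eq_bot.2 hx]
    exact ⟨fun H => absurd (le_bot_iff.1 H) (EReal.coe_ne_bot r), fun H =>
      absurd (H.trans hx) (not_le.2 (Real.exp_pos r))⟩

theorem logDensity_lt_coe {r x : ℝ} : logDensity h x < (r : EReal) ↔ h x < Real.exp r := by
  rw [← not_le, ← not_le, coe_le_logDensity]

theorem expFun_nonneg (φ : ℝ → EReal) (x : ℝ) : 0 ≤ expFun φ x := ENNReal.toReal_nonneg

theorem logDensity_expFun (hφ : ∀ x, φ x ≠ ⊤) : logDensity (expFun φ) = φ := by
  funext x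
  unfold logDensity expFun
  rw [ENNReal.ofReal_toReal (by simpa using hφ x), EReal.log_exp]

theorem expFun_logDensity (h0 : ∀ x, 0 ≤ h x) : expFun (logDensity h) = h := by
  funext x
  unfold logDensity expFun
  rw [ENNReal.exp_log, ENNReal.toReal_ofReal (h0 x)]

theorem logDensity_mem_concaveClass (H : LogConc h) (hu : UpperSemicontinuous h)
    (hp : ∃ p, 0 < h p) : logDensity h ∈ ConcaveClass := by
  refine ⟨?_, fun x v hv => ?_, logDensity_ne_top h, ?_⟩
  · rintro ⟨x, r⟩ hx ⟨y, s⟩ hy a b ha hb hab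
    simp only [mem_ofPred_eq, coe_le_logDensity] at hx hy
    simp only [mem_ofPred_eq, Prod.smul_mk, Prod.mk_add_mk, smul_eq_mul]
    exact coe_le_logDensity.2 ((logConc_iff.1 H).2 x y r s a b ha hb hab hx hy)
  · induction v using EReal.rec with
    | bot => exact absurd hv not_lt_bot
    | top => exact Eventually.of_forall fun z => (logDensity_ne_top h z).lt_top
    | coe r =>
      filter_upwards [hu x _ (logDensity_lt_coe.1 hv)] with z hz using logDensity_lt_coe.2 hz
  · obtain ⟨p, hp⟩ := hp
    exact ⟨p, fun e => absurd hp (not_lt.2 (logDensity_eq_bot.1 e))⟩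

theorem exists_eq_logDensity (hφ : φ ∈ ConcaveClass) : logDensity (expFun φ) = φ ∧
    LogConc (expFun φ) ∧ UpperSemicontinuous (expFun φ) ∧ ∃ p, 0 < expFun φ p := by
  have e := logDensity_expFun hφ.2.2.1
  refine ⟨e, logConc_iff.2 ⟨expFun_nonneg φ, fun x y r s a b ha hb hab hx hy => ?_⟩,
    fun x v hv => ?_, ?_⟩
  · rw [← coe_le_logDensity, e] at hx hy ⊢
    have := hφ.1 (x := (x, r)) hx (y := (y, s)) hy ha hb hab
    simpa using this
  · have hv0 : 0 < v := (expFun_nonneg φ x).trans_lt hv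
    rw [← Real.exp_log hv0, ← logDensity_lt_coe, e] at hv
    filter_upwards [hφ.2.1 x _ hv] with z hz
    rwa [← e, logDensity_lt_coe, Real.exp_log hv0] at hz
  · obtain ⟨p, hp⟩ := hφ.2.2.2
    refine ⟨p, not_le.1 fun hle => hp ?_⟩
    rw [← e]; exact logDensity_eq_bot.2 hle

theorem omegaCrit_logDensity (hA : Adm P h) : omegaCrit (logDensity h) P = (crit P h : ℝ) := by
  have h1 : ∫⁻ x, (logDensity h x).toENNReal ∂P = ∫⁻ x, ENNReal.ofReal (Real.log (h x)) ∂P :=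
    lintegral_congr_ae (by filter_upwards [hA.pos] with x hx; rw [logDensity_of_pos hx]; rfl)
  have h2 : ∫⁻ x, (-logDensity h x).toENNReal ∂P = ∫⁻ x, ENNReal.ofReal (-Real.log (h x)) ∂P :=
    lintegral_congr_ae (by
      filter_upwards [hA.pos] with x hx; rw [logDensity_of_pos hx, ← EReal.coe_neg]; rfl)
  have h3 : ∫⁻ x, EReal.exp (logDensity h x) = ENNReal.ofReal (∫ x, h x) := by
    rw [ofReal_integral_eq_lintegral_ofReal hA.int (Eventually.of_forall hA.logConc.nonneg)]
    exact lintegral_congr fun x => ENNReal.exp_log _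
  have f1 : ∫⁻ x, ENNReal.ofReal (Real.log (h x)) ∂P ≠ ⊤ :=
    (hA.logInt.lintegral_lt_top).ne
  have f2 : ∫⁻ x, ENNReal.ofReal (-Real.log (h x)) ∂P ≠ ⊤ :=
    (hA.logInt.neg.lintegral_lt_top).ne
  unfold omegaCrit crit
  rw [h1, h2, h3, integral_eq_lintegral_pos_part_sub_lintegral_neg_part hA.logInt,
    ← EReal.coe_ennreal_toReal f1, ← EReal.coe_ennreal_toReal f2,
    ← EReal.coe_ennreal_toReal ENNReal.ofReal_ne_top,
    ENNReal.toReal_ofReal (integral_nonneg hA.logConc.nonneg)]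
  simp only [EReal.coe_sub]

/-- In the extended reals, subtracting `⊤` gives `⊥`, so infinite mass or an infinite negative part
makes the criterion `⊥`. Otherwise `exp φ` is integrable and positive on both sides of the spread
interval, hence bounded, and `log` is integrable. The extended and the real maximization problems
therefore agree. -/
theorem omegaCrit_eq_bot_or_adm [IsProbabilityMeasure P] {a b δ : ℝ} (H : Spread P a b δ)
    (hφ : φ ∈ ConcaveClass) : omegaCrit φ P = ⊥ ∨ Adm P (expFun φ) := by
  obtain ⟨e, hc, hu, -⟩ := exists_eq_logDensity hφ
  set h := expFun φ with hh
  have hm : Measurable h := hu.measurable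
  by_cases t1 : ∫⁻ x, EReal.exp (φ x) = ⊤
  · left
    unfold omegaCrit
    rw [t1, EReal.coe_ennreal_top, EReal.sub_top]
  by_cases t2 : ∫⁻ x, (-φ x).toENNReal ∂P = ⊤
  · left
    unfold omegaCrit
    rw [t2, EReal.coe_ennreal_top, EReal.sub_top, EReal.bot_sub]
  right
  have hφm : Measurable φ := by rw [← e]; unfold logDensity; fun_prop
  have hi : Integrable h := by
    refine ⟨hm.aestronglyMeasurable, ?_⟩
    rw [hasFiniteIntegral_iff_ofReal (Eventually.of_forall hc.nonneg)]
    have : ∀ x, ENNReal.ofReal (h x) = EReal.exp (φ x) := fun x => by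
      rw [← e]; exact (ENNReal.exp_log _).symm
    simp_rw [this]
    exact lt_top_iff_ne_top.2 t1
  have hpos : ∀ᵐ x ∂P, 0 < h x := by
    have : ∀ᵐ x ∂P, (-φ x).toENNReal < ⊤ :=
      ae_lt_top (by fun_prop) t2
    filter_upwards [this] with x hx
    by_contra hcon
    have : φ x = ⊥ := by rw [← e]; exact logDensity_eq_bot.2 (not_lt.1 hcon)
    rw [this] at hx
    simp at hx
  obtain ⟨⟨p, hp, hp0⟩, q, hq, hq0⟩ := H.exists_pos hpos
  have hpq : p < q := hp.trans_lt (H.lt.trans_le hq)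
  -- The available bound assumes mass at most one; dividing by `1 + ∫ h` ensures that whatever the
  -- mass is.
  obtain ⟨S, hS⟩ : ∃ S, ∀ x, h x ≤ S := by
    set k := (1 + ∫ x, h x)⁻¹ with hk
    have h0 : 0 ≤ ∫ x, h x := integral_nonneg hc.nonneg
    have hk0 : 0 < k := by positivity
    obtain ⟨S, hS⟩ := (hc.const_mul hk0).bddAbove (hi.const_mul k) (by
      rw [integral_const_mul, hk, inv_mul_le_one₀ (by positivity)]; linarith) hpq
      (mul_pos hk0 hp0) (mul_pos hk0 hq0)
    refine ⟨S / k, fun x => ?_⟩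
    rw [le_div_iff₀ hk0, mul_comm]
    exact hS ⟨x, rfl⟩
  refine ⟨hc, hu, hpos, ⟨(Real.measurable_log.comp hm).aestronglyMeasurable, ?_⟩, hi⟩
  have hb : ∀ᵐ x ∂P, ‖Real.log (h x)‖ₑ ≤ ENNReal.ofReal |Real.log S| + (-φ x).toENNReal := by
    filter_upwards [hpos] with x hx
    have e1 : (-φ x).toENNReal = ENNReal.ofReal (-Real.log (h x)) := by
      rw [← e, logDensity_of_pos hx, ← EReal.coe_neg]; rfl
    rw [e1, Real.enorm_eq_ofReal_abs]
    have hlog := Real.log_le_log hx (hS x)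
    rcases le_total 0 (Real.log (h x)) with h1 | h1
    · refine le_add_right (ENNReal.ofReal_le_ofReal ?_)
      rw [abs_of_nonneg h1]; exact hlog.trans (le_abs_self _)
    · rw [abs_of_nonpos h1]
      exact le_add_left le_rfl
  refine (lintegral_mono_ae hb).trans_lt ?_
  rw [lintegral_add_left measurable_const]
  refine ENNReal.add_lt_top.2 ⟨?_, lt_top_iff_ne_top.2 t2⟩
  simp

theorem isProj_expFun [IsProbabilityMeasure P] {a b δ : ℝ} (H : Spread P a b δ)
    (hP : Integrable (fun x : ℝ => x) P) (hφ : IsLogConcaveProjection P φ) :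
    IsProj P (expFun φ) := by
  obtain ⟨g, hg⟩ := exists_isProj H hP
  have key : ∀ k, Adm P k → (crit P k : EReal) ≤ omegaCrit φ P := fun k hk => by
    rw [← omegaCrit_logDensity hk]
    exact hφ.2 _ (logDensity_mem_concaveClass hk.logConc hk.usc hk.pos.exists)
  rcases omegaCrit_eq_bot_or_adm H hφ.1 with h1 | h1
  · have := key g hg.adm
    rw [h1] at this
    exact absurd (le_bot_iff.1 this) (EReal.coe_ne_bot _)
  · refine ⟨h1, fun k hk => ?_⟩
    have h2 := key k hk
    rw [← logDensity_expFun hφ.1.2.2.1, omegaCrit_logDensity h1] at h2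
    exact EReal.coe_le_coe_iff.1 h2

theorem IsProj.isLogConcaveProjection [IsProbabilityMeasure P] {a b δ : ℝ} (H : Spread P a b δ)
    (hh : IsProj P h) : IsLogConcaveProjection P (logDensity h) := by
  refine ⟨logDensity_mem_concaveClass hh.adm.logConc hh.adm.usc hh.adm.pos.exists,
    fun φ hφ => ?_⟩
  rcases omegaCrit_eq_bot_or_adm H hφ with h1 | h1
  · rw [h1]; exact bot_le
  · rw [← logDensity_expFun hφ.2.2.1, omegaCrit_logDensity h1, omegaCrit_logDensity hh.adm]
    exact EReal.coe_le_coe_iff.2 (hh.le_crit _ h1)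

theorem isProj_logProjection [IsProbabilityMeasure P] {a b δ : ℝ} (H : Spread P a b δ)
    (hP : Integrable (fun x : ℝ => x) P) : IsProj P (expFun (logProjection P)) := by
  obtain ⟨g, hg⟩ := exists_isProj H hP
  exact isProj_expFun H hP (Classical.epsilon_spec ⟨_, hg.isLogConcaveProjection H⟩)

end bridge

/-! ### Affine maps -/

/-- With `e = ±1` this covers translations and reflections at once; they preserve Lebesgue measure,
and the inverse is of the same form with `-(e * c)` in place of `c`. -/
theorem Adm.comp_affine {P : Measure ℝ} {h : ℝ → ℝ} (hA : Adm P h) {e : ℝ} (he : e * e = 1)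
    (c : ℝ) : Adm (P.map fun x => e * x + c) (fun y => h (e * y + -(e * c))) ∧
      crit (P.map fun x => e * x + c) (fun y => h (e * y + -(e * c))) = crit P h := by
  have hm : Measurable fun x : ℝ => e * x + c := by fun_prop
  have hcomp : ∀ x, e * (e * x + c) + -(e * c) = x := fun x => by linear_combination x * he
  have hhm := hA.usc.measurable
  have hgm : Measurable fun y : ℝ => h (e * y + -(e * c)) := hhm.comp (by fun_prop)
  have hlm : AEStronglyMeasurable (fun y : ℝ => Real.log (h (e * y + -(e * c))))
      (P.map fun x => e * x + c) := (Real.measurable_log.comp hgm).aestronglyMeasurable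
  have he0 : e ≠ 0 := fun h0 => by simp [h0] at he
  have habs : |e⁻¹| = 1 := by
    have : |e| * |e| = 1 := by rw [← abs_mul, he, abs_one]
    rw [abs_inv, show |e| = 1 by nlinarith [abs_nonneg e], inv_one]
  have hi : Integrable fun y => h (e * y + -(e * c)) :=
    (hA.int.comp_add_right (-(e * c))).comp_mul_left' he0
  have hii : ∫ y, h (e * y + -(e * c)) = ∫ y, h y := by
    rw [Measure.integral_comp_mul_left (fun y => h (y + -(e * c))) e, habs, one_smul,
      integral_add_right_eq_self]
  refine ⟨⟨hA.logConc.comp_affine e _, ?_, ?_, ?_, hi⟩, ?_⟩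
  · exact hA.usc.comp (by fun_prop : Continuous fun y : ℝ => e * y + -(e * c))
  · rw [ae_map_iff hm.aemeasurable (measurableSet_lt measurable_const hgm)]
    simpa only [hcomp] using hA.pos
  · rw [integrable_map_measure hlm hm.aemeasurable]
    simpa only [Function.comp_def, hcomp] using hA.logInt
  · unfold crit
    rw [hii, integral_map hm.aemeasurable hlm]
    simp only [hcomp]

theorem IsProj.comp_affine {P : Measure ℝ} {h : ℝ → ℝ} (hP : IsProj P h) {e : ℝ}
    (he : e * e = 1) (c : ℝ) :
    IsProj (P.map fun x => e * x + c) (fun y => h (e * y + -(e * c))) := by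
  have h1 := hP.adm.comp_affine he c
  refine ⟨h1.1, fun g hg => ?_⟩
  have h2 := hg.comp_affine he (-(e * c))
  have hid : (P.map fun x => e * x + c).map (fun x => e * x + -(e * c)) = P := by
    rw [Measure.map_map (by fun_prop) (by fun_prop)]
    have : (fun x : ℝ => e * x + -(e * c)) ∘ (fun x => e * x + c) = id := by
      funext x; simp only [Function.comp, id]; linear_combination x * he
    rw [this, Measure.map_id]
  rw [hid] at h2
  rw [h1.2, ← h2.2]
  exact hP.le_crit _ h2.1

/-! ### Empirical measures and maximum likelihood -/

section empirical

variable {n : ℕ} {x : ℕ → ℝ} {h : ℝ → ℝ} {a b δ : ℝ}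

theorem isProbabilityMeasure_empiricalMeasure (hn : n ≠ 0) (x : ℕ → ℝ) :
    IsProbabilityMeasure (empiricalMeasure n x) := by
  constructor
  simp only [empiricalMeasure, Measure.smul_apply, Measure.finsetSum_apply, measure_univ,
    Finset.sum_const, Finset.card_range, nsmul_eq_mul, mul_one, smul_eq_mul]
  exact ENNReal.inv_mul_cancel (by exact_mod_cast hn) (ENNReal.natCast_ne_top n)

theorem integrable_empiricalMeasure (hn : n ≠ 0) (x : ℕ → ℝ) (u : ℝ → ℝ) :
    Integrable u (empiricalMeasure n x) := by
  refine Integrable.smul_measure ?_ (by simpa using hn)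
  exact integrable_finsetSum_measure.2 fun i _ => integrable_dirac (by simp)

theorem integral_empiricalMeasure (n : ℕ) (x : ℕ → ℝ) (u : ℝ → ℝ) :
    ∫ t, u t ∂(empiricalMeasure n x) = (n : ℝ)⁻¹ * ∑ i ∈ Finset.range n, u (x i) := by
  rw [empiricalMeasure, integral_smul_measure,
    integral_finsetSum_measure fun i _ => integrable_dirac (by simp)]
  simp

theorem ae_empiricalMeasure_iff {p : ℝ → Prop} :
    (∀ᵐ t ∂(empiricalMeasure n x), p t) ↔ ∀ i < n, p (x i) := by
  rw [ae_iff]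
  simp only [empiricalMeasure, Measure.smul_apply, Measure.finsetSum_apply, smul_eq_mul,
    mul_eq_zero, ENNReal.inv_eq_zero, ENNReal.natCast_ne_top, false_or,
    Finset.sum_eq_zero_iff, Finset.mem_range, Measure.dirac_apply]
  refine forall₂_congr fun i _ => ?_
  simp

theorem Adm.pos_of_lt (hA : Adm (empiricalMeasure n x) h) (i : ℕ) (hi : i < n) : 0 < h (x i) :=
  (ae_empiricalMeasure_iff (p := fun t => 0 < h t)).1 hA.pos i hi

theorem adm_empiricalMeasure (hn : n ≠ 0) (H : LogConc h) (hu : UpperSemicontinuous h)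
    (hi : Integrable h) (hp : ∀ i < n, 0 < h (x i)) : Adm (empiricalMeasure n x) h :=
  ⟨H, hu, (ae_empiricalMeasure_iff (p := fun t => 0 < h t)).2 hp, integrable_empiricalMeasure hn x _, hi⟩

theorem logConc_of_mem_logConcaveDensities (hh : h ∈ LogConcaveDensities) :
    LogConc h ∧ UpperSemicontinuous h ∧ Integrable h ∧ ∫ x, h x = 1 := by
  obtain ⟨⟨hm, h0, h1⟩, hc⟩ := hh
  have h2 := exists_eq_logDensity hc
  rw [expFun_logDensity h0] at h2
  have hi : Integrable h := by
    refine ⟨hm.aestronglyMeasurable, ?_⟩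
    rw [hasFiniteIntegral_iff_ofReal (Eventually.of_forall h0), h1]
    exact ENNReal.one_lt_top
  refine ⟨h2.2.1, h2.2.2.1, hi, ?_⟩
  rw [integral_eq_lintegral_of_nonneg_ae (Eventually.of_forall h0) hm.aestronglyMeasurable, h1,
    ENNReal.toReal_one]

theorem Adm.mem_logConcaveDensities {P : Measure ℝ} [IsProbabilityMeasure P] (hA : Adm P h)
    (h1 : ∫ x, h x = 1) : h ∈ LogConcaveDensities := by
  refine ⟨⟨hA.usc.measurable, hA.logConc.nonneg, ?_⟩,
    logDensity_mem_concaveClass hA.logConc hA.usc hA.pos.exists⟩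
  rw [← ofReal_integral_eq_lintegral_ofReal hA.int (Eventually.of_forall hA.logConc.nonneg), h1,
    ENNReal.ofReal_one]

theorem prod_eq_exp_integral_log (hn : n ≠ 0) (hp : ∀ i < n, 0 < h (x i)) :
    ∏ i ∈ Finset.range n, h (x i) =
      Real.exp (n * ∫ t, Real.log (h t) ∂(empiricalMeasure n x)) := by
  rw [integral_empiricalMeasure, mul_inv_cancel_left₀ (by exact_mod_cast hn), Real.exp_sum]
  exact Finset.prod_congr rfl fun i hi => (Real.exp_log (hp i (Finset.mem_range.1 hi))).symm

/-- The likelihood is `exp (n ∫ log h)` for the empirical measure, and the constraint of unit mass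
can be dropped by normalization, as `log t ≤ t - 1`. -/
theorem isProj_of_isLogConcaveMLE (hn : n ≠ 0) (H : Spread (empiricalMeasure n x) a b δ)
    (hh : IsLogConcaveMLE n x h) : IsProj (empiricalMeasure n x) h := by
  have := isProbabilityMeasure_empiricalMeasure hn x
  have hn0 : (0 : ℝ) < n := by exact_mod_cast hn.bot_lt
  have hle : ∀ k, Adm (empiricalMeasure n x) k → ∫ x, k x = 1 →
      ∏ i ∈ Finset.range n, k (x i) ≤ ∏ i ∈ Finset.range n, h (x i) := fun k hk h1 =>
    hh.2 _ (hk.mem_logConcaveDensities h1)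
  obtain ⟨hc, hu, hi, h1⟩ := logConc_of_mem_logConcaveDensities hh.1
  obtain ⟨g, hg⟩ := exists_isProj H (integrable_empiricalMeasure hn x _)
  -- A density with positive likelihood must be exhibited before logarithms can be taken; an
  -- existing maximizer of the criterion is one.
  have hprod : 0 < ∏ i ∈ Finset.range n, h (x i) :=
    (Finset.prod_pos fun i hi => hg.adm.pos_of_lt i
      (Finset.mem_range.1 hi)).trans_le (hle g hg.adm (hg.integral_eq_one H))
  have hpos : ∀ i < n, 0 < h (x i) := fun i hi =>
    lt_of_le_of_ne (hc.nonneg _) fun e =>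
      hprod.ne (Finset.prod_eq_zero (Finset.mem_range.2 hi) e.symm).symm
  have hA := adm_empiricalMeasure hn hc hu hi hpos
  refine ⟨hA, fun k hk => ?_⟩
  have hk0 := hk.integral_pos H
  obtain ⟨k1, k2⟩ := hk.const_mul (inv_pos.2 hk0)
  have k3 : ∫ t, (∫ s, k s)⁻¹ * k t = 1 := by
    rw [integral_const_mul, inv_mul_cancel₀ hk0.ne']
  have k4 := hle _ k1 k3
  rw [prod_eq_exp_integral_log (h := fun t => (∫ s, k s)⁻¹ * k t) hn
    k1.pos_of_lt, prod_eq_exp_integral_log hn hpos, Real.exp_le_exp,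
    mul_le_mul_iff_right₀ hn0] at k4
  rw [Real.log_inv, inv_mul_cancel₀ hk0.ne', crit, k3] at k2
  unfold crit
  rw [h1]
  linarith [Real.log_le_sub_one_of_pos hk0]

theorem IsProj.isLogConcaveMLE (hn : n ≠ 0) (H : Spread (empiricalMeasure n x) a b δ)
    (hh : IsProj (empiricalMeasure n x) h) : IsLogConcaveMLE n x h := by
  have := isProbabilityMeasure_empiricalMeasure hn x
  have h1 := hh.integral_eq_one H
  refine ⟨hh.adm.mem_logConcaveDensities h1, fun k hk => ?_⟩
  obtain ⟨hc, hu, hi, k1⟩ := logConc_of_mem_logConcaveDensities hk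
  by_cases hpos : ∀ i < n, 0 < k (x i)
  · have h2 := hh.le_crit _ (adm_empiricalMeasure hn hc hu hi hpos)
    unfold crit at h2
    rw [h1, k1] at h2
    rw [prod_eq_exp_integral_log hn hpos,
      prod_eq_exp_integral_log hn hh.adm.pos_of_lt, Real.exp_le_exp]
    exact mul_le_mul_of_nonneg_left (by linarith) n.cast_nonneg
  · push Not at hpos
    obtain ⟨i, hin, hi0⟩ := hpos
    rw [Finset.prod_eq_zero (Finset.mem_range.2 hin) (le_antisymm hi0 (hc.nonneg _))]
    exact Finset.prod_nonneg fun j _ => hh.adm.logConc.nonneg _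

theorem isProj_mle (hn : n ≠ 0) (H : Spread (empiricalMeasure n x) a b δ) :
    IsProj (empiricalMeasure n x) (mle n x) := by
  have := isProbabilityMeasure_empiricalMeasure hn x
  obtain ⟨g, hg⟩ := exists_isProj H (integrable_empiricalMeasure hn x _)
  exact isProj_of_isLogConcaveMLE hn H (Classical.epsilon_spec ⟨g, hg.isLogConcaveMLE hn H⟩)

end empirical

/-! ### Symmetrization and the partial maximum likelihood estimator -/

section symmetrization

variable {P : Measure ℝ} {h : ℝ → ℝ} {a b δ : ℝ}

/-- The mixture with equal weights of `P` and its reflection. -/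
noncomputable def symLaw (P : Measure ℝ) : Measure ℝ := (2 : ℝ≥0∞)⁻¹ • (P + P.map fun x => -x)

theorem map_neg_map_neg (P : Measure ℝ) : (P.map fun x => -x).map (fun x => -x) = P := by
  rw [Measure.map_map (by fun_prop) (by fun_prop)]
  have : (fun x : ℝ => -x) ∘ (fun x => -x) = id := by funext x; simp
  rw [this, Measure.map_id]

theorem isProbabilityMeasure_symLaw [IsProbabilityMeasure P] :
    IsProbabilityMeasure (symLaw P) := by
  have : IsProbabilityMeasure (P.map fun x => -x) :=
    Measure.isProbabilityMeasure_map (by fun_prop)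
  constructor
  simp only [symLaw, Measure.smul_apply, Measure.add_apply, measure_univ, smul_eq_mul]
  rw [one_add_one_eq_two]
  exact ENNReal.inv_mul_cancel (by simp) (by simp)

theorem symLaw_map_neg (P : Measure ℝ) : (symLaw P).map (fun x => -x) = symLaw P := by
  unfold symLaw
  rw [Measure.map_smul, Measure.map_add _ _ (by fun_prop), map_neg_map_neg, add_comm]

theorem symLaw_eq_self (hP : P.map (fun x => -x) = P) : symLaw P = P := by
  unfold symLaw
  rw [hP, ← two_smul ℝ≥0∞ P, smul_smul, ENNReal.inv_mul_cancel (by simp) (by simp), one_smul]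

theorem integrable_symLaw {u : ℝ → ℝ} (hu : Integrable u P)
    (hu' : Integrable u (P.map fun x => -x)) : Integrable u (symLaw P) :=
  (hu.add_measure hu').smul_measure (by simp)

theorem integral_symLaw {u : ℝ → ℝ} (hu : Integrable u P)
    (hu' : Integrable u (P.map fun x => -x)) :
    ∫ x, u x ∂(symLaw P) = (∫ x, u x ∂P + ∫ x, u x ∂(P.map fun x => -x)) / 2 := by
  rw [symLaw, integral_smul_measure, integral_add_measure hu hu']
  simp only [ENNReal.toReal_inv, ENNReal.toReal_ofNat, smul_eq_mul]
  ring

theorem lintegral_symLaw {u : ℝ → ℝ≥0∞} (hu : Measurable u) (hs : ∀ x, u (-x) = u x) :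
    ∫⁻ x, u x ∂(symLaw P) = ∫⁻ x, u x ∂P := by
  rw [symLaw, lintegral_smul_measure, lintegral_add_measure, lintegral_map hu (by fun_prop)]
  simp only [hs]
  rw [← two_mul, smul_eq_mul, ← mul_assoc, ENNReal.inv_mul_cancel (by simp) (by simp), one_mul]

theorem integrable_map_neg (hP : Integrable (fun x : ℝ => x) P) :
    Integrable (fun x : ℝ => x) (P.map fun x => -x) :=
  (integrable_map_measure aestronglyMeasurable_id (by fun_prop)).2 hP.neg

theorem W1Le.symLaw {P₀ : Measure ℝ} [IsProbabilityMeasure P] [IsProbabilityMeasure P₀]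
    (hP : Integrable (fun x : ℝ => x) P) (hP₀ : Integrable (fun x : ℝ => x) P₀) {W : ℝ}
    (hW : W1Le P P₀ W) : W1Le (symLaw P) (symLaw P₀) W := fun u hu => by
  have : IsProbabilityMeasure (P.map fun x => -x) :=
    Measure.isProbabilityMeasure_map (by fun_prop)
  have : IsProbabilityMeasure (P₀.map fun x => -x) :=
    Measure.isProbabilityMeasure_map (by fun_prop)
  rw [integral_symLaw (integrable_of_lipschitzWith hP hu)
    (integrable_of_lipschitzWith (integrable_map_neg hP) hu),
    integral_symLaw (integrable_of_lipschitzWith hP₀ hu)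
    (integrable_of_lipschitzWith (integrable_map_neg hP₀) hu)]
  have h1 := abs_le.1 (hW u hu)
  have h2 := abs_le.1 (hW.map_neg u hu)
  rw [abs_le]
  constructor <;> linarith [h1.1, h1.2, h2.1, h2.2]

theorem IsProj.comp_neg (hP : IsProj P h) : IsProj (P.map fun x => -x) (fun x => h (-x)) := by
  have := hP.comp_affine (e := -1) (by norm_num) 0
  simpa using this

/-- A reflection invariant measure has a reflection invariant maximizer. -/
theorem IsProj.sqrt_mul_neg (hP : IsProj P h) (hs : P.map (fun x => -x) = P) :
    IsProj P (fun x => √(h x * h (-x))) := by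
  have h1 := hP.comp_neg
  rw [hs] at h1
  obtain ⟨h2, -, h3⟩ := hP.adm.sqrt_mul h1.adm
  refine ⟨h2, fun g hg => (hP.le_crit g hg).trans ?_⟩
  rw [h3]
  have h4 := h1.le_crit _ hP.adm
  have h5 : 0 ≤ ∫ x, (√(h x) - √(h (-x))) ^ 2 := integral_nonneg fun x => sq_nonneg _
  linarith

/-- Integrals of even functions do not change under symmetrization, and the mass term is translation
invariant. -/
theorem psiCrit_eq_omegaCrit_symLaw {θ : ℝ} {ψ : ℝ → EReal} (hψ : ψ ∈ SymConcaveClass 0)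
    (P : Measure ℝ) : psiCrit θ ψ P = omegaCrit ψ (symLaw (P.map fun x => x - θ)) := by
  have hs : ∀ x, ψ (-x) = ψ x := fun x => by simpa using (hψ.2 x).symm
  have hm : Measurable ψ := by
    rw [← (exists_eq_logDensity hψ.1).1]
    have := (exists_eq_logDensity hψ.1).2.2.1.measurable
    unfold logDensity
    fun_prop
  have hm1 : Measurable fun x => (ψ x).toENNReal := by fun_prop
  have hm2 : Measurable fun x => (-ψ x).toENNReal := by fun_prop
  unfold psiCrit omegaCrit
  rw [lintegral_symLaw hm1 fun x => by rw [hs], lintegral_symLaw hm2 fun x => by rw [hs],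
    lintegral_map hm1 (by fun_prop), lintegral_map hm2 (by fun_prop),
    lintegral_sub_right_eq_self (fun x => EReal.exp (ψ x)) θ]

/-- The symmetrized measure has an even maximizer among all log-concave functions. Hence the maximum
over even functions equals the unrestricted one, and the symmetry constraint costs nothing. -/
theorem isProj_partialMle {n : ℕ} {x : ℕ → ℝ} {θ : ℝ} (hn : n ≠ 0)
    (H : Spread (symLaw ((empiricalMeasure n x).map fun t => t - θ)) a b δ) :
    IsProj (symLaw ((empiricalMeasure n x).map fun t => t - θ)) (partialMle n x θ) := by
  have := isProbabilityMeasure_empiricalMeasure hn x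
  have : IsProbabilityMeasure ((empiricalMeasure n x).map fun t => t - θ) :=
    Measure.isProbabilityMeasure_map (by fun_prop)
  have := isProbabilityMeasure_symLaw (P := (empiricalMeasure n x).map fun t => t - θ)
  have hi : Integrable (fun t : ℝ => t) ((empiricalMeasure n x).map fun t => t - θ) :=
    (integrable_map_measure aestronglyMeasurable_id (by fun_prop)).2
      (integrable_empiricalMeasure hn x _)
  have hiQ := integrable_symLaw hi (integrable_map_neg hi)
  set Q := symLaw ((empiricalMeasure n x).map fun t => t - θ) with hQ
  obtain ⟨g, hg⟩ := exists_isProj H hiQ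
  have hk := hg.sqrt_mul_neg (symLaw_map_neg _)
  set k : ℝ → ℝ := fun x => √(g x * g (-x)) with hkdef
  have hkl := hk.isLogConcaveProjection H
  have hks : logDensity k ∈ SymConcaveClass 0 := by
    refine ⟨hkl.1, fun x => ?_⟩
    unfold logDensity
    simp only [hkdef, zero_add, zero_sub, neg_neg, mul_comm]
  have hex : ∃ ψ, IsPartialMLE n x θ ψ := by
    refine ⟨logDensity k, hks, fun ψ hψ => ?_⟩
    rw [psiCrit_eq_omegaCrit_symLaw hψ, psiCrit_eq_omegaCrit_symLaw hks]
    exact hkl.2 ψ hψ.1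
  have hspec := Classical.epsilon_spec hex
  refine isProj_expFun H hiQ ⟨hspec.1.1, fun φ hφ => (hkl.2 φ hφ).trans ?_⟩
  have := hspec.2 _ hks
  rwa [psiCrit_eq_omegaCrit_symLaw hspec.1, psiCrit_eq_omegaCrit_symLaw hks] at this

end symmetrization

/-! ### Laws with densities -/

section law

variable {f : ℝ → ℝ}

theorem isProbabilityMeasure_law (hf : f ∈ Densities) : IsProbabilityMeasure (law f) :=
  ⟨by rw [law, withDensity_apply _ MeasurableSet.univ, setLIntegral_univ]; exact hf.2.2⟩

theorem nullSingletonClass_law (f : ℝ → ℝ) : NullSingletonClass (law f) :=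
  ⟨fun _ => withDensity_absolutelyContinuous _ _ Real.volume_singleton⟩

theorem integrable_law_iff (hf : f ∈ Densities) {u : ℝ → ℝ} :
    Integrable u (law f) ↔ Integrable (fun x => u x * f x) := by
  rw [law, integrable_withDensity_iff (by have := hf.1; fun_prop)
    (Eventually.of_forall fun x => ENNReal.ofReal_lt_top)]
  simp only [ENNReal.toReal_ofReal (hf.2.1 _)]

theorem integral_law (hf : f ∈ Densities) (u : ℝ → ℝ) :
    ∫ x, u x ∂(law f) = ∫ x, u x * f x := by
  rw [law, integral_withDensity_eq_integral_toReal_smul (by have := hf.1; fun_prop)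
    (Eventually.of_forall fun x => ENNReal.ofReal_lt_top)]
  simp only [ENNReal.toReal_ofReal (hf.2.1 _), smul_eq_mul, mul_comm]

theorem ae_law_iff (hf : f ∈ Densities) {p : ℝ → Prop} :
    (∀ᵐ x ∂(law f), p x) ↔ ∀ᵐ x, 0 < f x → p x := by
  rw [law, ae_withDensity_iff (by have := hf.1; fun_prop)]
  simp

theorem integrable_of_mem_densities (hf : f ∈ Densities) : Integrable f ∧ ∫ x, f x = 1 := by
  have hi : Integrable f := by
    refine ⟨hf.1.aestronglyMeasurable, ?_⟩
    rw [hasFiniteIntegral_iff_ofReal (Eventually.of_forall hf.2.1), hf.2.2]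
    exact ENNReal.one_lt_top
  refine ⟨hi, ?_⟩
  rw [integral_eq_lintegral_of_nonneg_ae (Eventually.of_forall hf.2.1) hf.1.aestronglyMeasurable,
    hf.2.2, ENNReal.toReal_one]

/-- Without atoms the support cannot be a single point. Half-lines that are neighbourhoods of two of
its points carry positive mass. -/
theorem exists_spread (P : Measure ℝ) [IsProbabilityMeasure P] [NullSingletonClass P] :
    ∃ a b δ, Spread P a b δ := by
  have key : ∃ p q, p < q ∧ p ∈ P.support ∧ q ∈ P.support := by
    by_contra hcon
    push Not at hcon
    have hsub : P.support.Subsingleton := fun p hp q hq => by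
      rcases lt_trichotomy p q with h | h | h
      · exact absurd hq (hcon p q h hp)
      · exact h
      · exact absurd hp (hcon q p h hq)
    have h1 : P P.support = 0 := hsub.measure_zero P
    have h2 : P univ = 0 := by
      rw [← union_compl_self P.support]
      exact measure_union_null h1 Measure.measure_compl_support
    simp at h2
  obtain ⟨p, q, hpq, hp, hq⟩ := key
  rw [Measure.mem_support_iff_forall] at hp hq
  have h1 := hp (Iic (p + (q - p) / 3)) (Iic_mem_nhds (by linarith))
  have h2 := hq (Ici (q - (q - p) / 3)) (Ici_mem_nhds (by linarith))
  refine ⟨p + (q - p) / 3, q - (q - p) / 3, min (P.real (Iic (p + (q - p) / 3)))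
    (P.real (Ici (q - (q - p) / 3))), by linarith, lt_min ?_ ?_, min_le_left _ _, min_le_right _ _⟩
  · exact ENNReal.toReal_pos h1.ne' (measure_ne_top _ _)
  · exact ENNReal.toReal_pos h2.ne' (measure_ne_top _ _)

theorem law_map {f : ℝ → ℝ} (hf : Measurable f) {T S : ℝ → ℝ} (hT : MeasurePreserving T)
    (hS : Measurable S) (hST : ∀ x, S (T x) = x) : (law f).map T = law (fun z => f (S z)) := by
  ext s hs
  rw [Measure.map_apply hT.measurable hs, law, law, withDensity_apply _ (hT.measurable hs),
    withDensity_apply _ hs,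
    ← hT.setLIntegral_comp_preimage hs (f := fun z => ENNReal.ofReal (f (S z))) (by fun_prop)]
  simp only [hST]

theorem law_map_sub (hf : Measurable f) (θ : ℝ) :
    ((law f).map fun x => x - θ) = law (fun z => f (z + θ)) :=
  law_map hf (measurePreserving_sub_right volume θ) (by fun_prop) (by simp)

theorem law_map_neg (hf : Measurable f) :
    ((law f).map fun x => -x) = law (fun z => f (-z)) :=
  law_map hf (Measure.measurePreserving_neg volume) (by fun_prop) (by simp)

theorem mem_densities_add (hf : f ∈ Densities) (θ : ℝ) : (fun z => f (z + θ)) ∈ Densities :=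
  ⟨hf.1.comp (by fun_prop), fun z => hf.2.1 _, by
    rw [lintegral_add_right_eq_self fun x => ENNReal.ofReal (f x)]; exact hf.2.2⟩

/-- The projection is positive on the interior of the set of positivity of the density. -/
theorem interior_subset_of_ae_pos {h : ℝ → ℝ} (hf : f ∈ Densities) (hh : LogConc h)
    (hp : ∀ᵐ x ∂(law f), 0 < h x) : interior {x | 0 < f x} ⊆ interior {x | 0 < h x} := by
  have key : ∀ u v : ℝ, u < v → Ioo u v ⊆ {x | 0 < f x} → ∃ p ∈ Ioo u v, 0 < h p := by
    intro u v huv hsub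
    by_contra hcon
    push Not at hcon
    rw [ae_law_iff hf] at hp
    have hsub' : Ioo u v ⊆ {x | ¬(0 < f x → 0 < h x)} := fun x hx H =>
      absurd (H (hsub hx)) (not_lt.2 (hcon x hx))
    have : volume (Ioo u v) = 0 := measure_mono_null hsub' (ae_iff.1 hp)
    rw [Real.volume_Ioo, ENNReal.ofReal_eq_zero] at this
    linarith
  refine interior_maximal (fun x hx => ?_) isOpen_interior
  obtain ⟨u, v, hxuv, hsub⟩ := mem_nhds_iff_exists_Ioo_subset.1 (mem_interior_iff_mem_nhds.1 hx)
  obtain ⟨p, hp, hp0⟩ := key u x hxuv.1 fun z hz => hsub ⟨hz.1, hz.2.trans hxuv.2⟩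
  obtain ⟨q, hq, hq0⟩ := key x v hxuv.2 fun z hz => hsub ⟨hxuv.1.trans hz.1, hz.2⟩
  exact hh.pos_of_mem hp0 hq0 hp.2.le hq.1.le

/-- Writing `log v = 2 log √v` trades the singularity at zero for `√v`, which still decays
exponentially under an exponential envelope. This gives integrability of `f log f`. -/
theorem abs_mul_log_le {v S : ℝ} (hv : 0 ≤ v) (hvS : v ≤ S) :
    |Real.log v * v| ≤ 2 * √v + 2 * √S * v := by
  rcases hv.eq_or_lt with h | h
  · simp [← h]
  have hs : 0 < √v := Real.sqrt_pos.2 h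
  have hS : √v ≤ √S := Real.sqrt_le_sqrt hvS
  have h1 : Real.log v = 2 * Real.log (√v) := by rw [Real.log_sqrt hv]; ring
  have h2 : Real.log (√v) ≤ √v := (Real.log_le_sub_one_of_pos hs).trans (by linarith)
  have h3 : -Real.log (√v) ≤ (√v)⁻¹ := by
    rw [← Real.log_inv]
    exact (Real.log_le_sub_one_of_pos (inv_pos.2 hs)).trans (by linarith)
  have h4 : (√v)⁻¹ * v = √v := by rw [inv_mul_eq_div, Real.div_sqrt]
  rw [abs_mul, abs_of_pos h, h1, abs_mul, abs_two]
  rcases abs_cases (Real.log (√v)) with ⟨h5, -⟩ | ⟨h5, -⟩ <;> rw [h5]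
  · have : Real.log √v * v ≤ √S * v := by gcongr; exact h2.trans hS
    linarith
  · have : -Real.log √v * v ≤ (√v)⁻¹ * v := by gcongr
    have : 0 ≤ √S * v := by positivity
    linarith

/-! ### Log-concave densities under their own laws. -/

/-- Exponential decay of a log-concave density. -/
theorem exists_envelope_of_mem_logConcaveDensities (hf : f ∈ LogConcaveDensities) :
    ∃ A B : ℝ, 0 < B ∧ 0 < A ∧ ∀ x, f x ≤ A * Real.exp (-(B * |x|)) := by
  obtain ⟨hc, hu, hi, h1⟩ := logConc_of_mem_logConcaveDensities hf
  have := isProbabilityMeasure_law hf.1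
  have := nullSingletonClass_law f
  obtain ⟨a, b, δ, H⟩ := exists_spread (law f)
  obtain ⟨⟨p, hp, hp0⟩, q, hq, hq0⟩ := H.exists_pos (h := f)
    ((ae_law_iff hf.1).2 (Eventually.of_forall fun x hx => hx))
  obtain ⟨A, B, hB, hA, hE⟩ := LogConc.exists_envelope (hp.trans_lt (H.lt.trans_le hq))
    (lt_min hp0 hq0)
  exact ⟨A, B, hB, hA, hE f hc hi h1.le (min_le_left _ _) (min_le_right _ _)⟩

theorem integrable_mul_of_envelope {A B : ℝ} (hB : 0 < B) (hm : Measurable f)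
    (h0 : ∀ x, 0 ≤ f x) (hE : ∀ x, f x ≤ A * Real.exp (-(B * |x|))) {u : ℝ → ℝ}
    (hu : Measurable u) {C : ℝ} (huC : ∀ x, |u x| ≤ C * (1 + |x| + x ^ 2)) :
    Integrable fun x => u x * f x := by
  refine ((integrable_sq_mul_exp_neg_mul_abs hB).const_mul (C * A)).mono'
    (hu.mul hm).aestronglyMeasurable (Eventually.of_forall fun x => ?_)
  rw [Real.norm_eq_abs, abs_mul, abs_of_nonneg (h0 x)]
  calc |u x| * f x ≤ C * (1 + |x| + x ^ 2) * (A * Real.exp (-(B * |x|))) :=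
        mul_le_mul (huC x) (hE x) (h0 x) ((abs_nonneg _).trans (huC x))
    _ = _ := by ring

/-- A log-concave density is its own projection. -/
theorem isProj_law_self (hf : f ∈ LogConcaveDensities) : IsProj (law f) f := by
  obtain ⟨hc, hu, hi, h1⟩ := logConc_of_mem_logConcaveDensities hf
  obtain ⟨A, B, hB, hA, hE⟩ := exists_envelope_of_mem_logConcaveDensities hf
  have hlog : Integrable (fun x => Real.log (f x) * f x) := by
    refine (((integrable_exp_neg_mul_abs (show 0 < B / 2 by positivity)).const_mul (2 * √A)).add
      (hi.const_mul (2 * √A))).mono'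
      ((Real.measurable_log.comp hf.1.1).mul hf.1.1).aestronglyMeasurable
      (Eventually.of_forall fun x => ?_)
    have hA' : f x ≤ A := (hE x).trans (mul_le_of_le_one_right hA.le
      (Real.exp_le_one_iff.2 (neg_nonpos.2 (by positivity))))
    refine (abs_mul_log_le (hc.nonneg x) hA').trans ?_
    have : √(f x) ≤ √A * Real.exp (-(B / 2 * |x|)) := by
      refine (Real.sqrt_le_sqrt (hE x)).trans ?_
      rw [Real.sqrt_mul hA.le, ← Real.exp_half]
      exact le_of_eq (by congr 2; ring)
    simp only [Pi.add_apply]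
    linarith
  refine ⟨⟨hc, hu, (ae_law_iff hf.1).2 (Eventually.of_forall fun x hx => hx),
    (integrable_law_iff hf.1).2 hlog, hi⟩, fun k hk => ?_⟩
  have hkl := (integrable_law_iff hf.1).1 hk.logInt
  unfold crit
  rw [integral_law hf.1, integral_law hf.1]
  -- Gibbs' inequality: `f log (k / f) ≤ k - f` pointwise. Where `f` vanishes the left side is zero
  -- and the right side is `k`.
  have : ∫ x, (Real.log (k x) * f x - Real.log (f x) * f x) ≤ ∫ x, (k x - f x) := by
    refine integral_mono_ae (hkl.sub hlog) (hk.int.sub hi) ?_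
    filter_upwards [(ae_law_iff hf.1).1 hk.pos] with x hx
    rcases (hc.nonneg x).eq_or_lt with h | h
    · simpa [← h] using hk.logConc.nonneg x
    · have h2 := Real.log_le_sub_one_of_pos (div_pos (hx h) h)
      rw [Real.log_div (hx h).ne' h.ne'] at h2
      have h3 := mul_le_mul_of_nonneg_right h2 h.le
      have h4 : (k x / f x - 1) * f x = k x - f x := by field_simp
      linarith
  rw [integral_sub hkl hlog, integral_sub hk.int hi] at this
  linarith

end law

/-! ### Gaussian smoothing -/

/-- The basic composition formula for pairs of functions whose determinants have the same sign. -/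
theorem integral_mul_integral_le {p q r s : ℝ → ℝ} (hpr : Integrable fun u => p u * r u)
    (hqs : Integrable fun u => q u * s u) (hps : Integrable fun u => p u * s u)
    (hqr : Integrable fun u => q u * r u)
    (H : ∀ u v, 0 ≤ (p u * q v - p v * q u) * (r u * s v - r v * s u)) :
    (∫ u, p u * s u) * ∫ u, q u * r u ≤ (∫ u, p u * r u) * ∫ u, q u * s u := by
  have i1 : Integrable (fun z : ℝ × ℝ => p z.1 * r z.1 * (q z.2 * s z.2)) := hpr.mul_prod hqs
  have i2 : Integrable (fun z : ℝ × ℝ => q z.1 * s z.1 * (p z.2 * r z.2)) := hqs.mul_prod hpr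
  have i3 : Integrable (fun z : ℝ × ℝ => p z.1 * s z.1 * (q z.2 * r z.2)) := hps.mul_prod hqr
  have i4 : Integrable (fun z : ℝ × ℝ => q z.1 * r z.1 * (p z.2 * s z.2)) := hqr.mul_prod hps
  have e1 : ∫ z : ℝ × ℝ, p z.1 * r z.1 * (q z.2 * s z.2) = _ :=
    integral_prod_mul (fun u => p u * r u) (fun u => q u * s u)
  have e2 : ∫ z : ℝ × ℝ, q z.1 * s z.1 * (p z.2 * r z.2) = _ :=
    integral_prod_mul (fun u => q u * s u) (fun u => p u * r u)
  have e3 : ∫ z : ℝ × ℝ, p z.1 * s z.1 * (q z.2 * r z.2) = _ :=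
    integral_prod_mul (fun u => p u * s u) (fun u => q u * r u)
  have e4 : ∫ z : ℝ × ℝ, q z.1 * r z.1 * (p z.2 * s z.2) = _ :=
    integral_prod_mul (fun u => q u * r u) (fun u => p u * s u)
  have h1 : ∫ z : ℝ × ℝ, (p z.1 * s z.1 * (q z.2 * r z.2) + q z.1 * r z.1 * (p z.2 * s z.2)) ≤
      ∫ z : ℝ × ℝ, (p z.1 * r z.1 * (q z.2 * s z.2) + q z.1 * s z.1 * (p z.2 * r z.2)) := by
    refine integral_mono (i3.add i4) (i1.add i2) fun z => ?_
    have := H z.1 z.2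
    simp only
    linarith
  rw [integral_add i3 i4, integral_add i1 i2, e1, e2, e3, e4] at h1
  linarith [mul_comm (∫ u, p u * s u) (∫ u, q u * r u),
    mul_comm (∫ u, p u * r u) (∫ u, q u * s u)]

/-- A minimum principle. At the leftmost point where a negative minimum is attained, a symmetric
pair of neighbours has one value strictly larger and the other at least as large, against midpoint
concavity. -/
theorem le_of_midpoint_le {g : ℝ → ℝ} (hg : Continuous g) {x y : ℝ} (hxy : x ≤ y)
    (hx : 0 ≤ g x) (hy : 0 ≤ g y)
    (H : ∀ m d, 0 ≤ d → g (m - d) + g (m + d) ≤ 2 * g m) {z : ℝ} (hz : z ∈ Icc x y) : 0 ≤ g z := by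
  obtain ⟨w, hw, hwm⟩ := isCompact_Icc.exists_isMinOn (nonempty_Icc.2 hxy) hg.continuousOn
  by_contra hcon
  have hw0 : g w < 0 := (hwm hz).trans_lt (not_le.1 hcon)
  set K := Icc x y ∩ {t | g t ≤ g w} with hK
  have hKc : IsCompact K := isCompact_Icc.inter_right (isClosed_le hg continuous_const)
  obtain ⟨m, hm, hml⟩ := hKc.exists_isLeast ⟨w, hw, show g w ≤ g w from le_rfl⟩
  have hgm : g m ≤ g w := hm.2
  have hxm : x < m := lt_of_le_of_ne hm.1.1 fun e => by rw [← e] at hgm; linarith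
  have hmy : m < y := lt_of_le_of_ne hm.1.2 fun e => by rw [e] at hgm; linarith
  set d := min (m - x) (y - m) with hd
  have hd0 : 0 < d := lt_min (by linarith) (by linarith)
  have h1 : m - d ∈ Icc x y := ⟨by linarith [min_le_left (m - x) (y - m)], by linarith⟩
  have h2 : m + d ∈ Icc x y := ⟨by linarith, by linarith [min_le_right (m - x) (y - m)]⟩
  have h3 : g w < g (m - d) := by
    by_contra h4
    have := hml ⟨h1, not_lt.1 h4⟩
    linarith
  have h4 : g w ≤ g (m + d) := hwm h2
  linarith [H m d hd0.le]

/-- Midpoint concavity plus continuity gives concavity: the minimum principle is applied to `log S`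
minus its chord. -/
theorem logConc_of_mul_le_sq {S : ℝ → ℝ} (h0 : ∀ x, 0 < S x) (hc : Continuous S)
    (H : ∀ m d, 0 ≤ d → S (m - d) * S (m + d) ≤ S m * S m) : LogConc S := by
  refine ⟨fun x => (h0 x).le, ?_⟩
  have hu : {x | 0 < S x} = univ := eq_univ_of_forall h0
  rw [hu]
  have hlc : Continuous fun x => Real.log (S x) := hc.log fun x => (h0 x).ne'
  have key : ∀ x y a b : ℝ, x ≤ y → 0 ≤ a → 0 ≤ b → a + b = 1 →
      a * Real.log (S x) + b * Real.log (S y) ≤ Real.log (S (a * x + b * y)) := by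
    intro x y a b hxy ha hb hab
    rcases hxy.eq_or_lt with rfl | hxy'
    · rw [← add_mul, ← add_mul, hab, one_mul, one_mul]
    have hyx : 0 < y - x := sub_pos.2 hxy'
    set g : ℝ → ℝ := fun t => Real.log (S t) -
      (Real.log (S x) + (t - x) / (y - x) * (Real.log (S y) - Real.log (S x))) with hgdef
    have hz : a * x + b * y ∈ Icc x y := by
      have e : a = 1 - b := by linarith
      constructor <;> rw [e] <;> nlinarith
    have := le_of_midpoint_le (g := g) (by fun_prop) hxy (by simp [hgdef])
      (by simp only [hgdef]; rw [div_self hyx.ne']; linarith) (fun m d hd => ?_) hz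
    · simp only [hgdef] at this
      have e : (a * x + b * y - x) / (y - x) = b := by
        rw [div_eq_iff hyx.ne']; linear_combination x * hab
      rw [e] at this
      have e2 : a = 1 - b := by linarith
      rw [e2] at this ⊢
      linarith
    · have h1 := Real.log_le_log (mul_pos (h0 _) (h0 _)) (H m d hd)
      rw [Real.log_mul (h0 _).ne' (h0 _).ne', Real.log_mul (h0 _).ne' (h0 _).ne'] at h1
      simp only [hgdef]
      have e : (m - d - x) / (y - x) + (m + d - x) / (y - x) = 2 * ((m - x) / (y - x)) := by ring
      have e' : ∀ c : ℝ, (m - d - x) / (y - x) * c + (m + d - x) / (y - x) * c =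
          2 * ((m - x) / (y - x) * c) := fun c => by rw [← add_mul, e, mul_assoc]
      linarith [e' (Real.log (S y) - Real.log (S x))]
  refine ⟨convex_univ, fun x _ y _ a b ha hb hab => ?_⟩
  simp only [smul_eq_mul]
  rcases le_total x y with h | h
  · exact key x y a b h ha hb hab
  · have := key y x b a h hb ha (by rw [add_comm, hab])
    rwa [add_comm, add_comm (a * x)]

theorem logConc_exp_neg_sq {ε : ℝ} (hε : 0 ≤ ε) (c : ℝ) :
    LogConc fun x => Real.exp (-(ε * (x - c) ^ 2)) := by
  refine logConc_iff.2 ⟨fun x => (Real.exp_pos _).le, fun x y r s a b ha hb hab hx hy => ?_⟩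
  rw [Real.exp_le_exp] at hx hy ⊢
  have e : a * x + b * y - c = a * (x - c) + b * (y - c) := by linear_combination c * hab
  have h1 : (a * (x - c) + b * (y - c)) ^ 2 ≤ a * (x - c) ^ 2 + b * (y - c) ^ 2 := by
    have : b = 1 - a := by linarith
    rw [this]
    nlinarith [mul_nonneg (mul_nonneg ha (this ▸ hb)) (sq_nonneg ((x - c) - (y - c)))]
  rw [e]
  nlinarith [mul_le_mul_of_nonneg_left h1 hε, mul_le_mul_of_nonneg_left hx ha,
    mul_le_mul_of_nonneg_left hy hb]

/-- The average of `f (x - b * Z)` over a standard normal variable `Z`. -/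
noncomputable def gaussAvg (b : ℝ) (f : ℝ → ℝ) (x : ℝ) : ℝ :=
  ∫ z, f (x - b * z) ∂(gaussianReal 0 1)

/-- The normal density with standard deviation `b`. -/
noncomputable def gaussKernel (b t : ℝ) : ℝ := b⁻¹ * gaussianPDFReal 0 1 (t / b)

section gaussAvg

variable {b : ℝ} {f : ℝ → ℝ}

theorem gaussKernel_eq (b t : ℝ) : gaussKernel b t =
    b⁻¹ * (√(2 * Real.pi))⁻¹ * Real.exp (-((2 * b ^ 2)⁻¹ * (t - 0) ^ 2)) := by
  unfold gaussKernel gaussianPDFReal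
  rw [NNReal.coe_one, mul_one, mul_one, ← mul_assoc]
  congr 2
  simp only [sub_zero, mul_inv, div_eq_mul_inv]
  ring

theorem logConc_gaussKernel (hb : 0 < b) : LogConc (gaussKernel b) := by
  rw [show gaussKernel b = _ from funext (gaussKernel_eq b)]
  exact (logConc_exp_neg_sq (by positivity) 0).const_mul (by positivity)

theorem gaussKernel_pos (hb : 0 < b) (t : ℝ) : 0 < gaussKernel b t := by
  rw [gaussKernel_eq]; positivity

theorem gaussKernel_le (hb : 0 < b) (t : ℝ) : gaussKernel b t ≤ b⁻¹ * (√(2 * Real.pi))⁻¹ := by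
  rw [gaussKernel_eq]
  refine mul_le_of_le_one_right (by positivity) (Real.exp_le_one_iff.2 ?_)
  have : 0 ≤ (2 * b ^ 2)⁻¹ * (t - 0) ^ 2 := by positivity
  linarith

theorem continuous_gaussKernel (b : ℝ) : Continuous (gaussKernel b) := by
  rw [show gaussKernel b = _ from funext (gaussKernel_eq b)]
  fun_prop

theorem gaussAvg_eq_integral (hb : 0 < b) (f : ℝ → ℝ) (x : ℝ) :
    gaussAvg b f x = ∫ t, gaussKernel b t * f (x - t) := by
  unfold gaussAvg gaussKernel
  rw [integral_gaussianReal_eq_integral_smul one_ne_zero]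
  have h := Measure.integral_comp_mul_left
    (fun t => b⁻¹ * gaussianPDFReal 0 1 (t / b) * f (x - t)) b
  rw [abs_of_pos (inv_pos.2 hb)] at h
  simp only [mul_div_cancel_left₀ _ hb.ne', mul_assoc, integral_const_mul, smul_eq_mul] at h ⊢
  exact mul_left_cancel₀ (inv_pos.2 hb).ne' h

theorem gaussAvg_sub (hb : 0 < b) (f : ℝ → ℝ) (x y : ℝ) :
    gaussAvg b f (x - y) = ∫ u, gaussKernel b (x - u) * f (u - y) := by
  rw [gaussAvg_eq_integral hb,
    ← integral_sub_left_eq_self (fun t => gaussKernel b t * f (x - y - t)) volume x]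
  exact integral_congr_ae (Eventually.of_forall fun u => by ring_nf)

theorem gaussSmooth_eq_gaussAvg (hb : 0 < b) (f : ℝ → ℝ) : gaussSmooth b f = gaussAvg b f := by
  funext x
  rw [gaussAvg_eq_integral hb, gaussSmooth, ← integral_const_mul]
  refine integral_congr_ae (Eventually.of_forall fun t => ?_)
  simp only [gaussKernel, one_div]
  ring

/-- Averaging over a standard normal variable makes sense for bandwidth zero, where the kernel
formula divides by zero. Zero is the limiting bandwidth when the true density is log-concave. -/
theorem gaussAvg_zero (f : ℝ → ℝ) : gaussAvg 0 f = f := by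
  funext x
  simp [gaussAvg]

theorem integrable_gaussKernel_mul (hb : 0 < b) (hi : Integrable f) (x y : ℝ) :
    Integrable fun u => gaussKernel b (x - u) * f (u - y) :=
  (hi.comp_sub_right y).bdd_mul (c := b⁻¹ * (√(2 * Real.pi))⁻¹)
    ((continuous_gaussKernel b).comp (by fun_prop)).aestronglyMeasurable
    (Eventually.of_forall fun u => by
      rw [Real.norm_eq_abs, abs_of_pos (gaussKernel_pos hb _)]; exact gaussKernel_le hb _)

theorem gaussAvg_pos (hb : 0 < b) (hi : Integrable f) (h0 : ∀ x, 0 ≤ f x) (hf : 0 < ∫ x, f x)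
    (x : ℝ) : 0 < gaussAvg b f x := by
  have h1 := gaussAvg_sub hb f x 0
  have h2 := integrable_gaussKernel_mul hb hi x 0
  simp only [sub_zero] at h1 h2
  rw [h1, integral_pos_iff_support_of_nonneg
    (fun u => mul_nonneg (gaussKernel_pos hb _).le (h0 u)) h2]
  rw [integral_pos_iff_support_of_nonneg h0 hi] at hf
  refine hf.trans_le (measure_mono fun u hu => ?_)
  exact mul_ne_zero (gaussKernel_pos hb _).ne' hu

theorem continuous_gaussAvg (hb : 0 < b) (hi : Integrable f) : Continuous (gaussAvg b f) := by
  have e : gaussAvg b f = fun x => ∫ u, gaussKernel b (x - u) * f u := by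
    funext x
    simpa using gaussAvg_sub hb f x 0
  rw [e]
  refine continuous_of_dominated (bound := fun u => b⁻¹ * (√(2 * Real.pi))⁻¹ * ‖f u‖)
    (fun x => ?_) (fun x => Eventually.of_forall fun u => ?_) (hi.norm.const_mul _)
    (Eventually.of_forall fun u => ?_)
  · simpa using (integrable_gaussKernel_mul hb hi x 0).aestronglyMeasurable
  · rw [norm_mul, Real.norm_eq_abs, abs_of_pos (gaussKernel_pos hb _)]
    exact mul_le_mul_of_nonneg_right (gaussKernel_le hb _) (norm_nonneg _)
  · exact ((continuous_gaussKernel b).comp (by fun_prop)).mul continuous_const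

/-- The normal kernel and `f` are both totally positive of order two as functions of differences,
and the composition formula transfers this to the convolution. Applied to the rows `m`, `m + d` and
the columns `0`, `d`, it reads `S (m - d) S (m + d) ≤ S m ^ 2`. -/
theorem LogConc.gaussAvg (hf : LogConc f) (hi : Integrable f) (h0 : 0 < ∫ x, f x) (hb : 0 ≤ b) :
    LogConc (gaussAvg b f) := by
  rcases hb.eq_or_lt with rfl | hb
  · rwa [gaussAvg_zero]
  refine logConc_of_mul_le_sq (gaussAvg_pos hb hi hf.nonneg h0) (continuous_gaussAvg hb hi)
    fun m d hd => ?_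
  have e0 := gaussAvg_sub hb f m 0
  have e1 := gaussAvg_sub hb f (m + d) d
  have e2 := gaussAvg_sub hb f m d
  have e3 := gaussAvg_sub hb f (m + d) 0
  have hk := logConc_gaussKernel hb
  have key := integral_mul_integral_le (p := fun u => gaussKernel b (m - u))
    (q := fun u => gaussKernel b (m + d - u)) (r := fun u => f (u - 0)) (s := fun u => f (u - d))
    (integrable_gaussKernel_mul hb hi m 0) (integrable_gaussKernel_mul hb hi (m + d) d)
    (integrable_gaussKernel_mul hb hi m d) (integrable_gaussKernel_mul hb hi (m + d) 0)
    (fun u v => ?_)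
  · rw [← e0, ← e1, ← e2, ← e3, sub_zero, sub_zero, add_sub_cancel_right] at key
    exact key
  · rcases le_total u v with h | h
    · refine mul_nonneg (sub_nonneg.2 ?_) (sub_nonneg.2 ?_)
      · exact hk.mul_le_mul_of_add_eq (by linarith) (by linarith) (by ring)
      · have := hf.mul_le_mul_of_add_eq (a := u - d) (b := u - 0) (c := v - 0) (d := v - d)
          (by linarith) (by linarith) (by ring)
        linarith
    · refine mul_nonneg_of_nonpos_of_nonpos (sub_nonpos.2 ?_) (sub_nonpos.2 ?_)
      · exact hk.mul_le_mul_of_add_eq (by linarith) (by linarith) (by ring)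
      · have := hf.mul_le_mul_of_add_eq (a := v - d) (b := v - 0) (c := u - 0) (d := u - d)
          (by linarith) (by linarith) (by ring)
        linarith

theorem frontier_preimage_null {q : ℝ → ℝ} (hq : LogConc q) (hb : b ≠ 0) (x : ℝ) :
    ∀ᵐ z ∂(gaussianReal 0 1), x - b * z ∉ frontier {x | 0 < q x} := by
  have h0 : volume (frontier {x | 0 < q x}) = 0 := hq.concaveOn.1.addHaar_frontier volume
  have hq1 : Measure.QuasiMeasurePreserving (fun z : ℝ => x - b * z) volume volume := by
    have h1 : Measure.QuasiMeasurePreserving (fun z : ℝ => b * z) volume volume := by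
      refine ⟨by fun_prop, ?_⟩
      rw [Real.map_volume_mul_left hb]
      exact Measure.smul_absolutelyContinuous
    exact (Measure.measurePreserving_sub_left volume x).quasiMeasurePreserving.comp h1
  exact (gaussianReal_absolutelyContinuous 0 one_ne_zero).ae_le (hq1.ae (compl_mem_ae_iff.2 h0))

/-- Gaussian averages converge if the bandwidths and the functions do. -/
theorem tendsto_gaussAvg {ι : Type*} {l : Filter ι} [l.IsCountablyGenerated] {k : ι → ℝ → ℝ}
    {q : ℝ → ℝ} {β : ι → ℝ} (hq : LogConc q) (hm : ∀ᶠ i in l, Measurable (k i)) {A : ℝ}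
    (hA : ∀ᶠ i in l, ∀ x, |k i x| ≤ A)
    (hk : ∀ x ∉ frontier {x | 0 < q x}, Tendsto (fun p : ι × ℝ => k p.1 p.2) (l ×ˢ 𝓝 x) (𝓝 (q x)))
    (hβ : Tendsto β l (𝓝 b)) {x : ℝ} (hx : b = 0 → x ∈ interior {x | 0 < q x}) :
    Tendsto (fun i => gaussAvg (β i) (k i) x) l (𝓝 (gaussAvg b q x)) := by
  refine tendsto_integral_filter_of_dominated_convergence (fun _ => A) ?_ ?_ (integrable_const _) ?_
  · filter_upwards [hm] with i hi
    exact (hi.comp (by fun_prop)).aestronglyMeasurable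
  · filter_upwards [hA] with i hi
    exact Eventually.of_forall fun z => hi _
  · have hae : ∀ᵐ z ∂(gaussianReal 0 1), x - b * z ∉ frontier {x | 0 < q x} := by
      by_cases hb : b = 0
      · refine Eventually.of_forall fun z hz => ?_
        rw [hb, zero_mul, sub_zero] at hz
        exact hz.2 (hx hb)
      · exact frontier_preimage_null hq hb x
    filter_upwards [hae] with z hz
    have h1 : Tendsto (fun i => (i, x - β i * z)) l (l ×ˢ 𝓝 (x - b * z)) :=
      tendsto_id.prodMk ((hβ.mul_const z).const_sub x)
    exact (hk _ hz).comp h1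

end gaussAvg

/-! ### Second moments of the maximizers -/

section moments

variable {P : Measure ℝ} {h : ℝ → ℝ} {a b δ : ℝ}

theorem Adm.exists_envelope (H : Spread P a b δ) (hA : Adm P h) (h1 : ∫ x, h x ≤ 1) :
    ∃ A B : ℝ, 0 < B ∧ 0 < A ∧ ∀ x, h x ≤ A * Real.exp (-(B * |x|)) := by
  obtain ⟨⟨p, hp, hp0⟩, q, hq, hq0⟩ := H.exists_pos hA.pos
  obtain ⟨A, B, hB, hA', hE⟩ := LogConc.exists_envelope (hp.trans_lt (H.lt.trans_le hq))
    (lt_min hp0 hq0)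
  exact ⟨A, B, hB, hA', hE h hA.logConc hA.int h1 (min_le_left _ _) (min_le_right _ _)⟩

theorem abs_sq_sub_le (c x : ℝ) : |(x - c) ^ 2| ≤ (2 + 2 * c ^ 2) * (1 + |x| + x ^ 2) := by
  rw [abs_of_nonneg (sq_nonneg _)]
  nlinarith [sq_nonneg (x + c), abs_nonneg x, sq_nonneg c, mul_nonneg (sq_nonneg c) (abs_nonneg x),
    mul_nonneg (sq_nonneg c) (sq_nonneg x)]

theorem upperSemicontinuous_mul_of_continuous {w : ℝ → ℝ} (hu : UpperSemicontinuous h)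
    (hw : Continuous w) (hw0 : ∀ x, 0 < w x) : UpperSemicontinuous fun x => h x * w x := by
  intro x v hv
  have h1 : h x < v / w x := (lt_div_iff₀ (hw0 x)).2 hv
  obtain ⟨c, hc1, hc2⟩ := exists_between h1
  rw [lt_div_iff₀ (hw0 x)] at hc2
  filter_upwards [hu x c hc1, (hw.const_mul c).continuousAt.eventually_lt_const hc2] with z hz1 hz2
  exact (mul_le_mul_of_nonneg_right hz1.le (hw0 z).le).trans_lt hz2

/-- Second moments of the maximizer do not exceed those of the measure. -/
theorem IsProj.integral_sq_sub_le [IsProbabilityMeasure P] (H : Spread P a b δ) (hP : IsProj P h)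
    (c : ℝ) (h2 : Integrable (fun x => (x - c) ^ 2) P) :
    ∫ x, (x - c) ^ 2 * h x ≤ ∫ x, (x - c) ^ 2 ∂P := by
  have h1 := hP.integral_eq_one H
  have hA := hP.adm
  obtain ⟨A, B, hB, -, hE⟩ := hA.exists_envelope H h1.le
  have hi2 : Integrable fun x => (x - c) ^ 2 * h x :=
    integrable_mul_of_envelope hB hA.usc.measurable hA.logConc.nonneg hE (by fun_prop)
      (abs_sq_sub_le c)
  -- The competitor `h exp (-ε (x - c)²)` is log-concave for `ε > 0` only, hence the one-sided
  -- conclusion. Comparing criteria gives `∫ h (1 - exp (-t)) ≤ ε ∫ (x - c)² dP` with `t = ε (x -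
  -- c)²`, and `1 - exp (-t) ≥ t / (1 + t)` leaves an integrand that converges as `ε → 0`.
  have key : ∀ ε : ℝ, 0 < ε →
      ∫ x, (x - c) ^ 2 / (1 + ε * (x - c) ^ 2) * h x ≤ ∫ x, (x - c) ^ 2 ∂P := by
    intro ε hε
    have hw : Continuous fun x : ℝ => Real.exp (-(ε * (x - c) ^ 2)) := by fun_prop
    have e : (fun x => Real.log (h x * Real.exp (-(ε * (x - c) ^ 2)))) =ᵐ[P]
        fun x => Real.log (h x) - ε * (x - c) ^ 2 := by
      filter_upwards [hA.pos] with x hx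
      rw [Real.log_mul hx.ne' (Real.exp_pos _).ne', Real.log_exp]; ring
    have hki : Integrable fun x => h x * Real.exp (-(ε * (x - c) ^ 2)) := by
      refine hA.int.mul_bdd (c := 1) hw.aestronglyMeasurable
        (Eventually.of_forall fun x => ?_)
      rw [Real.norm_eq_abs, abs_of_pos (Real.exp_pos _), Real.exp_le_one_iff, neg_nonpos]
      positivity
    have hk : Adm P fun x => h x * Real.exp (-(ε * (x - c) ^ 2)) := by
      refine ⟨hA.logConc.mul (logConc_exp_neg_sq hε.le c),
        upperSemicontinuous_mul_of_continuous hA.usc hw fun x => Real.exp_pos _, ?_,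
        (hA.logInt.sub (h2.const_mul ε)).congr e.symm, hki⟩
      filter_upwards [hA.pos] with x hx using mul_pos hx (Real.exp_pos _)
    have h3 := hP.le_crit _ hk
    unfold crit at h3
    rw [integral_congr_ae e, integral_sub hA.logInt (h2.const_mul ε), integral_const_mul] at h3
    have hle : ∀ x, ε * ((x - c) ^ 2 / (1 + ε * (x - c) ^ 2) * h x) ≤
        h x - h x * Real.exp (-(ε * (x - c) ^ 2)) := by
      intro x
      set t := ε * (x - c) ^ 2 with ht
      have ht0 : 0 ≤ t := by positivity
      have h5 : Real.exp (-t) ≤ (1 + t)⁻¹ := by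
        rw [Real.exp_neg]
        exact inv_anti₀ (by positivity) (by linarith [Real.add_one_le_exp t])
      have h6 : ε * ((x - c) ^ 2 / (1 + t) * h x) = h x * (1 - (1 + t)⁻¹) := by
        have : 1 - (1 + t)⁻¹ = t / (1 + t) := by field_simp; ring
        rw [this, ht]; ring
      rw [h6]
      nlinarith [hA.logConc.nonneg x]
    have hm := hA.usc.measurable
    have h4 : Integrable fun x => ε * ((x - c) ^ 2 / (1 + ε * (x - c) ^ 2) * h x) := by
      refine (hA.int.sub hki).mono' (by fun_prop) (Eventually.of_forall fun x => ?_)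
      have h0 := hA.logConc.nonneg x
      rw [Real.norm_eq_abs, abs_of_nonneg (by positivity)]
      exact hle x
    have h5 := integral_mono h4 (hA.int.sub hki) hle
    have h6 : ∫ x, (h x - h x * Real.exp (-(ε * (x - c) ^ 2))) =
        (∫ x, h x) - ∫ x, h x * Real.exp (-(ε * (x - c) ^ 2)) := integral_sub hA.int hki
    rw [integral_const_mul] at h5
    refine le_of_mul_le_mul_left (a := ε) ?_ hε
    refine h5.trans (h6.le.trans ?_)
    linarith
  have hlim : Tendsto (fun ε : ℝ => ∫ x, (x - c) ^ 2 / (1 + ε * (x - c) ^ 2) * h x) (𝓝[>] 0)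
      (𝓝 (∫ x, (x - c) ^ 2 * h x)) := by
    have hm := hA.usc.measurable
    refine tendsto_integral_filter_of_dominated_convergence (fun x => (x - c) ^ 2 * h x)
      (Eventually.of_forall fun ε => by fun_prop) ?_ hi2 (Eventually.of_forall fun x => ?_)
    · filter_upwards [self_mem_nhdsWithin] with ε hε
      have hε : 0 < ε := hε
      refine Eventually.of_forall fun x => ?_
      have h0 := hA.logConc.nonneg x
      rw [Real.norm_eq_abs, abs_of_nonneg (by positivity)]
      refine mul_le_mul_of_nonneg_right (div_le_self (sq_nonneg _) ?_) h0
      have : 0 ≤ ε * (x - c) ^ 2 := by positivity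
      linarith
    · have : ContinuousAt (fun ε : ℝ => (x - c) ^ 2 / (1 + ε * (x - c) ^ 2) * h x) 0 := by
        refine ContinuousAt.mul (ContinuousAt.div (by fun_prop) (by fun_prop) (by simp))
          continuousAt_const
      have h3 := this.tendsto.mono_left (nhdsWithin_le_nhds (s := Ioi 0))
      simpa using h3
  refine le_of_tendsto hlim ?_
  filter_upwards [self_mem_nhdsWithin] with ε hε using key ε hε

theorem integral_sq_sub_eq {A B : ℝ} (hB : 0 < B) (hm : Measurable h) (h0 : ∀ x, 0 ≤ h x)
    (hE : ∀ x, h x ≤ A * Real.exp (-(B * |x|))) (h1 : ∫ x, h x = 1) (hi : Integrable h) (c : ℝ) :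
    ∫ x, (x - c) ^ 2 * h x = (∫ x, x ^ 2 * h x) - 2 * c * (∫ x, x * h x) + c ^ 2 := by
  have i2 : Integrable fun x => x ^ 2 * h x := by
    simpa using integrable_mul_of_envelope hB hm h0 hE (by fun_prop) (abs_sq_sub_le 0)
  have i1 : Integrable fun x => x * h x :=
    integrable_mul_of_envelope hB hm h0 hE (u := fun x => x) (by fun_prop) (C := 1) fun x => by
      nlinarith [sq_nonneg x]
  have e : ∀ x, (x - c) ^ 2 * h x = x ^ 2 * h x - 2 * c * (x * h x) + c ^ 2 * h x :=
    fun x => by ring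
  have i3 : Integrable fun x => x ^ 2 * h x - 2 * c * (x * h x) := i2.sub (i1.const_mul _)
  simp only [e]
  rw [integral_add i3 (hi.const_mul _), integral_sub i2 (i1.const_mul _),
    integral_const_mul, integral_const_mul, h1, mul_one]

/-- The variance of the maximum likelihood estimator is less than the sample variance. -/
theorem mleVariance_lt_sampleVariance {n : ℕ} {x : ℕ → ℝ} (hn : n ≠ 0)
    (H : Spread (empiricalMeasure n x) a b δ) : mleVariance n x < sampleVariance n x := by
  have := isProbabilityMeasure_empiricalMeasure hn x
  have hP := isProj_mle hn H
  have h1 := hP.integral_eq_one H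
  have hA := hP.adm
  obtain ⟨A, B, hB, -, hE⟩ := hA.exists_envelope H h1.le
  have h2 := hP.integral_sq_sub_le H (sampleMean n x) (integrable_empiricalMeasure hn x _)
  rw [integral_sq_sub_eq hB hA.usc.measurable hA.logConc.nonneg hE h1 hA.int,
    integral_empiricalMeasure] at h2
  set V := ∑ i ∈ Finset.range n, (x i - sampleMean n x) ^ 2 with hV
  have hex : ∀ s : Set ℝ, 0 < (empiricalMeasure n x).real s → ∃ i < n, x i ∈ s := by
    intro s hs
    by_contra hcon
    push Not at hcon
    have h3 : ∀ᵐ t ∂(empiricalMeasure n x), t ∉ s := ae_empiricalMeasure_iff.2 hcon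
    have h4 : empiricalMeasure n x s = 0 := by
      have := ae_iff.1 h3
      simpa using this
    rw [measureReal_def, h4] at hs
    simp at hs
  obtain ⟨i, hi, hia⟩ := hex _ (H.pos.trans_le H.left)
  obtain ⟨j, hj, hjb⟩ := hex _ (H.pos.trans_le H.right)
  have hij : x i < x j := (show x i ≤ a from hia).trans_lt (H.lt.trans_le hjb)
  have hV0 : 0 < V := by
    have hne : ∃ k < n, x k ≠ sampleMean n x := by
      by_contra hcon
      push Not at hcon
      rw [hcon i hi, hcon j hj] at hij
      exact lt_irrefl _ hij
    obtain ⟨k, hk, hk0⟩ := hne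
    exact Finset.sum_pos' (fun _ _ => sq_nonneg _)
      ⟨k, Finset.mem_range.2 hk, by have := sub_ne_zero.2 hk0; positivity⟩
  have hn2 : (1 : ℝ) < n := by
    have : i ≠ j := fun e => by rw [e] at hij; exact lt_irrefl _ hij
    have : 1 < n := by omega
    exact_mod_cast this
  -- The moment comparison gives a weak inequality with divisor `n`. Strictness, and so a positive
  -- bandwidth, comes from the divisor `n - 1` and from two distinct observations.
  have h5 : (n : ℝ)⁻¹ * V < 1 / ((n : ℝ) - 1) * V := by
    refine mul_lt_mul_of_pos_right ?_ hV0
    rw [one_div]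
    exact inv_strictAnti₀ (by linarith) (by linarith)
  unfold mleVariance sampleVariance
  rw [← hV]
  nlinarith [sq_nonneg ((∫ z, z * mle n x z) - sampleMean n x)]

theorem sampleVariance_eq {n : ℕ} (hn : n ≠ 0) (x : ℕ → ℝ) : sampleVariance n x =
    n / ((n : ℝ) - 1) * (∫ t, t ^ 2 ∂(empiricalMeasure n x) - (∫ t, t ∂(empiricalMeasure n x)) ^ 2) := by
  have hn0 : (n : ℝ) ≠ 0 := by exact_mod_cast hn
  have hmean : (n : ℝ)⁻¹ * ∑ i ∈ Finset.range n, x i = sampleMean n x := by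
    rw [sampleMean]; field_simp
  rw [integral_empiricalMeasure, integral_empiricalMeasure, hmean, sampleVariance]
  have hs : ∑ i ∈ Finset.range n, x i = n * sampleMean n x := by
    rw [sampleMean]; field_simp
  have e : ∑ i ∈ Finset.range n, (x i - sampleMean n x) ^ 2 =
      ∑ i ∈ Finset.range n, x i ^ 2 - n * sampleMean n x ^ 2 := by
    simp only [sub_sq, Finset.sum_add_distrib, Finset.sum_sub_distrib, ← Finset.sum_mul,
      ← Finset.mul_sum, hs, Finset.sum_const, Finset.card_range, nsmul_eq_mul]
    ring
  rw [e]
  field_simp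

theorem integral_mul_of_ae_symm {g : ℝ → ℝ} {θ : ℝ} (hi : Integrable g)
    (hi1 : Integrable fun x => x * g x) (hs : g =ᵐ[volume] fun x => g (2 * θ - x)) :
    ∫ x, x * g x = θ * ∫ x, g x := by
  have h1 := integral_sub_left_eq_self (fun x => x * g x) volume (2 * θ)
  have h2 : ∫ x, (2 * θ - x) * g (2 * θ - x) = ∫ x, (2 * θ * g x - x * g x) := by
    refine integral_congr_ae ?_
    filter_upwards [hs] with x hx
    rw [← hx]; ring
  rw [h2, integral_sub (hi.const_mul _) hi1, integral_const_mul] at h1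
  linarith

end moments

/-! ### Consistency along a filter of samples -/

/-- `g i` is eventually the mean of two log-concave functions that converge to `q`. -/
def MeanTendsto {ι : Type*} (l : Filter ι) (g : ι → ℝ → ℝ) (q : ℝ → ℝ) : Prop :=
  ∃ h₁ h₂ : ι → ℝ → ℝ, (∀ᶠ i in l, LogConc (h₁ i)) ∧ (∀ᶠ i in l, LogConc (h₂ i)) ∧
    (∀ x ∈ interior {x | 0 < q x}, Tendsto (fun i => h₁ i x) l (𝓝 (q x))) ∧
    (∀ x ∈ interior {x | 0 < q x}, Tendsto (fun i => h₂ i x) l (𝓝 (q x))) ∧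
    ∀ᶠ i in l, ∀ x, g i x = (1 / 2) * (h₁ i x + h₂ i x)

theorem meanTendsto_of_logConc {ι : Type*} {l : Filter ι} {g : ι → ℝ → ℝ} {q : ℝ → ℝ}
    (hg : ∀ᶠ i in l, LogConc (g i))
    (hc : ∀ x ∈ interior {x | 0 < q x}, Tendsto (fun i => g i x) l (𝓝 (q x))) :
    MeanTendsto l g q :=
  ⟨g, g, hg, hg, hc, hc, Eventually.of_forall fun i x => by ring⟩

theorem MeanTendsto.congr {ι : Type*} {l : Filter ι} {g g' : ι → ℝ → ℝ} {q : ℝ → ℝ}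
    (H : MeanTendsto l g q) (hg : ∀ᶠ i in l, g' i = g i) : MeanTendsto l g' q := by
  obtain ⟨h₁, h₂, a1, a2, a3, a4, a5⟩ := H
  refine ⟨h₁, h₂, a1, a2, a3, a4, ?_⟩
  filter_upwards [a5, hg] with i h5 hi
  rwa [hi]

section tendsto

variable {ι : Type*} {l : Filter ι} {P : ι → Measure ℝ} {P₀ : Measure ℝ}

theorem Spread.eventually [IsProbabilityMeasure P₀] {a b δ : ℝ} (H : Spread P₀ a b δ)
    (hP : ∀ᶠ i in l, IsProbabilityMeasure (P i)) (hW : W1Tendsto P l P₀) :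
    ∃ a' b' δ', ∀ᶠ i in l, Spread (P i) a' b' δ' := by
  have hab := H.lt
  have hδ := H.pos
  set t := (b - a) / 4 with ht
  have ht0 : 0 < t := by rw [ht]; linarith
  refine ⟨a + t, b - t, δ / 2, ?_⟩
  filter_upwards [hP, hW (t * δ / 2) (by positivity)] with i hi hWi
  exact H.of_W1Le ht0 (by linarith) le_rfl hWi

theorem LogConc.ae_notMem_frontier {q : ℝ → ℝ} (hq : LogConc q) :
    ∀ᵐ x, x ∉ frontier {x | 0 < q x} :=
  compl_mem_ae_iff.2 (hq.concaveOn.1.addHaar_frontier volume)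

theorem tendsto_integral_mul_of_envelope [l.IsCountablyGenerated] {k : ι → ℝ → ℝ} {q : ℝ → ℝ}
    {A B C : ℝ} (hB : 0 < B) (hq : LogConc q)
    (hk : ∀ᶠ i in l, Measurable (k i) ∧ (∀ x, 0 ≤ k i x) ∧
      ∀ x, k i x ≤ A * Real.exp (-(B * |x|)))
    (hc : ∀ x ∉ frontier {x | 0 < q x}, Tendsto (fun i => k i x) l (𝓝 (q x)))
    {u : ℝ → ℝ} (hu : Measurable u) (huC : ∀ x, |u x| ≤ C * (1 + |x| + x ^ 2)) :
    Tendsto (fun i => ∫ x, u x * k i x) l (𝓝 (∫ x, u x * q x)) := by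
  refine tendsto_integral_filter_of_dominated_convergence
    (fun x => C * A * ((1 + |x| + x ^ 2) * Real.exp (-(B * |x|)))) ?_ ?_
    ((integrable_sq_mul_exp_neg_mul_abs hB).const_mul (C * A)) ?_
  · filter_upwards [hk] with i hi
    exact (hu.mul hi.1).aestronglyMeasurable
  · filter_upwards [hk] with i hi
    refine Eventually.of_forall fun x => ?_
    rw [Real.norm_eq_abs, abs_mul, abs_of_nonneg (hi.2.1 x)]
    calc |u x| * k i x ≤ C * (1 + |x| + x ^ 2) * (A * Real.exp (-(B * |x|))) :=
          mul_le_mul (huC x) (hi.2.2 x) (hi.2.1 x) ((abs_nonneg _).trans (huC x))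
      _ = _ := by ring
  · filter_upwards [hq.ae_notMem_frontier] with x hx using (hc x hx).const_mul _

end tendsto

/-- Samples of increasing size whose empirical measures converge to `P`, together with points
that converge to `θ₀`. -/
structure SampleTendsto {ι : Type*} (l : Filter ι) (n : ι → ℕ) (x : ι → ℕ → ℝ) (θ : ι → ℝ)
    (P : Measure ℝ) (θ₀ : ℝ) : Prop where
  size : Tendsto n l atTop
  centre : Tendsto θ l (𝓝 θ₀)
  dist : W1Tendsto (fun i => empiricalMeasure (n i) (x i)) l P

section sample

variable {ι : Type*} {l : Filter ι} {n : ι → ℕ} {x : ι → ℕ → ℝ} {θ : ι → ℝ} {P : Measure ℝ}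
  {θ₀ : ℝ}

theorem SampleTendsto.ne_zero (hS : SampleTendsto l n x θ P θ₀) : ∀ᶠ i in l, n i ≠ 0 :=
  hS.size.eventually (eventually_ne_atTop 0)

theorem integrable_map_sub {P : Measure ℝ} [IsFiniteMeasure P] (hP : Integrable (fun t : ℝ => t) P)
    (θ : ℝ) : Integrable (fun t : ℝ => t) (P.map fun t => t - θ) :=
  (integrable_map_measure aestronglyMeasurable_id (by fun_prop)).2 (hP.sub (integrable_const θ))

theorem SampleTendsto.eventually_prob (hS : SampleTendsto l n x θ P θ₀) :
    ∀ᶠ i in l, IsProbabilityMeasure ((empiricalMeasure (n i) (x i)).map fun t => t - θ i) ∧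
      Integrable (fun t : ℝ => t) ((empiricalMeasure (n i) (x i)).map fun t => t - θ i) := by
  filter_upwards [hS.ne_zero] with i hi
  have := isProbabilityMeasure_empiricalMeasure hi (x i)
  exact ⟨Measure.isProbabilityMeasure_map (by fun_prop),
    integrable_map_sub (integrable_empiricalMeasure hi _ _) _⟩

/-- Changing the centre from `θ₀` to `θ i` changes the integral of a 1-Lipschitz function by at most
`|θ i - θ₀|`, so estimated centring does no harm. -/
theorem SampleTendsto.w1Tendsto_sub [IsProbabilityMeasure P]
    (hS : SampleTendsto l n x θ P θ₀) :
    W1Tendsto (fun i => (empiricalMeasure (n i) (x i)).map fun t => t - θ i) l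
      (P.map fun t => t - θ₀) := by
  intro ε hε
  filter_upwards [hS.ne_zero, hS.dist (ε / 2) (by positivity),
    Metric.tendsto_nhds.1 hS.centre (ε / 2) (by positivity)] with i hi hW hθ u hu
  have := isProbabilityMeasure_empiricalMeasure hi (x i)
  rw [integral_map (by fun_prop) hu.continuous.aestronglyMeasurable,
    integral_map (by fun_prop) hu.continuous.aestronglyMeasurable]
  have h1 : LipschitzWith 1 fun t => u (t - θ₀) := by
    have : LipschitzWith 1 fun t : ℝ => t - θ₀ :=
      LipschitzWith.of_dist_le_mul fun a b => by simp
    simpa [Function.comp_def] using hu.comp this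
  have h2 := hW _ h1
  have h3 : ‖∫ t, (u (t - θ i) - u (t - θ₀)) ∂(empiricalMeasure (n i) (x i))‖ ≤
      ε / 2 * (empiricalMeasure (n i) (x i)).real univ := by
    refine norm_integral_le_of_norm_le_const (Eventually.of_forall fun t => ?_)
    have h4 := hu.dist_le_mul (t - θ i) (t - θ₀)
    rw [dist_sub_left, NNReal.coe_one, one_mul] at h4
    rw [← dist_eq_norm]
    exact h4.trans hθ.le
  rw [integral_sub (integrable_empiricalMeasure hi _ _) (integrable_empiricalMeasure hi _ _),
    probReal_univ, mul_one, Real.norm_eq_abs] at h3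
  rw [abs_le] at h2 h3 ⊢
  constructor <;> linarith [h2.1, h2.2, h3.1, h3.2]

theorem IsProj.comp_add {h : ℝ → ℝ} (hP : IsProj P h) (θ : ℝ) :
    IsProj (P.map fun t => t - θ) (fun z => h (θ + z)) := by
  have h1 := hP.comp_affine (e := 1) (by norm_num) (-θ)
  have e1 : (fun t : ℝ => 1 * t + -θ) = fun t => t - θ := by funext t; ring
  have e2 : (fun z => h (1 * z + -(1 * -θ))) = fun z => h (θ + z) := by
    funext z; congr 1; ring
  rwa [e1, e2] at h1

theorem tendsto_prodMk_const (z : ℝ) : Tendsto (fun i : ι => (i, z)) l (l ×ˢ 𝓝 z) :=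
  tendsto_id.prodMk tendsto_const_nhds

end sample

/-! ### The estimators as maximizers for converging measures. -/

section estimators

variable {ι : Type*} {l : Filter ι} {n : ι → ℕ} {x : ι → ℕ → ℝ} {θ : ι → ℝ} {f₀ p : ℝ → ℝ}
  {θ₀ : ℝ}

theorem integrable_id_law (hf : f₀ ∈ Densities) (hi : Integrable fun x => |x| * f₀ x) :
    Integrable (fun x : ℝ => x) (law f₀) := by
  rw [integrable_law_iff hf]
  refine hi.mono' (by have := hf.1; fun_prop) (Eventually.of_forall fun x => ?_)
  rw [Real.norm_eq_abs, abs_mul, abs_of_nonneg (hf.2.1 x)]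

theorem law_map_sub_map_neg (hf : f₀ ∈ SymDensities θ₀) :
    ((law f₀).map fun t => t - θ₀).map (fun t => -t) = (law f₀).map fun t => t - θ₀ := by
  have h1 := hf.1.1
  rw [law_map_sub h1, law_map_neg (by fun_prop)]
  congr 1
  funext z
  rw [add_comm z, hf.2 z]
  congr 1; ring

/-- The centred maximum likelihood estimators and the partial maximum likelihood estimator
are maximizers for measures that converge to the centred law. -/
structure CentredProj (l : Filter ι) (n : ι → ℕ) (x : ι → ℕ → ℝ) (θ : ι → ℝ) (P₀ : Measure ℝ) :
    Prop where
  plus : ∃ A : ι → Measure ℝ, (∀ᶠ i in l, IsProbabilityMeasure (A i) ∧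
    Integrable (fun t : ℝ => t) (A i)) ∧ W1Tendsto A l P₀ ∧
    ∀ᶠ i in l, IsProj (A i) fun z => mle (n i) (x i) (θ i + z)
  minus : ∃ A : ι → Measure ℝ, (∀ᶠ i in l, IsProbabilityMeasure (A i) ∧
    Integrable (fun t : ℝ => t) (A i)) ∧ W1Tendsto A l P₀ ∧
    ∀ᶠ i in l, IsProj (A i) fun z => mle (n i) (x i) (θ i - z)
  sym : ∃ A : ι → Measure ℝ, (∀ᶠ i in l, IsProbabilityMeasure (A i) ∧
    Integrable (fun t : ℝ => t) (A i)) ∧ W1Tendsto A l P₀ ∧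
    ∀ᶠ i in l, IsProj (A i) (partialMle (n i) (x i) (θ i))

theorem SampleTendsto.eventually_isProj_mle (hf : f₀ ∈ Densities)
    (hS : SampleTendsto l n x θ (law f₀) θ₀) :
    ∀ᶠ i in l, IsProj (empiricalMeasure (n i) (x i)) (mle (n i) (x i)) ∧
      mleVariance (n i) (x i) < sampleVariance (n i) (x i) := by
  have := isProbabilityMeasure_law hf
  have := nullSingletonClass_law f₀
  obtain ⟨a, b, δ, H⟩ := exists_spread (law f₀)
  obtain ⟨a', b', δ', H'⟩ := H.eventually (hS.ne_zero.mono fun i hi =>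
    isProbabilityMeasure_empiricalMeasure hi (x i)) hS.dist
  filter_upwards [H', hS.ne_zero] with i hi hn
  exact ⟨isProj_mle hn hi, mleVariance_lt_sampleVariance hn hi⟩

theorem SampleTendsto.centredProj (hf : f₀ ∈ SymDensities θ₀)
    (hi : Integrable fun x => |x| * f₀ x) (hS : SampleTendsto l n x θ (law f₀) θ₀) :
    CentredProj l n x θ ((law f₀).map fun t => t - θ₀) := by
  have := isProbabilityMeasure_law hf.1
  have hP := integrable_id_law hf.1 hi
  have hneg := law_map_sub_map_neg hf
  have hm := hS.eventually_isProj_mle hf.1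
  have hA := hS.eventually_prob
  have hW := hS.w1Tendsto_sub
  have hP₀ := integrable_map_sub hP θ₀
  have hB : ∀ᶠ i in l, IsProbabilityMeasure (symLaw
      ((empiricalMeasure (n i) (x i)).map fun t => t - θ i)) ∧ Integrable (fun t : ℝ => t)
      (symLaw ((empiricalMeasure (n i) (x i)).map fun t => t - θ i)) := by
    filter_upwards [hA] with i hAi
    have := hAi.1
    exact ⟨isProbabilityMeasure_symLaw, integrable_symLaw hAi.2 (integrable_map_neg hAi.2)⟩
  have hmp : IsProbabilityMeasure ((law f₀).map fun t => t - θ₀) :=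
    Measure.isProbabilityMeasure_map (by fun_prop)
  have hWs : W1Tendsto (fun i => symLaw ((empiricalMeasure (n i) (x i)).map fun t => t - θ i)) l
      ((law f₀).map fun t => t - θ₀) := by
    intro ε hε
    filter_upwards [hA, hW ε hε] with i hAi hWi
    have := hAi.1
    rw [← symLaw_eq_self hneg]
    exact hWi.symLaw hAi.2 hP₀
  refine ⟨⟨_, hA, hW, hm.mono fun i hi => hi.1.comp_add (θ i)⟩,
    ⟨fun i => ((empiricalMeasure (n i) (x i)).map fun t => t - θ i).map fun t => -t, ?_, ?_, ?_⟩,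
    ⟨_, hB, hWs, ?_⟩⟩
  · filter_upwards [hA] with i hAi
    have := hAi.1
    exact ⟨Measure.isProbabilityMeasure_map (by fun_prop), integrable_map_neg hAi.2⟩
  · intro ε hε
    filter_upwards [hW ε hε] with i hWi
    -- The centred law is its own reflection, so the reflected empirical measures have the same
    -- limit.
    rw [← hneg]
    exact hWi.map_neg
  · filter_upwards [hm] with i hi
    exact (hi.1.comp_add (θ i)).comp_neg
  · have hmeas := hf.1.1
    have := nullSingletonClass_law fun z => f₀ (z + θ₀)
    rw [← law_map_sub hmeas] at this
    obtain ⟨a, b, δ, H⟩ := exists_spread ((law f₀).map fun t => t - θ₀)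
    obtain ⟨a', b', δ', H'⟩ := H.eventually (hB.mono fun i hi => hi.1) hWs
    filter_upwards [H', hS.ne_zero] with i hi hn using isProj_partialMle hn hi

/-- Functions converging to `q` under a common exponential envelope. -/
structure EnvTendsto (l : Filter ι) (k : ι → ℝ → ℝ) (q : ℝ → ℝ) : Prop where
  logConc : ∀ᶠ i in l, LogConc (k i)
  measurable : ∀ᶠ i in l, Measurable (k i)
  integral : ∀ᶠ i in l, Integrable (k i) ∧ ∫ x, k i x = 1
  envelope : ∃ A B : ℝ, 0 < A ∧ 0 < B ∧ ∀ᶠ i in l, ∀ x, k i x ≤ A * Real.exp (-(B * |x|))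
  tendsto : ∀ z ∉ frontier {x | 0 < q x},
    Tendsto (fun p : ι × ℝ => k p.1 p.2) (l ×ˢ 𝓝 z) (𝓝 (q z))

theorem envTendsto_of_isProj {P : ι → Measure ℝ} {P₀ : Measure ℝ} [IsProbabilityMeasure P₀]
    [NullSingletonClass P₀] (hP₀ : Integrable (fun x : ℝ => x) P₀)
    (hP : ∀ᶠ i in l, IsProbabilityMeasure (P i) ∧ Integrable (fun x : ℝ => x) (P i))
    (hW : W1Tendsto P l P₀) {k : ι → ℝ → ℝ} {q : ℝ → ℝ} (hq : IsProj P₀ q)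
    (hk : ∀ᶠ i in l, IsProj (P i) (k i)) : EnvTendsto l k q := by
  obtain ⟨a, b, δ, H⟩ := exists_spread P₀
  obtain ⟨A, B, hA, hB, -, hE⟩ := exists_envelope_of_W1Tendsto H hP₀ hP hW hq hk
  refine ⟨hk.mono fun i hi => hi.adm.logConc, hk.mono fun i hi => hi.adm.usc.measurable, ?_,
    ⟨A, B, hA, hB, hE.mono fun i hi => hi.1⟩, fun z hz => IsProj.tendsto H hP₀ hP hW hq hk hz⟩
  filter_upwards [hk, hE] with i h1 h2 using ⟨h1.adm.int, h2.2⟩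

theorem EnvTendsto.tendsto_pointwise {k : ι → ℝ → ℝ} {q : ℝ → ℝ} (H : EnvTendsto l k q) {z : ℝ}
    (hz : z ∉ frontier {x | 0 < q x}) : Tendsto (fun i => k i z) l (𝓝 (q z)) :=
  (H.tendsto z hz).comp (tendsto_prodMk_const z)

theorem notMem_frontier_of_mem_interior {s : Set ℝ} {z : ℝ} (hz : z ∈ interior s) :
    z ∉ frontier s := fun h => h.2 hz

theorem EnvTendsto.tendsto_integral_mul [l.IsCountablyGenerated] {k : ι → ℝ → ℝ} {q : ℝ → ℝ}
    (H : EnvTendsto l k q) (hq : LogConc q) {u : ℝ → ℝ} (hu : Measurable u) {C : ℝ}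
    (huC : ∀ x, |u x| ≤ C * (1 + |x| + x ^ 2)) :
    Tendsto (fun i => ∫ x, u x * k i x) l (𝓝 (∫ x, u x * q x)) := by
  obtain ⟨A, B, -, hB, hE⟩ := H.envelope
  refine tendsto_integral_mul_of_envelope (A := A) hB hq ?_ (fun z hz => H.tendsto_pointwise hz) hu huC
  filter_upwards [H.logConc, H.measurable, hE] with i h1 h2 h3 using ⟨h2, h1.nonneg, h3⟩

theorem meanTendsto_add {k₁ k₂ : ι → ℝ → ℝ} {q : ℝ → ℝ} (h₁ : EnvTendsto l k₁ q)
    (h₂ : EnvTendsto l k₂ q) : MeanTendsto l (fun i z => (1 / 2) * (k₁ i z + k₂ i z)) q :=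
  ⟨k₁, k₂, h₁.logConc, h₂.logConc,
    fun _ hx => h₁.tendsto_pointwise (notMem_frontier_of_mem_interior hx),
    fun _ hx => h₂.tendsto_pointwise (notMem_frontier_of_mem_interior hx),
    Eventually.of_forall fun _ _ => rfl⟩

theorem meanTendsto_single {k : ι → ℝ → ℝ} {q : ℝ → ℝ} (H : EnvTendsto l k q) :
    MeanTendsto l k q :=
  meanTendsto_of_logConc H.logConc
    fun _ hx => H.tendsto_pointwise (notMem_frontier_of_mem_interior hx)

/-- The geometric mean is itself log-concave and converges to `√(q * q) = q`. It lies under a common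
envelope, so the normalizing integral tends to `∫ q = 1`. -/
theorem meanTendsto_geo [l.IsCountablyGenerated] {k₁ k₂ : ι → ℝ → ℝ} {q : ℝ → ℝ} (hq : LogConc q)
    (hq1 : ∫ x, q x = 1) (h₁ : EnvTendsto l k₁ q) (h₂ : EnvTendsto l k₂ q) :
    MeanTendsto l (fun i z => (∫ t, √(k₁ i t * k₂ i t))⁻¹ * √(k₁ i z * k₂ i z)) q := by
  obtain ⟨A₁, B₁, hA₁, hB₁, hE₁⟩ := h₁.envelope
  obtain ⟨A₂, B₂, hA₂, hB₂, hE₂⟩ := h₂.envelope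
  have hpt : ∀ z ∉ frontier {x | 0 < q x},
      Tendsto (fun i => √(k₁ i z * k₂ i z)) l (𝓝 (q z)) := fun z hz => by
    have := ((h₁.tendsto_pointwise hz).mul (h₂.tendsto_pointwise hz)).sqrt
    rwa [Real.sqrt_mul_self (hq.nonneg z)] at this
  have hint : Tendsto (fun i => ∫ t, √(k₁ i t * k₂ i t)) l (𝓝 1) := by
    have h0 := tendsto_integral_mul_of_envelope (k := fun i t => √(k₁ i t * k₂ i t)) (l := l)
      (A := A₁ + A₂) (B := min B₁ B₂) (C := 1) (lt_min hB₁ hB₂) hq ?_ hpt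
      (u := fun _ => 1) measurable_const fun x => ?_
    · simpa [hq1] using h0
    · filter_upwards [h₁.logConc, h₂.logConc, h₁.measurable, h₂.measurable, hE₁, hE₂]
        with i a1 a2 a3 a4 a5 a6
      refine ⟨(a3.mul a4).sqrt, fun _ => Real.sqrt_nonneg _, fun z => ?_⟩
      have e : ∀ B, min B₁ B₂ ≤ B →
          Real.exp (-(B * |z|)) ≤ Real.exp (-(min B₁ B₂ * |z|)) := fun B hB => by gcongr
      have b1 : k₁ i z ≤ (A₁ + A₂) * Real.exp (-(min B₁ B₂ * |z|)) :=
        (a5 z).trans (mul_le_mul (by linarith) (e _ (min_le_left _ _)) (Real.exp_pos _).le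
          (by linarith))
      have b2 : k₂ i z ≤ (A₁ + A₂) * Real.exp (-(min B₁ B₂ * |z|)) :=
        (a6 z).trans (mul_le_mul (by linarith) (e _ (min_le_right _ _)) (Real.exp_pos _).le
          (by linarith))
      have hpos : 0 ≤ (A₁ + A₂) * Real.exp (-(min B₁ B₂ * |z|)) := (a1.nonneg z).trans b1
      refine (Real.sqrt_le_sqrt (mul_le_mul b1 b2 (a2.nonneg z) hpos)).trans ?_
      rw [Real.sqrt_mul_self hpos]
    · simp only [abs_one, one_mul]
      nlinarith [abs_nonneg x, sq_nonneg x]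
  have hinv := hint.inv₀ one_ne_zero
  rw [inv_one] at hinv
  refine meanTendsto_of_logConc ?_ fun z hz => ?_
  · filter_upwards [h₁.logConc, h₂.logConc, hinv.eventually_const_lt one_pos] with i a1 a2 a3
    exact (a1.mul a2).sqrt.const_mul a3
  · simpa using hinv.mul (hpt z (notMem_frontier_of_mem_interior hz))

theorem EnvTendsto.abs_le {k : ι → ℝ → ℝ} {q : ℝ → ℝ} (H : EnvTendsto l k q) :
    ∃ A, ∀ᶠ i in l, ∀ x, |k i x| ≤ A := by
  obtain ⟨A, B, hA, hB, hE⟩ := H.envelope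
  refine ⟨A, ?_⟩
  filter_upwards [H.logConc, hE] with i h1 h2 x
  rw [abs_of_nonneg (h1.nonneg x)]
  refine (h2 x).trans (mul_le_of_le_one_right hA.le (Real.exp_le_one_iff.2 (neg_nonpos.2 ?_)))
  positivity

theorem EnvTendsto.gaussAvg [l.IsCountablyGenerated] {k : ι → ℝ → ℝ} {q : ℝ → ℝ}
    (H : EnvTendsto l k q) (hq : LogConc q) {β : ι → ℝ} {b : ℝ} (hβ : Tendsto β l (𝓝 b))
    (hβ0 : ∀ᶠ i in l, 0 < β i) :
    (∀ᶠ i in l, LogConc (gaussAvg (β i) (k i))) ∧ ∀ z ∈ interior {x | 0 < gaussAvg b q x},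
      Tendsto (fun i => LogConcaveLocation.gaussAvg (β i) (k i) z) l (𝓝 (gaussAvg b q z)) := by
  refine ⟨?_, fun z hz => ?_⟩
  · filter_upwards [H.logConc, H.integral, hβ0] with i h1 h2 h3
    exact h1.gaussAvg h2.1 (by rw [h2.2]; exact one_pos) h3.le
  · obtain ⟨A, hA⟩ := H.abs_le
    refine tendsto_gaussAvg hq H.measurable hA H.tendsto hβ fun hb => ?_
    rwa [hb, gaussAvg_zero] at hz

theorem SampleTendsto.envTendsto_mle (hf : f₀ ∈ Densities)
    (hi : Integrable fun x => |x| * f₀ x) (hS : SampleTendsto l n x θ (law f₀) θ₀)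
    (hp : IsProj (law f₀) p) : EnvTendsto l (fun i => mle (n i) (x i)) p := by
  have := isProbabilityMeasure_law hf
  have := nullSingletonClass_law f₀
  refine envTendsto_of_isProj (integrable_id_law hf hi) ?_ hS.dist hp
    ((hS.eventually_isProj_mle hf).mono fun i h => h.1)
  filter_upwards [hS.ne_zero] with i h
  exact ⟨isProbabilityMeasure_empiricalMeasure h _, integrable_empiricalMeasure h _ _⟩

end estimators

/-! ### The limits of the bandwidth and of the smoothed estimators. -/

section bandwidth

variable {ι : Type*} {l : Filter ι} [l.IsCountablyGenerated] {n : ι → ℕ} {x : ι → ℕ → ℝ}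
  {θ : ι → ℝ} {f₀ p : ℝ → ℝ} {θ₀ : ℝ}

theorem sym_moments {g : ℝ → ℝ} (hi : Integrable g) (h1 : ∫ x, g x = 1)
    (hi1 : Integrable fun x => x * g x) (hs : g =ᵐ[volume] fun x => g (2 * θ₀ - x)) :
    ∫ x, x * g x = θ₀ := by
  rw [integral_mul_of_ae_symm hi hi1 hs, h1, mul_one]

/-- The projection of a symmetric law is symmetric up to a null set. -/
theorem IsProj.ae_symm (hf : f₀ ∈ SymDensities θ₀) (hp : IsProj (law f₀) p) :
    p =ᵐ[volume] fun x => p (2 * θ₀ - x) := by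
  have h1 := hp.comp_affine (e := -1) (by norm_num) (2 * θ₀)
  have e1 : (law f₀).map (fun x => -1 * x + 2 * θ₀) = law f₀ := by
    have h2 : (fun x : ℝ => -1 * x + 2 * θ₀) = fun x => 2 * θ₀ - x := by funext x; ring
    rw [h2, law_map hf.1.1 (Measure.measurePreserving_sub_left volume (2 * θ₀))
      (S := fun z => 2 * θ₀ - z) (by fun_prop) (fun x => by ring)]
    congr 1
    funext z
    have := hf.2 (z - θ₀)
    rw [show θ₀ + (z - θ₀) = z by ring, show θ₀ - (z - θ₀) = 2 * θ₀ - z by ring] at this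
    exact this.symm
  have e2 : (fun y => p (-1 * y + -(-1 * (2 * θ₀)))) = fun x => p (2 * θ₀ - x) := by
    funext y; congr 1; ring
  rw [e1, e2] at h1
  exact hp.ae_eq h1

/-- Sample moments converge, the second by assumption since Kantorovich convergence does not control
it; moments of the MLE converge under the envelope. By symmetry the true law and its projection both
have mean `θ₀`, so only second moments remain in the difference of variances. -/
theorem SampleTendsto.tendsto_bandwidth (hf : f₀ ∈ SymDensities θ₀)
    (hi : Integrable fun x => |x| * f₀ x) (hi2 : Integrable fun x => x ^ 2 * f₀ x)
    (hS : SampleTendsto l n x θ (law f₀) θ₀) (hp : IsProj (law f₀) p)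
    (h2 : Tendsto (fun i => ∫ t, t ^ 2 ∂(empiricalMeasure (n i) (x i))) l
      (𝓝 (∫ t, t ^ 2 * f₀ t))) :
    Tendsto (fun i => bandwidth (n i) (x i)) l (𝓝 √(∫ z, z ^ 2 * (f₀ z - p z))) := by
  have hE := hS.envTendsto_mle hf.1 hi hp
  have := isProbabilityMeasure_law hf.1
  have := nullSingletonClass_law f₀
  obtain ⟨a, b, δ, H⟩ := exists_spread (law f₀)
  have hp1 := hp.integral_eq_one H
  obtain ⟨A, B, hB, -, hEp⟩ := hp.adm.exists_envelope H hp1.le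
  have hpm := hp.adm.usc.measurable
  have hb2 : ∀ x : ℝ, |x ^ 2| ≤ 1 * (1 + |x| + x ^ 2) := fun x => by
    rw [abs_of_nonneg (sq_nonneg x)]; linarith [abs_nonneg x]
  have hb1 : ∀ x : ℝ, |x| ≤ 1 * (1 + |x| + x ^ 2) := fun x => by nlinarith [sq_nonneg x]
  have ip2 : Integrable fun x => x ^ 2 * p x :=
    integrable_mul_of_envelope hB hpm hp.adm.logConc.nonneg hEp (by fun_prop) hb2
  have ip1 : Integrable fun x => x * p x :=
    integrable_mul_of_envelope hB hpm hp.adm.logConc.nonneg hEp (u := fun x => x) (by fun_prop) hb1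
  obtain ⟨if0, if1⟩ := integrable_of_mem_densities hf.1
  have mp : ∫ x, x * p x = θ₀ := sym_moments hp.adm.int hp1 ip1 (hp.ae_symm hf)
  have mf : ∫ x, x * f₀ x = θ₀ := by
    refine sym_moments if0 if1 ((integrable_law_iff hf.1).1 (integrable_id_law hf.1 hi))
      (Eventually.of_forall fun z => ?_)
    have := hf.2 (z - θ₀)
    rwa [show θ₀ + (z - θ₀) = z by ring, show θ₀ - (z - θ₀) = 2 * θ₀ - z by ring] at this
  have t1 : Tendsto (fun i => ∫ t, t ∂(empiricalMeasure (n i) (x i))) l (𝓝 θ₀) := by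
    rw [← mf, ← integral_law hf.1]
    refine Metric.tendsto_nhds.2 fun ε hε => ?_
    filter_upwards [hS.dist (ε / 2) (by positivity)] with i h
    rw [Real.dist_eq]
    exact (h (fun t => t) LipschitzWith.id).trans_lt (by linarith)
  have t0 : Tendsto (fun i => (n i : ℝ) / ((n i : ℝ) - 1)) l (𝓝 1) := by
    have := (tendsto_natCast_div_add_atTop (𝕜 := ℝ) (-1)).comp hS.size
    simpa [Function.comp_def, ← sub_eq_add_neg] using this
  have s1 : Tendsto (fun i => sampleVariance (n i) (x i)) l
      (𝓝 ((∫ t, t ^ 2 * f₀ t) - θ₀ ^ 2)) := by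
    have h3 := t0.mul (h2.sub (t1.pow 2))
    rw [one_mul] at h3
    refine h3.congr' ?_
    filter_upwards [hS.ne_zero] with i h
    exact (sampleVariance_eq h _).symm
  have s2 : Tendsto (fun i => mleVariance (n i) (x i)) l
      (𝓝 ((∫ t, t ^ 2 * p t) - θ₀ ^ 2)) := by
    have h3 := hE.tendsto_integral_mul hp.adm.logConc (u := fun t => t ^ 2) (by fun_prop) hb2
    have h4 := hE.tendsto_integral_mul hp.adm.logConc (u := fun t => t) (by fun_prop) hb1
    rw [mp] at h4
    exact h3.sub (h4.pow 2)
  have e : ∫ z, z ^ 2 * (f₀ z - p z) =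
      (∫ t, t ^ 2 * f₀ t) - θ₀ ^ 2 - ((∫ t, t ^ 2 * p t) - θ₀ ^ 2) := by
    simp only [mul_sub]
    rw [integral_sub hi2 ip2]; ring
  rw [e]
  exact (s1.sub s2).sqrt

/-- The estimators without smoothing. -/
theorem SampleTendsto.meanTendsto (hf : f₀ ∈ SymDensities θ₀)
    (hi : Integrable fun x => |x| * f₀ x) (hS : SampleTendsto l n x θ (law f₀) θ₀)
    (hp : IsProj (law f₀) p) :
    (EnvTendsto l (fun i z => mle (n i) (x i) (θ i + z)) (fun z => p (z + θ₀)) ∧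
      EnvTendsto l (fun i z => mle (n i) (x i) (θ i - z)) (fun z => p (z + θ₀)) ∧
      EnvTendsto l (fun i => partialMle (n i) (x i) (θ i)) (fun z => p (z + θ₀))) ∧
    MeanTendsto l (fun i => symEst (n i) (x i) (θ i)) (fun z => p (z + θ₀)) ∧
      MeanTendsto l (fun i => geoEst (n i) (x i) (θ i)) (fun z => p (z + θ₀)) := by
  have := isProbabilityMeasure_law hf.1
  have hP₀ := integrable_map_sub (integrable_id_law hf.1 hi) θ₀
  have hmp : IsProbabilityMeasure ((law f₀).map fun t => t - θ₀) :=
    Measure.isProbabilityMeasure_map (by fun_prop)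
  have hns : NullSingletonClass ((law f₀).map fun t => t - θ₀) := by
    rw [law_map_sub hf.1.1]; exact nullSingletonClass_law _
  have hq : IsProj ((law f₀).map fun t => t - θ₀) (fun z => p (z + θ₀)) := by
    simpa only [add_comm θ₀] using hp.comp_add θ₀
  obtain ⟨a, b, δ, H⟩ := exists_spread ((law f₀).map fun t => t - θ₀)
  have hq1 := hq.integral_eq_one H
  obtain ⟨⟨A₁, a1, a2, a3⟩, ⟨A₂, b1, b2, b3⟩, ⟨A₃, c1, c2, c3⟩⟩ := hS.centredProj hf hi
  have E₁ := envTendsto_of_isProj hP₀ a1 a2 hq a3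
  have E₂ := envTendsto_of_isProj hP₀ b1 b2 hq b3
  have E₃ := envTendsto_of_isProj hP₀ c1 c2 hq c3
  exact ⟨⟨E₁, E₂, E₃⟩, meanTendsto_add E₁ E₂, meanTendsto_geo hq.adm.logConc hq1 E₁ E₂⟩

theorem integrable_comp_gaussian {f : ℝ → ℝ} (hm : Measurable f) {A : ℝ} (hA : ∀ x, |f x| ≤ A)
    (b z : ℝ) : Integrable (fun t => f (z - b * t)) (gaussianReal 0 1) :=
  (integrable_const A).mono' (hm.comp (by fun_prop)).aestronglyMeasurable
    (Eventually.of_forall fun t => hA _)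

theorem integral_gaussian_neg (u : ℝ → ℝ) (hu : Measurable u) :
    ∫ t, u (-t) ∂(gaussianReal 0 1) = ∫ t, u t ∂(gaussianReal 0 1) := by
  have h1 := gaussianReal_map_neg (μ := 0) (v := 1)
  rw [neg_zero] at h1
  conv_rhs => rw [← h1]
  exact (integral_map (by fun_prop) hu.aestronglyMeasurable).symm

/-- The smoothed estimators. -/
theorem SampleTendsto.meanTendsto_smooth (hf : f₀ ∈ SymDensities θ₀)
    (hi : Integrable fun x => |x| * f₀ x) (hi2 : Integrable fun x => x ^ 2 * f₀ x)
    (hS : SampleTendsto l n x θ (law f₀) θ₀) (hp : IsProj (law f₀) p)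
    (h2 : Tendsto (fun i => ∫ t, t ^ 2 ∂(empiricalMeasure (n i) (x i))) l
      (𝓝 (∫ t, t ^ 2 * f₀ t))) :
    MeanTendsto l (fun i => smoothedSymEst (n i) (x i) (θ i))
      (gaussAvg √(∫ z, z ^ 2 * (f₀ z - p z)) fun z => p (z + θ₀)) ∧
    MeanTendsto l (fun i z => smoothedMle (n i) (x i) (θ i + z))
      (gaussAvg √(∫ z, z ^ 2 * (f₀ z - p z)) fun z => p (z + θ₀)) ∧
    MeanTendsto l (fun i z => smoothedMle (n i) (x i) (θ i - z))
      (gaussAvg √(∫ z, z ^ 2 * (f₀ z - p z)) fun z => p (z + θ₀)) := by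
  have hβ := hS.tendsto_bandwidth hf hi hi2 hp h2
  -- The kernel formula defining the estimators agrees with the Gaussian average only for positive
  -- bandwidth.
  have hβ0 : ∀ᶠ i in l, 0 < bandwidth (n i) (x i) := by
    filter_upwards [hS.eventually_isProj_mle hf.1] with i h
    exact Real.sqrt_pos.2 (sub_pos.2 h.2)
  obtain ⟨⟨E₁, E₂, -⟩, -⟩ := hS.meanTendsto hf hi hp
  have hqc : LogConc fun z => p (z + θ₀) := by
    simpa using hp.adm.logConc.comp_affine 1 θ₀
  obtain ⟨l1, t1⟩ := E₁.gaussAvg hqc hβ hβ0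
  obtain ⟨l2, t2⟩ := E₂.gaussAvg hqc hβ hβ0
  refine ⟨⟨_, _, l1, l2, t1, t2, ?_⟩, (meanTendsto_of_logConc l1 t1).congr ?_,
    (meanTendsto_of_logConc l2 t2).congr ?_⟩
  · obtain ⟨A₁, hA₁⟩ := E₁.abs_le
    obtain ⟨A₂, hA₂⟩ := E₂.abs_le
    filter_upwards [hβ0, hA₁, hA₂, E₁.measurable, E₂.measurable] with i h0 a1 a2 m1 m2 z
    rw [smoothedSymEst, gaussSmooth_eq_gaussAvg h0]
    unfold gaussAvg
    rw [← integral_add (integrable_comp_gaussian m1 a1 _ z) (integrable_comp_gaussian m2 a2 _ z),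
      ← integral_const_mul]
    rfl
  · filter_upwards [hβ0] with i h0
    funext z
    rw [smoothedMle, gaussSmooth_eq_gaussAvg h0]
    unfold gaussAvg
    simp only [add_sub_assoc]
  · filter_upwards [hβ0, (hS.eventually_isProj_mle hf.1)] with i h0 hpr
    funext z
    have hm := hpr.1.adm.usc.measurable
    rw [smoothedMle, gaussSmooth_eq_gaussAvg h0]
    unfold gaussAvg
    -- Evaluation at `θ i - z` reflects the argument, and the symmetry of the normal law reflects
    -- the noise along with it.
    rw [← integral_gaussian_neg _ (by fun_prop)]
    refine integral_congr_ae (Eventually.of_forall fun t => ?_)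
    simp only
    congr 1; ring

/-- The limit of the smoothed estimators. -/
theorem smoothedProj_eq_gaussAvg (hm : Measurable (projDensity f₀)) :
    smoothedProj f₀ θ₀ = gaussAvg √(∫ z, z ^ 2 * (f₀ z - projDensity f₀ z))
      fun z => projDensity f₀ (z + θ₀) := by
  funext z
  have h1 := gaussianReal_map_const_mul (μ := 0) (v := 1) √(smoothingVariance f₀)
  -- The square root and `toNNReal` both truncate negative values to zero, so the sign of the
  -- variance need not be known.
  have e : NNReal.mk (√(smoothingVariance f₀) ^ 2) (sq_nonneg _) * 1 =
      (smoothingVariance f₀).toNNReal := by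
    rw [mul_one]
    ext
    rw [NNReal.coe_mk, Real.coe_toNNReal']
    rcases le_total 0 (smoothingVariance f₀) with h | h
    · rw [Real.sq_sqrt h, max_eq_left h]
    · rw [Real.sqrt_eq_zero_of_nonpos h, max_eq_right h]; simp
  rw [e, mul_zero] at h1
  unfold smoothedProj gaussAvg centeredProj
  rw [← h1]
  exact integral_map (by fun_prop) (by fun_prop : Measurable _).aestronglyMeasurable

end bandwidth

/-! ### Convergence of empirical measures -/

/-- Truncation to `[-m, m]`. -/
def trunc (m : ℕ) (x : ℝ) : ℝ := max (-(m : ℝ)) (min m x)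

/-- Indicator of a cell of the grid with mesh `1 / m` on `[-m, m]`. -/
noncomputable def cell (m : ℕ) (j : ℤ) : ℝ → ℝ :=
  indicator {x | ⌊(m : ℝ) * trunc m x⌋ = j} fun _ => 1

/-- The part of `|x|` above `m`. -/
noncomputable def tail (m : ℕ) (x : ℝ) : ℝ := max (|x| - m) 0

theorem measurable_cell (m : ℕ) (j : ℤ) : Measurable (cell m j) := by
  refine measurable_const.indicator ?_
  have : Measurable fun x => ⌊(m : ℝ) * trunc m x⌋ := by unfold trunc; fun_prop
  exact this (measurableSet_singleton j)

theorem measurable_tail (m : ℕ) : Measurable (tail m) := by unfold tail; fun_prop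

theorem integrable_cell (P : Measure ℝ) [IsFiniteMeasure P] (m : ℕ) (j : ℤ) :
    Integrable (cell m j) P := by
  refine (integrable_const (1 : ℝ)).mono' (measurable_cell m j).aestronglyMeasurable
    (Eventually.of_forall fun x => ?_)
  unfold cell
  by_cases h : x ∈ {x | ⌊(m : ℝ) * trunc m x⌋ = j} <;> simp [h]

theorem integrable_tail {P : Measure ℝ} [IsFiniteMeasure P] (hP : Integrable (fun x : ℝ => x) P)
    (m : ℕ) : Integrable (tail m) P :=
  (hP.norm.sub (integrable_const _)).pos_part

/-- Rounding down to the grid costs `1 / m`, and truncation to `[-m, m]` costs exactly the excess of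
`|x|` over `m`. -/
theorem abs_sub_floor_le {m : ℕ} (hm : 0 < m) (x : ℝ) :
    |x - ⌊(m : ℝ) * trunc m x⌋ / m| ≤ (m : ℝ)⁻¹ + tail m x := by
  have hm0 : (0 : ℝ) < m := by exact_mod_cast hm
  have h1 : |trunc m x - ⌊(m : ℝ) * trunc m x⌋ / m| ≤ (m : ℝ)⁻¹ := by
    have e : trunc m x - ⌊(m : ℝ) * trunc m x⌋ / m =
        ((m : ℝ) * trunc m x - ⌊(m : ℝ) * trunc m x⌋) * (m : ℝ)⁻¹ := by field_simp
    rw [e, abs_mul, abs_of_pos (inv_pos.2 hm0)]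
    refine mul_le_of_le_one_left (inv_pos.2 hm0).le ?_
    rw [Int.self_sub_floor, abs_of_nonneg (Int.fract_nonneg _)]
    exact (Int.fract_lt_one _).le
  have h2 : |x - trunc m x| ≤ tail m x := by
    unfold trunc tail
    rcases le_total x 0 with hx | hx
    · rw [min_eq_right (by linarith), abs_of_nonpos hx]
      rcases le_total (-(m : ℝ)) x with h | h
      · rw [max_eq_right h]; simp
      · rw [max_eq_left h, abs_of_nonpos (by linarith)]
        exact le_trans (by linarith) (le_max_left _ _)
    · rw [abs_of_nonneg hx, max_eq_right (le_min (by linarith) (by linarith))]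
      rcases le_total x m with h | h
      · rw [min_eq_right h]; simp
      · rw [min_eq_left h, abs_of_nonneg (by linarith)]
        exact le_max_left _ _
  calc |x - ⌊(m : ℝ) * trunc m x⌋ / m|
      = |(x - trunc m x) + (trunc m x - ⌊(m : ℝ) * trunc m x⌋ / m)| := by congr 1; ring
    _ ≤ _ := (abs_add_le _ _).trans (by linarith)

theorem floor_trunc_mem (m : ℕ) (x : ℝ) :
    ⌊(m : ℝ) * trunc m x⌋ ∈ Finset.Icc (-(m : ℤ) ^ 2) ((m : ℤ) ^ 2) := by
  have h1 : -(m : ℝ) ≤ trunc m x := le_max_left _ _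
  have h2 : trunc m x ≤ m := max_le (by linarith [m.cast_nonneg (α := ℝ)]) (min_le_left _ _)
  have hm0 : (0 : ℝ) ≤ m := m.cast_nonneg
  rw [Finset.mem_Icc]
  constructor
  · rw [Int.le_floor]; push_cast; nlinarith
  · have : (⌊(m : ℝ) * trunc m x⌋ : ℝ) ≤ (m : ℝ) ^ 2 :=
      (Int.floor_le _).trans (by nlinarith)
    exact_mod_cast this

theorem comp_floor_eq_sum (m : ℕ) (u : ℝ → ℝ) (x : ℝ) :
    u (⌊(m : ℝ) * trunc m x⌋ / m) =
      ∑ j ∈ Finset.Icc (-(m : ℤ) ^ 2) ((m : ℤ) ^ 2), u (j / m) * cell m j x := by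
  rw [Finset.sum_eq_single_of_mem _ (floor_trunc_mem m x) fun j _ hj => ?_]
  · simp [cell]
  · have : x ∉ {x | ⌊(m : ℝ) * trunc m x⌋ = j} := fun h => hj h.symm
    simp [cell, this]

/-- Distance between the integral of a Lipschitz function and its discretization. -/
theorem abs_integral_sub_sum_le {P : Measure ℝ} [IsProbabilityMeasure P]
    (hP : Integrable (fun x : ℝ => x) P) {m : ℕ} (hm : 0 < m) {u : ℝ → ℝ}
    (hu : LipschitzWith 1 u) :
    |∫ x, u x ∂P - ∑ j ∈ Finset.Icc (-(m : ℤ) ^ 2) ((m : ℤ) ^ 2),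
      u (j / m) * ∫ x, cell m j x ∂P| ≤ (m : ℝ)⁻¹ + ∫ x, tail m x ∂P := by
  have hc : ∀ j ∈ Finset.Icc (-(m : ℤ) ^ 2) ((m : ℤ) ^ 2),
      Integrable (fun x => u (j / m) * cell m j x) P := fun j _ =>
    (integrable_cell P m j).const_mul _
  have e : ∑ j ∈ Finset.Icc (-(m : ℤ) ^ 2) ((m : ℤ) ^ 2), u (j / m) * ∫ x, cell m j x ∂P =
      ∫ x, u (⌊(m : ℝ) * trunc m x⌋ / m) ∂P := by
    simp only [comp_floor_eq_sum]
    rw [integral_finsetSum _ hc]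
    simp only [integral_const_mul]
  have hi : Integrable (fun x => u (⌊(m : ℝ) * trunc m x⌋ / m)) P := by
    simp only [comp_floor_eq_sum]
    exact integrable_finsetSum _ hc
  have ht : Integrable (fun x => (m : ℝ)⁻¹ + tail m x) P :=
    (integrable_const _).add (integrable_tail hP m)
  rw [e, ← integral_sub (integrable_of_lipschitzWith hP hu) hi]
  refine (abs_integral_le_integral_abs).trans ((integral_mono
    ((integrable_of_lipschitzWith hP hu).sub hi).abs ht fun x => ?_).trans ?_)
  · have := hu.dist_le_mul x (⌊(m : ℝ) * trunc m x⌋ / m)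
    rw [Real.dist_eq, Real.dist_eq, NNReal.coe_one, one_mul] at this
    exact this.trans (abs_sub_floor_le hm x)
  · rw [integral_add (integrable_const _) (integrable_tail hP m)]
    simp

theorem tendsto_integral_tail {P : Measure ℝ} [IsFiniteMeasure P]
    (hP : Integrable (fun x : ℝ => x) P) :
    Tendsto (fun m : ℕ => ∫ x, tail m x ∂P) atTop (𝓝 0) := by
  have h := tendsto_integral_of_dominated_convergence (F := fun (m : ℕ) x => tail m x)
    (f := fun _ => (0 : ℝ)) (μ := P) (fun x => |x|)
    (fun m => (measurable_tail m).aestronglyMeasurable) hP.abs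
    (fun m => Eventually.of_forall fun x => ?_) (Eventually.of_forall fun x => ?_)
  · simpa using h
  · rw [Real.norm_eq_abs, tail, abs_of_nonneg (le_max_right _ _)]
    exact max_le (by linarith [m.cast_nonneg (α := ℝ)]) (abs_nonneg x)
  · refine tendsto_const_nhds.congr' ?_
    filter_upwards [eventually_ge_atTop ⌈|x|⌉₊] with m hm
    have : |x| ≤ m := Nat.ceil_le.1 hm
    exact (max_eq_right (by linarith)).symm

/-- Discretization reduces all 1-Lipschitz functions at once to finitely many cell probabilities, up
to an error `1 / m` plus the integral of the tail. Convergence is thus uniform over Lipschitz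
functions although only countably many means are controlled. -/
theorem w1Tendsto_of_tendsto {ι : Type*} {l : Filter ι} {Q : ι → Measure ℝ} {P : Measure ℝ}
    [IsProbabilityMeasure P] (hP : Integrable (fun x : ℝ => x) P)
    (hQ : ∀ᶠ i in l, IsProbabilityMeasure (Q i) ∧ Integrable (fun x : ℝ => x) (Q i))
    (hcell : ∀ m j, Tendsto (fun i => ∫ x, cell m j x ∂(Q i)) l (𝓝 (∫ x, cell m j x ∂P)))
    (htail : ∀ m, Tendsto (fun i => ∫ x, tail m x ∂(Q i)) l (𝓝 (∫ x, tail m x ∂P))) :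
    W1Tendsto Q l P := by
  intro ε hε
  obtain ⟨m, hm, hm1, hm2⟩ : ∃ m : ℕ, 0 < m ∧ (m : ℝ)⁻¹ < ε / 8 ∧ ∫ x, tail m x ∂P < ε / 8 :=
    ((eventually_gt_atTop 0).and (((tendsto_inv_atTop_nhds_zero_nat (𝕜 := ℝ)).eventually_lt_const
      (by positivity)).and ((tendsto_integral_tail hP).eventually_lt_const (by positivity)))).exists
  have hm0 : (0 : ℝ) < m := by exact_mod_cast hm
  have hs : Tendsto (fun i => ∑ j ∈ Finset.Icc (-(m : ℤ) ^ 2) ((m : ℤ) ^ 2),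
      (m : ℝ) * |∫ x, cell m j x ∂(Q i) - ∫ x, cell m j x ∂P|) l (𝓝 0) := by
    rw [← Finset.sum_const_zero (s := Finset.Icc (-(m : ℤ) ^ 2) ((m : ℤ) ^ 2))]
    refine tendsto_finsetSum _ fun j _ => ?_
    have := (((hcell m j).sub_const (∫ x, cell m j x ∂P)).abs).const_mul (m : ℝ)
    simpa using this
  filter_upwards [hQ, (htail m).eventually_lt_const hm2,
    hs.eventually_lt_const (show 0 < ε / 8 by positivity)] with i hi ht hsi u hu
  have := hi.1
  -- Subtracting `u 0` leaves the difference of integrals unchanged and bounds the values on the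
  -- grid by `m`, uniformly in `u`.
  have hv : LipschitzWith 1 fun x => u x - u 0 := by
    refine LipschitzWith.of_dist_le_mul fun x y => ?_
    rw [dist_sub_right]; exact hu.dist_le_mul x y
  have h1 := abs_integral_sub_sum_le hi.2 hm hv
  have h2 := abs_integral_sub_sum_le hP hm hv
  have h3 : |∑ j ∈ Finset.Icc (-(m : ℤ) ^ 2) ((m : ℤ) ^ 2),
        (u (j / m) - u 0) * ∫ x, cell m j x ∂(Q i) -
      ∑ j ∈ Finset.Icc (-(m : ℤ) ^ 2) ((m : ℤ) ^ 2),
        (u (j / m) - u 0) * ∫ x, cell m j x ∂P| ≤ ε / 8 := by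
    rw [← Finset.sum_sub_distrib]
    refine (Finset.abs_sum_le_sum_abs _ _).trans (le_trans (Finset.sum_le_sum fun j hj => ?_)
      hsi.le)
    rw [← mul_sub, abs_mul]
    refine mul_le_mul_of_nonneg_right ?_ (abs_nonneg _)
    have h4 := hu.dist_le_mul (j / m) 0
    rw [Real.dist_eq, Real.dist_eq, NNReal.coe_one, one_mul, sub_zero] at h4
    refine h4.trans ?_
    rw [abs_div, abs_of_pos hm0, div_le_iff₀ hm0, ← sq, abs_le]
    rw [Finset.mem_Icc] at hj
    exact ⟨by exact_mod_cast hj.1, by exact_mod_cast hj.2⟩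
  have e1 : ∫ x, (u x - u 0) ∂(Q i) = ∫ x, u x ∂(Q i) - u 0 := by
    rw [integral_sub (integrable_of_lipschitzWith hi.2 hu) (integrable_const _)]; simp
  have e2 : ∫ x, (u x - u 0) ∂P = ∫ x, u x ∂P - u 0 := by
    rw [integral_sub (integrable_of_lipschitzWith hP hu) (integrable_const _)]; simp
  rw [e1] at h1
  rw [e2] at h2
  rw [abs_le] at h1 h2 h3 ⊢
  constructor <;> linarith [h1.1, h1.2, h2.1, h2.2, h3.1, h3.2]

/-! ### Random samples -/

/-- Test functions that determine the convergence of empirical measures, and a further one. -/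
noncomputable def testFun (w : ℝ → ℝ) : (ℕ × ℤ) ⊕ ℕ ⊕ Unit → ℝ → ℝ :=
  Sum.elim (fun c => cell c.1 c.2) (Sum.elim tail fun _ => w)

/-- A size, a sample, a centre and a shift. -/
abbrev Sample : Type := ℕ × (ℕ → ℝ) × ℝ × ℝ

/-- The filter of samples whose sizes tend to infinity, whose means of test functions tend to the
integrals with respect to `P`, with centres that tend to `θ₀` and shifts that tend to `0`. -/
noncomputable def sampleFilter (P : Measure ℝ) (θ₀ : ℝ) (w : ℝ → ℝ) : Filter Sample :=
  (((comap (fun s => s.1) atTop) ⊓ (comap (fun s => s.2.2.1) (𝓝 θ₀))) ⊓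
    (comap (fun s => s.2.2.2) (𝓝 0))) ⊓
    ⨅ c, comap (fun s => ∫ t, testFun w c t ∂(empiricalMeasure s.1 s.2.1))
      (𝓝 (∫ t, testFun w c t ∂P))

section sampleFilter

variable {P : Measure ℝ} {θ₀ : ℝ} {w : ℝ → ℝ}

/-- Dominated convergence along a filter requires countable generation; this is why a countable
family of test functions is used. -/
instance isCountablyGenerated_sampleFilter : (sampleFilter P θ₀ w).IsCountablyGenerated := by
  unfold sampleFilter
  infer_instance

theorem le_sampleFilter_iff {l : Filter Sample} : l ≤ sampleFilter P θ₀ w ↔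
    ((Tendsto (fun s : Sample => s.1) l atTop ∧ Tendsto (fun s : Sample => s.2.2.1) l (𝓝 θ₀)) ∧
    Tendsto (fun s : Sample => s.2.2.2) l (𝓝 0)) ∧
    ∀ c, Tendsto (fun s : Sample => ∫ t, testFun w c t ∂(empiricalMeasure s.1 s.2.1)) l
      (𝓝 (∫ t, testFun w c t ∂P)) := by
  simp only [sampleFilter, le_inf_iff, le_iInf_iff, tendsto_iff_comap]

theorem sampleTendsto_sampleFilter [IsProbabilityMeasure P]
    (hP : Integrable (fun x : ℝ => x) P) :
    SampleTendsto (sampleFilter P θ₀ w) (fun s => s.1) (fun s => s.2.1) (fun s => s.2.2.1) P θ₀ ∧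
    Tendsto (fun s : Sample => s.2.2.2) (sampleFilter P θ₀ w) (𝓝 0) ∧
    Tendsto (fun s : Sample => ∫ t, w t ∂(empiricalMeasure s.1 s.2.1)) (sampleFilter P θ₀ w)
      (𝓝 (∫ t, w t ∂P)) := by
  obtain ⟨⟨⟨h1, h2⟩, h3⟩, h4⟩ := le_sampleFilter_iff.1 (le_refl (sampleFilter P θ₀ w))
  refine ⟨⟨h1, h2, w1Tendsto_of_tendsto hP ?_ (fun m j => h4 (Sum.inl (m, j)))
    fun m => h4 (Sum.inr (Sum.inl m))⟩, h3, h4 (Sum.inr (Sum.inr ()))⟩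
  filter_upwards [h1.eventually (eventually_ne_atTop 0)] with s hs
  exact ⟨isProbabilityMeasure_empiricalMeasure hs _, integrable_empiricalMeasure hs _ _⟩

end sampleFilter

section random

variable {Ω : Type*} [MeasurableSpace Ω] {μ : Measure Ω} {P : Measure ℝ} {θ₀ : ℝ} {w : ℝ → ℝ}
  {X : ℕ → Ω → ℝ} {θbar y : ℕ → Ω → ℝ}

/-- The random sample of size `n`. -/
def sampleAt (X θbar y : ℕ → Ω → ℝ) (n : ℕ) (ω : Ω) : Sample :=
  (n, fun i => X i ω, θbar n ω, y n ω)

theorem ae_tendsto_testFun [IsProbabilityMeasure μ] [IsProbabilityMeasure P]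
    (hP : Integrable (fun x : ℝ => x) P) (hwm : Measurable w) (hw : Integrable w P)
    (hXm : ∀ i, Measurable (X i)) (hX : iIndepFun X μ) (hXP : ∀ i, μ.map (X i) = P)
    (c : (ℕ × ℤ) ⊕ ℕ ⊕ Unit) :
    Measurable (testFun w c) ∧ ∀ᵐ ω ∂μ, Tendsto
      (fun n => ∫ t, testFun w c t ∂(empiricalMeasure n fun i => X i ω)) atTop
      (𝓝 (∫ t, testFun w c t ∂P)) := by
  have hT : Measurable (testFun w c) ∧ Integrable (testFun w c) P := by
    rcases c with c | m | u
    · exact ⟨measurable_cell _ _, integrable_cell P _ _⟩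
    · exact ⟨measurable_tail m, integrable_tail hP m⟩
    · exact ⟨hwm, hw⟩
  obtain ⟨hm, hi⟩ := hT
  refine ⟨hm, ?_⟩
  have hint : Integrable (fun ω => testFun w c (X 0 ω)) μ := by
    rw [← hXP 0] at hi
    exact hi.comp_measurable (hXm 0)
  have h := strong_law_ae_real (μ := μ) (fun i ω => testFun w c (X i ω)) hint
    (fun i j hij => (hX.indepFun hij).comp hm hm)
    (fun i => (IdentDistrib.mk (hXm i).aemeasurable (hXm 0).aemeasurable
      ((hXP i).trans (hXP 0).symm)).comp hm)
  have e : μ[fun ω => testFun w c (X 0 ω)] = ∫ t, testFun w c t ∂P := by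
    rw [← hXP 0, integral_map (hXm 0).aemeasurable hm.aestronglyMeasurable]
  rw [e] at h
  filter_upwards [h] with ω hω
  refine hω.congr fun n => ?_
  rw [integral_empiricalMeasure, div_eq_inv_mul]

/-- Outside one null set, the strong law holds for the countably many test functions together, so
the path of samples maps `atTop` into the sample filter. -/
theorem convAS_of_tendsto [IsProbabilityMeasure μ] [IsProbabilityMeasure P]
    (hP : Integrable (fun x : ℝ => x) P) (hwm : Measurable w) (hw : Integrable w P)
    (hXm : ∀ i, Measurable (X i)) (hX : iIndepFun X μ) (hXP : ∀ i, μ.map (X i) = P)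
    (hθ : ∀ᵐ ω ∂μ, Tendsto (fun n => θbar n ω) atTop (𝓝 θ₀))
    (hy : ∀ᵐ ω ∂μ, Tendsto (fun n => y n ω) atTop (𝓝 0)) {D : Sample → ℝ≥0∞}
    (hD : Tendsto D (sampleFilter P θ₀ w) (𝓝 0)) :
    ConvAS μ fun n ω => D (sampleAt X θbar y n ω) := by
  have hT := ae_all_iff.2 fun c => (ae_tendsto_testFun hP hwm hw hXm hX hXP c).2
  unfold ConvAS
  filter_upwards [hT, hθ, hy] with ω h1 h2 h3
  have hle : map (fun n => sampleAt X θbar y n ω) atTop ≤ sampleFilter P θ₀ w :=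
    le_sampleFilter_iff.2 ⟨⟨⟨tendsto_map'_iff.2 tendsto_id, tendsto_map'_iff.2 h2⟩,
      tendsto_map'_iff.2 h3⟩, fun c => tendsto_map'_iff.2 (h1 c)⟩
  exact hD.comp (tendsto_iff_comap.2 (map_le_iff_le_comap.1 hle))

/-- The sets that contain the random samples with probability tending to one. -/
def inProbFilter (μ : Measure Ω) (Z : ℕ → Ω → Sample) : Filter Sample where
  sets := {A | Tendsto (fun n => μ {ω | Z n ω ∉ A}) atTop (𝓝 0)}
  univ_sets := by simp
  sets_of_superset {A B} hA hAB := by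
    refine tendsto_of_tendsto_of_tendsto_of_le_of_le tendsto_const_nhds hA
      (fun _ => zero_le) fun n => measure_mono fun ω hω hωA => hω (hAB hωA)
  inter_sets {A B} hA hB := by
    have h := Tendsto.add hA hB
    rw [add_zero] at h
    refine tendsto_of_tendsto_of_tendsto_of_le_of_le tendsto_const_nhds h
      (fun _ => zero_le) fun n => (measure_mono fun ω hω => ?_).trans (measure_union_le _ _)
    by_contra hcon
    have h1 : ¬ (Z n ω ∉ A ∨ Z n ω ∉ B) := hcon
    push Not at h1
    exact hω h1

theorem mem_inProbFilter {Z : ℕ → Ω → Sample} {A : Set Sample} :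
    A ∈ inProbFilter μ Z ↔ Tendsto (fun n => μ {ω | Z n ω ∉ A}) atTop (𝓝 0) := Iff.rfl

theorem tendsto_inProbFilter {Z : ℕ → Ω → Sample} {F : Sample → ℝ} {c : ℝ}
    (h : TendstoInMeasure μ (fun n ω => F (Z n ω)) atTop fun _ => c) :
    Tendsto F (inProbFilter μ Z) (𝓝 c) := by
  rw [Metric.tendsto_nhds]
  intro ε hε
  rw [tendstoInMeasure_iff_dist] at h
  refine mem_inProbFilter.2 ((h ε hε).congr fun n => ?_)
  congr 1
  ext ω
  simp

/-- The filter of sets that are likely for large `n` is finer than the sample filter, because each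
generating condition holds in probability. No subsequences are needed. Only monotonicity and
subadditivity of `μ` enter, so `D` need not be measurable. -/
theorem convInProb_of_tendsto [IsProbabilityMeasure μ] [IsProbabilityMeasure P]
    (hP : Integrable (fun x : ℝ => x) P) (hwm : Measurable w) (hw : Integrable w P)
    (hXm : ∀ i, Measurable (X i)) (hX : iIndepFun X μ) (hXP : ∀ i, μ.map (X i) = P)
    (hθ : TendstoInMeasure μ θbar atTop fun _ => θ₀)
    (hy : TendstoInMeasure μ y atTop fun _ => 0) {D : Sample → ℝ≥0∞}
    (hD : Tendsto D (sampleFilter P θ₀ w) (𝓝 0)) :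
    ConvInProb μ fun n ω => D (sampleAt X θbar y n ω) := by
  have hle : inProbFilter μ (sampleAt X θbar y) ≤ sampleFilter P θ₀ w := by
    refine le_sampleFilter_iff.2 ⟨⟨⟨?_, tendsto_inProbFilter hθ⟩, tendsto_inProbFilter hy⟩,
      fun c => tendsto_inProbFilter ?_⟩
    · refine tendsto_atTop.2 fun b => mem_inProbFilter.2 ?_
      refine tendsto_const_nhds.congr' ?_
      filter_upwards [eventually_ge_atTop b] with n hn
      have h0 : {ω | ¬b ≤ (sampleAt X θbar y n ω).1} = ∅ :=
        eq_empty_of_forall_notMem fun ω hω => hω hn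
      exact ((congrArg μ h0).trans measure_empty).symm
    · obtain ⟨hm, hae⟩ := ae_tendsto_testFun hP hwm hw hXm hX hXP c
      refine tendstoInMeasure_of_tendsto_ae (fun n => ?_) hae
      simp only [sampleAt, integral_empiricalMeasure]
      exact ((Finset.measurable_sum _ fun i _ => hm.comp (hXm i)).const_mul _).aestronglyMeasurable
  intro ε hε
  have h1 : ∀ᶠ s in inProbFilter μ (sampleAt X θbar y), D s < ε :=
    (hD.mono_left hle).eventually_lt_const hε
  refine (mem_inProbFilter.1 h1).congr fun n => ?_
  congr 1
  ext ω
  simp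

end random

/-! ### The consistency theorem -/

section consistency

variable {Ω : Type*} {conv : (ℕ → Ω → ℝ≥0∞) → Prop} {X θbar y : ℕ → Ω → ℝ}
  {l : Filter Sample} {q f₀ : ℝ → ℝ} {θ₀ : ℝ} {G : Sample → ℝ → ℝ}

theorem MeanTendsto.locallyConsistent (hq : LogConc q) (hG : MeanTendsto l G q)
    (hy : Tendsto (fun s : Sample => s.2.2.2) l (𝓝 0)) :
    LocallyConsistent l G (fun s => s.2.2.2) q := by
  obtain ⟨h₁, h₂, a1, a2, a3, a4, a5⟩ := hG
  exact locallyConsistent_of_tendsto a1 a2 hq a3 a4 hy a5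

theorem MeanTendsto.compactlyConsistent (hq : LogConc q) (hG : MeanTendsto l G q)
    (hy : Tendsto (fun s : Sample => s.2.2.2) l (𝓝 0))
    (hconv : ∀ D : Sample → ℝ≥0∞, Tendsto D l (𝓝 0) →
      conv fun n ω => D (sampleAt X θbar y n ω)) :
    CompactlyConsistent conv (fun n ω => G (sampleAt X θbar y n ω)) y q := by
  obtain ⟨h1, h2, h3⟩ := hG.locallyConsistent hq hy
  unfold CompactlyConsistent LogConsistent ScoreConsistent
  rw [dom_logDensity]
  exact ⟨fun K hK hKs => hconv _ (h1 K hK hKs), fun K hK hKs => hconv _ (h2 K hK hKs),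
    fun x hx hc => hconv _ (h3 x hx hc)⟩

theorem MeanTendsto.globallyConsistent (hq : LogConc q) (hG : MeanTendsto l G q)
    (hy : Tendsto (fun s : Sample => s.2.2.2) l (𝓝 0))
    (hconv : ∀ D : Sample → ℝ≥0∞, Tendsto D l (𝓝 0) →
      conv fun n ω => D (sampleAt X θbar y n ω)) (hqc : Continuous q)
    (hq0 : Tendsto q (cocompact ℝ) (𝓝 0)) {p : ℝ} (hp : 0 < q p) :
    GloballyConsistent conv (fun n ω => G (sampleAt X θbar y n ω)) y q := by
  refine ⟨?_, (hG.compactlyConsistent hq hy hconv).2⟩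
  obtain ⟨h₁, h₂, a1, a2, a3, a4, a5⟩ := hG
  exact hconv _ (tendsto_supDev_univ a1 a2 hq a3 a4 hy a5 hqc hq0 hp)

theorem isProj_projDensity (hf : f₀ ∈ Densities) (hi : Integrable fun x => |x| * f₀ x) :
    IsProj (law f₀) (projDensity f₀) := by
  have := isProbabilityMeasure_law hf
  have := nullSingletonClass_law f₀
  obtain ⟨a, b, δ, H⟩ := exists_spread (law f₀)
  exact isProj_logProjection H (integrable_id_law hf hi)

theorem IsProj.integral_eq_one_of_law (hf : f₀ ∈ Densities) {p : ℝ → ℝ}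
    (hp : IsProj (law f₀) p) : ∫ x, p x = 1 := by
  have := isProbabilityMeasure_law hf
  have := nullSingletonClass_law f₀
  obtain ⟨a, b, δ, H⟩ := exists_spread (law f₀)
  exact hp.integral_eq_one H

theorem LogConc.comp_add {p : ℝ → ℝ} (hp : LogConc p) (θ : ℝ) : LogConc fun z => p (z + θ) := by
  simpa using hp.comp_affine 1 θ

theorem LogConc.gaussAvg_comp_add {p : ℝ → ℝ} (hp : LogConc p) (hi : Integrable p)
    (h1 : ∫ x, p x = 1) (θ : ℝ) {b : ℝ} (hb : 0 ≤ b) :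
    LogConc (LogConcaveLocation.gaussAvg b fun z => p (z + θ)) := by
  refine (hp.comp_add θ).gaussAvg (hi.comp_add_right θ) ?_ hb
  rw [integral_add_right_eq_self, h1]
  exact one_pos

theorem conclusionP1_of_conv (hf : f₀ ∈ SymDensities θ₀) (hi : Integrable fun x => |x| * f₀ x)
    (hconv : ∀ w : ℝ → ℝ, Measurable w → Integrable w (law f₀) → ∀ D : Sample → ℝ≥0∞,
      Tendsto D (sampleFilter (law f₀) θ₀ w) (𝓝 0) →
        conv fun n ω => D (sampleAt X θbar y n ω)) :
    ConclusionP1 conv X θbar y f₀ θ₀ := by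
  have := isProbabilityMeasure_law hf.1
  have hP := integrable_id_law hf.1 hi
  have hp := isProj_projDensity hf.1 hi
  have hq := hp.adm.logConc.comp_add θ₀
  refine ⟨?_, fun hi2 => ?_⟩
  -- Without smoothing the extra test function is a dummy; with smoothing it is `t ^ 2`, which
  -- supplies the convergence of empirical second moments.
  · obtain ⟨hS, hy, -⟩ := sampleTendsto_sampleFilter (θ₀ := θ₀) (w := fun _ => 0) hP
    have hc := hconv (fun _ => 0) measurable_const (integrable_zero _ _ _)
    obtain ⟨⟨E₁, E₂, E₃⟩, M₁, M₂⟩ := hS.meanTendsto hf hi hp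
    rintro g (rfl | rfl | rfl | rfl | rfl)
    · have h := M₁.compactlyConsistent hq hy hc
      exact h
    · have h := (meanTendsto_single E₃).compactlyConsistent hq hy hc
      exact h
    · have h := M₂.compactlyConsistent hq hy hc
      exact h
    · have h := (meanTendsto_single E₁).compactlyConsistent hq hy hc
      exact h
    · have h := (meanTendsto_single E₂).compactlyConsistent hq hy hc
      exact h
  · obtain ⟨hS, hy, hw⟩ := sampleTendsto_sampleFilter (θ₀ := θ₀) (w := fun t => t ^ 2) hP
    have hc := hconv (fun t => t ^ 2) (by fun_prop) ((integrable_law_iff hf.1).2 hi2)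
    rw [integral_law hf.1] at hw
    obtain ⟨M₁, M₂, M₃⟩ := hS.meanTendsto_smooth hf hi hi2 hp hw
    have hqs := hp.adm.logConc.gaussAvg_comp_add hp.adm.int (hp.integral_eq_one_of_law hf.1) θ₀
      (Real.sqrt_nonneg (∫ z, z ^ 2 * (f₀ z - projDensity f₀ z)))
    rw [smoothedProj_eq_gaussAvg hp.adm.usc.measurable]
    rintro g (rfl | rfl | rfl)
    · have h := M₁.compactlyConsistent hqs hy hc
      exact h
    · have h := M₂.compactlyConsistent hqs hy hc
      exact h
    · have h := M₃.compactlyConsistent hqs hy hc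
      exact h

theorem mem_logConcaveDensities_of_mem_modelP0 (hf : f₀ ∈ ModelP0) :
    f₀ ∈ LogConcaveDensities := by
  obtain ⟨hd, θ, g, hg, hfg, -⟩ := hf
  obtain ⟨hc, hu, -, -⟩ := logConc_of_mem_logConcaveDensities hg.1
  have e : f₀ = fun x => g (x + -θ) := by
    funext x; rw [hfg, sub_eq_add_neg]
  refine ⟨hd, ?_⟩
  obtain ⟨p, hp⟩ := (exists_eq_logDensity hg.1.2).2.2.2
  rw [expFun_logDensity hg.1.1.2.1] at hp
  refine logDensity_mem_concaveClass (e ▸ hc.comp_add (-θ)) ?_ ⟨p + θ, by simpa [e] using hp⟩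
  rw [e]
  exact hu.comp (by fun_prop : Continuous fun x : ℝ => x + -θ)

theorem integrable_abs_mul_of_mem_modelP0 (hf : f₀ ∈ ModelP0) :
    Integrable fun x => |x| * f₀ x := by
  have hlc := mem_logConcaveDensities_of_mem_modelP0 hf
  obtain ⟨A, B, hB, -, hE⟩ := exists_envelope_of_mem_logConcaveDensities hlc
  exact integrable_mul_of_envelope hB hlc.1.1 hlc.1.2.1 hE (by fun_prop) (C := 1) fun x => by
    rw [abs_abs]; nlinarith [sq_nonneg x]

/-- Finiteness of the infimum only provides some integrable derivative; continuity follows from the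
fundamental theorem of calculus. -/
theorem continuous_of_fisherInformation_lt_top (hf : fisherInformation f₀ < ∞) :
    Continuous f₀ := by
  unfold fisherInformation at hf
  simp only [iInf_lt_iff] at hf
  obtain ⟨f', ⟨hi, hd⟩, -⟩ := hf
  have e : f₀ = fun x => f₀ 0 + ∫ t in (0 : ℝ)..x, f' t := by
    funext x
    rw [← hd 0 x]; ring
  rw [e]
  exact continuous_const.add
    (intervalIntegral.continuous_primitive (fun a b => hi.intervalIntegrable) 0)

theorem tendsto_cocompact_of_envelope {f : ℝ → ℝ} {A B : ℝ} (hB : 0 < B) (h0 : ∀ x, 0 ≤ f x)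
    (hE : ∀ x, f x ≤ A * Real.exp (-(B * |x|))) : Tendsto f (cocompact ℝ) (𝓝 0) := by
  have h1 : Tendsto (fun x : ℝ => |x|) (cocompact ℝ) atTop := tendsto_norm_cocompact_atTop
  have h2 : Tendsto (fun x : ℝ => A * Real.exp (-(B * |x|))) (cocompact ℝ) (𝓝 (A * 0)) :=
    (Real.tendsto_exp_atBot.comp
      (tendsto_neg_atTop_atBot.comp (h1.const_mul_atTop hB))).const_mul A
  rw [mul_zero] at h2
  exact tendsto_of_tendsto_of_tendsto_of_le_of_le tendsto_const_nhds h2 h0 hE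

theorem conclusionP0_of_conv (hf : f₀ ∈ SymDensities θ₀) (hf0 : f₀ ∈ ModelP0)
    (hconv : ∀ w : ℝ → ℝ, Measurable w → Integrable w (law f₀) → ∀ D : Sample → ℝ≥0∞,
      Tendsto D (sampleFilter (law f₀) θ₀ w) (𝓝 0) →
        conv fun n ω => D (sampleAt X θbar y n ω)) :
    ConclusionP0 conv X θbar y f₀ θ₀ := by
  have hlc := mem_logConcaveDensities_of_mem_modelP0 hf0
  have hi := integrable_abs_mul_of_mem_modelP0 hf0
  obtain ⟨-, -, -, -, -, hfi⟩ := hf0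
  have hcont := continuous_of_fisherInformation_lt_top hfi
  have := isProbabilityMeasure_law hf.1
  have hp := isProj_law_self hlc
  obtain ⟨A, B, hB, -, hE⟩ := exists_envelope_of_mem_logConcaveDensities hlc
  have hi2 : Integrable fun x => x ^ 2 * f₀ x :=
    integrable_mul_of_envelope hB hf.1.1 hf.1.2.1 hE (by fun_prop) (C := 1) fun x => by
      rw [abs_of_nonneg (sq_nonneg x)]; linarith [abs_nonneg x]
  have hP := integrable_id_law hf.1 hi
  have hq := hp.adm.logConc.comp_add θ₀
  have hqc : Continuous fun z => f₀ (z + θ₀) := by fun_prop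
  have hq0 : Tendsto (fun z => f₀ (z + θ₀)) (cocompact ℝ) (𝓝 0) :=
    (tendsto_cocompact_of_envelope hB hf.1.2.1 hE).comp
      (Homeomorph.addRight θ₀).isClosedEmbedding.tendsto_cocompact
  obtain ⟨p, hpp⟩ := hp.adm.pos.exists
  have hpos : 0 < f₀ (p - θ₀ + θ₀) := by rwa [sub_add_cancel]
  obtain ⟨hS, hy, hw⟩ := sampleTendsto_sampleFilter (θ₀ := θ₀) (w := fun t => t ^ 2) hP
  have hc := hconv (fun t => t ^ 2) (by fun_prop) ((integrable_law_iff hf.1).2 hi2)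
  rw [integral_law hf.1] at hw
  obtain ⟨⟨-, -, E₃⟩, M₁, M₂⟩ := hS.meanTendsto hf hi hp
  obtain ⟨M₃, -, -⟩ := hS.meanTendsto_smooth hf hi hi2 hp hw
  -- The projection of `f₀` is `f₀` itself, so the limiting bandwidth vanishes and the smoothed
  -- estimator has the unsmoothed limit.
  simp only [sub_self, mul_zero, integral_zero, Real.sqrt_zero, gaussAvg_zero] at M₃
  rintro g (rfl | rfl | rfl | rfl)
  · have h := M₁.globallyConsistent hq hy hc hqc hq0 hpos
    exact h
  · have h := M₃.globallyConsistent hq hy hc hqc hq0 hpos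
    exact h
  · have h := (meanTendsto_single E₃).globallyConsistent hq hy hc hqc hq0 hpos
    exact h
  · have h := M₂.globallyConsistent hq hy hc hqc hq0 hpos
    exact h

theorem interior_subset_interior_dom (hf : f₀ ∈ Densities)
    (hi : Integrable fun x => |x| * f₀ x) :
    interior {x | 0 < f₀ (x + θ₀)} ⊆ interior (dom (logDensity (centeredProj f₀ θ₀))) := by
  have hp := isProj_projDensity hf hi
  have h1 := (hp.comp_add θ₀).adm
  rw [law_map_sub hf.1] at h1
  rw [dom_logDensity]
  refine interior_subset_of_ae_pos (mem_densities_add hf θ₀) (hp.adm.logConc.comp_add θ₀) ?_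
  simpa only [centeredProj, add_comm θ₀] using h1.pos

theorem dom_smoothedProj (hf : f₀ ∈ Densities) (hi : Integrable fun x => |x| * f₀ x)
    (hv : 0 < smoothingVariance f₀) : dom (logDensity (smoothedProj f₀ θ₀)) = univ := by
  have hp := isProj_projDensity hf hi
  rw [dom_logDensity, smoothedProj_eq_gaussAvg hp.adm.usc.measurable]
  refine eq_univ_of_forall fun x => gaussAvg_pos (Real.sqrt_pos.2 hv)
    (hp.adm.int.comp_add_right θ₀) (fun _ => hp.adm.logConc.nonneg _) ?_ x
  rw [integral_add_right_eq_self, hp.integral_eq_one_of_law hf]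
  exact one_pos

end consistency

end LogConcaveLocation

theorem mainTheorem9 {Ω : Type*} [MeasurableSpace Ω] (μ : Measure Ω) [IsProbabilityMeasure μ]
    (f₀ : ℝ → ℝ) (θ₀ : ℝ) (hsym : f₀ ∈ SymDensities θ₀)
    (X : ℕ → Ω → ℝ) (hXm : ∀ i, Measurable (X i)) (hXindep : iIndepFun X μ)
    (hXlaw : ∀ i, μ.map (X i) = law f₀)
    (θbar : ℕ → Ω → ℝ) (hθm : ∀ n, Measurable (θbar n))
    (hθ : TendstoInMeasure μ θbar atTop (fun _ => θ₀))
    (y : ℕ → Ω → ℝ) (hym : ∀ n, Measurable (y n))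
    (hy : TendstoInMeasure μ y atTop (fun _ => 0)) :
    (f₀ ∈ ModelP1 →
      interior {x | 0 < f₀ (x + θ₀)} ⊆ interior (dom (logDensity (centeredProj f₀ θ₀))) ∧
      (Integrable (fun z => z ^ 2 * f₀ z) → 0 < smoothingVariance f₀ →
        dom (logDensity (smoothedProj f₀ θ₀)) = Set.univ) ∧
      ConclusionP1 (ConvInProb μ) X θbar y f₀ θ₀ ∧
      ((∀ᵐ ω ∂μ, Tendsto (fun n => θbar n ω) atTop (𝓝 θ₀)) →
        (∀ᵐ ω ∂μ, Tendsto (fun n => y n ω) atTop (𝓝 0)) →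
        ConclusionP1 (ConvAS μ) X θbar y f₀ θ₀)) ∧
    (f₀ ∈ ModelP0 →
      ConclusionP0 (ConvInProb μ) X θbar y f₀ θ₀ ∧
      ((∀ᵐ ω ∂μ, Tendsto (fun n => θbar n ω) atTop (𝓝 θ₀)) →
        (∀ᵐ ω ∂μ, Tendsto (fun n => y n ω) atTop (𝓝 0)) →
        ConclusionP0 (ConvAS μ) X θbar y f₀ θ₀)) := by
  have := isProbabilityMeasure_law hsym.1
  have hAS : Integrable (fun x => |x| * f₀ x) →
      (∀ᵐ ω ∂μ, Tendsto (fun n => θbar n ω) atTop (𝓝 θ₀)) →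
      (∀ᵐ ω ∂μ, Tendsto (fun n => y n ω) atTop (𝓝 0)) →
      ∀ w : ℝ → ℝ, Measurable w → Integrable w (law f₀) → ∀ D : Sample → ℝ≥0∞,
        Tendsto D (sampleFilter (law f₀) θ₀ w) (𝓝 0) →
          ConvAS μ fun n ω => D (sampleAt X θbar y n ω) :=
    fun hi h1 h2 w hwm hw D hD =>
      convAS_of_tendsto (integrable_id_law hsym.1 hi) hwm hw hXm hXindep hXlaw h1 h2 hD
  have hP : Integrable (fun x => |x| * f₀ x) →
      ∀ w : ℝ → ℝ, Measurable w → Integrable w (law f₀) → ∀ D : Sample → ℝ≥0∞,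
        Tendsto D (sampleFilter (law f₀) θ₀ w) (𝓝 0) →
          ConvInProb μ fun n ω => D (sampleAt X θbar y n ω) :=
    fun hi w hwm hw D hD =>
      convInProb_of_tendsto (integrable_id_law hsym.1 hi) hwm hw hXm hXindep hXlaw hθ hy hD
  refine ⟨fun h1 => ?_, fun h0 => ?_⟩
  · have hi := h1.2.2.2
    exact ⟨interior_subset_interior_dom hsym.1 hi, fun _ hv => dom_smoothedProj hsym.1 hi hv,
      conclusionP1_of_conv hsym hi (hP hi),
      fun hθ' hy' => conclusionP1_of_conv hsym hi (hAS hi hθ' hy')⟩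
  · have hi := integrable_abs_mul_of_mem_modelP0 h0
    exact ⟨conclusionP0_of_conv hsym h0 (hP hi),
      fun hθ' hy' => conclusionP0_of_conv hsym h0 (hAS hi hθ' hy')⟩
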